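/- **Conventions.** Metrics on four-manifolds have signature $(-,+,+,+)$; $\nabla_a\nabla_b v_c-\nabla_b\nabla_a v_c=R_{abcd}v^d$, $R_{bd}=g^{ac}R_{abcd}$; the Schouten tensor is $P_{ab}=\frac12R_{ab}-\frac1{12}Rg_{ab}$ in dimension $4$ and $P^{(3)}_{ab}=R^{(3)}_{ab}-\frac14R^{(3)}h_{ab}$ in dimension $3$; the Weyl tensor $C_{abcd}$ is defined by $R_{abcd}=C_{abcd}+2(g_{c[a}P_{b]d}+g_{d[b}P_{a]c})$; the Cotton tensor is $A_{abc}=2\nabla_{[b}P_{c]a}$, and $A^{(3)}_{abc}=2D_{[b}P^{(3)}_{c]a}$. **Setting.** Let $\mathcal M$ be a smooth four-manifold with boundary, $g$ a smooth Lorentzian metric on $\mathcal M$ and $\Omega$ a smooth function with $\Omega>0$ in the interior and $\Omega=0$ on $\partial\mathcal M$. Let $\hat g=\Omega^{-2}g$ on the interior $\widehat{\mathcal M}$ be asymptotically de Sitter: $\widehat R_{ab}-\frac12\widehat R\hat g_{ab}+\widehat\Lambda\hat g_{ab}=\widehat T_{ab}$ with $\widehat\Lambda>0$, where $\widehat T_{ab}=\Omega^qT_{ab}$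 with $q\ge0$ and $T_{ab}$ smooth on $\mathcal M$. Assume that the rescaled Weyl tensor $d_{abcd}=\Omega^{-1}C_{abcd}$ (the Weyl tensor of $g$, indices moved with $g$) and the rescaled Cotton tensor $Q_{abc}=\Omega^{-1}\widehat A_{abc}$ (the Cotton tensor of $\hat g$) extend smoothly to $\mathcal M$. Put $s=\frac1{24}R\,\Omega+\frac14\Box\Omega$ and $\mathring T_{ab}=\widehat T_{ab}-\frac14\widehat T\hat g_{ab}$, where $\widehat T=\Omega^2g^{ab}\widehat T_{ab}$, and assume that Friedrich's conformal Einstein field equations hold on $\mathcal M$: $$\nabla_a\nabla_b\Omega=-\Omega P_{ab}+sg_{ab}+\tfrac{\Omega}{2}\mathring T_{ab},\qquad \nabla_as=-P_a{}^b\nabla_b\Omega+\tfrac16\nabla^c(\Omega\mathring T_{ac}),\qquad \nabla_dd^d{}_{abc}=Q_{abc},$$ $$2\nabla_{[b}P_{c]a}=d^d{}_{abc}\nabla_d\Omega+\Omega Q_{abc},\qquad \widehat\Lambda=6\Omega s-3\nabla_c\Omega\nabla^c\Omega+\tfrac14\widehat T,$$ together with $\widehat\nabla^b\widehat T_{ab}=0$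 on $\widehat{\mathcal M}$. **Theorem.** Under these assumptions the conformal boundary $\mathcal I^+=\mathcal Z(\Omega)=\partial\mathcal M$ is spacelike. Let $n^a$ be its unit normal, $n^an_a=-1$, pointing into $\mathcal M$ (in the direction of increasing $\Omega$); let $\perp$ denote contraction with $n^a$ and $\top$ projection to $\mathcal I^+$; let $h_{ab}$ be the induced metric, $D_a$ its Levi-Civita connection, $P^{(3)}_{ab}$ and $A^{(3)}_{abc}$ its Schouten and Cotton tensors, $K_{ab}=\nabla_an_b+n_an^c\nabla_cn_b$ the extrinsic curvature, and $e_{ab}=d^\top_{a\perp b\perp}$, $b_{abc}=d^\top_{abc\perp}$ the electric and magnetic parts of $d_{abcd}$. Then on $\mathcal I^+$ $$\nabla_\perp\Omega=\sqrt{\tfrac{\widehat\Lambda}{3}},\qquad K_{ab}=-\sqrt{\tfrac{3}{\widehat\Lambda}}\,s\,h_{ab},\qquad P^\top_{a\perp}=\sqrt{\tfrac{3}{\widehat\Lambda}}\,D_as,\qquad P^\top_{ab}=P^{(3)}_{ab}+\frac{3}{2\widehat\Lambda}s^2h_{ab},$$ $$b_{abc}=\sqrt{\tfrac{3}{\widehat\Lambda}}\,A^{(3)}_{cab},\qquad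 D^be_{ab}=-Q^\top_{\perp\perp a},\qquad Q^\top_{\perp ab}=0.$$ -/

import Mathlib

open scoped Manifold ContDiff

namespace ConformalBoundary

noncomputable section

/-! ### Tensor calculus in a coordinate domain

A covariant tensor field of rank `k` is given by its components `T x ![a₁, …, aₖ]`.  All partial
derivatives are taken within a set `D` of coordinates: the closed half space `{x | 0 ≤ x 0}` for a
chart of a manifold with boundary (one-sided derivatives at the boundary), and the whole space for
the coordinates of the boundary itself. -/

/-- The coordinate space `ℝⁿ`. -/
abbrev Coord (n : ℕ) := EuclideanSpace ℝ (Fin n)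

/-- Component functions of a covariant tensor field of rank `k` on `ℝⁿ`. -/
abbrev CoordTensor (n k : ℕ) := Coord n → (Fin k → Fin n) → ℝ

section Coordinates

variable {n k : ℕ}

/-- `∂ₐ f`, the derivative being taken within `D`. -/
def pd (D : Set (Coord n)) (f : Coord n → ℝ) (a : Fin n) (x : Coord n) : ℝ :=
  fderivWithin ℝ f D x (EuclideanSpace.single a 1)

/-- The inverse metric `gᵃᵇ`. -/
def invMetric (G : CoordTensor n 2) (x : Coord n) : Matrix (Fin n) (Fin n) ℝ :=
  (Matrix.of fun a b => G x ![a, b])⁻¹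

/-- The Christoffel symbol `Γᶜₐᵦ` of the Levi-Civita connection of `G`. -/
def christoffel (D : Set (Coord n)) (G : CoordTensor n 2) (x : Coord n) (c a b : Fin n) : ℝ :=
  1 / 2 * ∑ d, invMetric G x c d *
    (pd D (fun z => G z ![b, d]) a x + pd D (fun z => G z ![a, d]) b x
      - pd D (fun z => G z ![a, b]) d x)

/-- The covariant derivative `∇ₐ T_I` for the Levi-Civita connection of `G`. -/
def covDeriv (D : Set (Coord n)) (G : CoordTensor n 2) (T : CoordTensor n k) (x : Coord n)
    (a : Fin n) (I : Fin k → Fin n) : ℝ :=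
  pd D (fun z => T z I) a x
    - ∑ j, ∑ c, christoffel D G x c a (I j) * T x (Function.update I j c)

/-- The gradient `∇ₐ f` as a covector field. -/
def grad (D : Set (Coord n)) (f : Coord n → ℝ) : CoordTensor n 1 :=
  fun x I => pd D f (I 0) x

/-- The Hessian `∇ₐ ∇ᵦ f`. -/
def hess (D : Set (Coord n)) (G : CoordTensor n 2) (f : Coord n → ℝ) : CoordTensor n 2 :=
  fun x I => covDeriv D G (grad D f) x (I 0) ![I 1]

/-- The trace `gᵃᵇ Sₐᵦ`. -/
def trace (G S : CoordTensor n 2) (x : Coord n) : ℝ :=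
  ∑ a, ∑ b, invMetric G x a b * S x ![a, b]

/-- The mixed curvature components `Rₐᵦ꜀ᵈ`, with the convention
`∇ₐ ∇ᵦ v꜀ - ∇ᵦ ∇ₐ v꜀ = Rₐᵦ꜀ᵈ v_d`. -/
def riemannMixed (D : Set (Coord n)) (G : CoordTensor n 2) (x : Coord n) (a b c d : Fin n) : ℝ :=
  pd D (fun z => christoffel D G z d a c) b x - pd D (fun z => christoffel D G z d b c) a x
    + ∑ e, (christoffel D G x e a c * christoffel D G x d b e
      - christoffel D G x e b c * christoffel D G x d a e)

/-- The Riemann tensor `Rₐᵦ꜀ᵈ g_{de}`. -/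
def riemann (D : Set (Coord n)) (G : CoordTensor n 2) : CoordTensor n 4 :=
  fun x I => ∑ e, riemannMixed D G x (I 0) (I 1) (I 2) e * G x ![e, I 3]

/-- The Ricci tensor `R_{bd} = gᵃᶜ R_{abcd}` (positive on round spheres). -/
def ricci (D : Set (Coord n)) (G : CoordTensor n 2) : CoordTensor n 2 :=
  fun x I => ∑ a, ∑ c, invMetric G x a c * riemann D G x ![a, I 0, c, I 1]

/-- The scalar curvature. -/
def scalarCurv (D : Set (Coord n)) (G : CoordTensor n 2) (x : Coord n) : ℝ :=
  trace G (ricci D G) x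

/-- The Schouten tensor; for `n = 4` it is `Rₐᵦ / 2 - R gₐᵦ / 12`, for `n = 3` it is
`Rₐᵦ - R gₐᵦ / 4`. -/
def schouten (D : Set (Coord n)) (G : CoordTensor n 2) : CoordTensor n 2 :=
  fun x I => 1 / ((n : ℝ) - 2) *
    (ricci D G x I - scalarCurv D G x / (2 * ((n : ℝ) - 1)) * G x I)

/-- The Weyl tensor: `R_{abcd} = C_{abcd} + 2 (g_{c[a} P_{b]d} + g_{d[b} P_{a]c})`. -/
def weyl (D : Set (Coord n)) (G : CoordTensor n 2) : CoordTensor n 4 :=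
  fun x I => riemann D G x I
    - (G x ![I 2, I 0] * schouten D G x ![I 1, I 3] - G x ![I 2, I 1] * schouten D G x ![I 0, I 3]
      + G x ![I 3, I 1] * schouten D G x ![I 0, I 2]
      - G x ![I 3, I 0] * schouten D G x ![I 1, I 2])

/-- The Cotton tensor `A_{abc} = ∇ᵦ P_{ca} - ∇꜀ P_{ba}`. -/
def cotton (D : Set (Coord n)) (G : CoordTensor n 2) : CoordTensor n 3 :=
  fun x I => covDeriv D G (schouten D G) x (I 1) ![I 2, I 0]
    - covDeriv D G (schouten D G) x (I 2) ![I 1, I 0]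

end Coordinates

/-! ### The conformal field equations in a chart of a four-manifold with boundary -/

/-- The closed half space `{x | 0 ≤ x 0}` in which the charts take their values. -/
def halfSpace : Set (Coord 4) := Set.range (𝓡∂ 4)

/-- The scalar `s = R Ω / 24 + □Ω / 4`. -/
def friedrichScalar (G : CoordTensor 4 2) (W : Coord 4 → ℝ) (x : Coord 4) : ℝ :=
  scalarCurv halfSpace G x * W x / 24 + trace G (hess halfSpace G W) x / 4

/-- The trace-free part of `That`, with respect to `G` (equivalently to `Ω⁻² G`). -/
def traceFree (G That : CoordTensor 4 2) : CoordTensor 4 2 :=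
  fun x I => That x I - trace G That x / 4 * G x I

/-- Friedrich's conformal Einstein field equations at the coordinate point `x`, for the unphysical
metric `G`, the conformal factor `W`, the physical energy-momentum tensor `That`, the rescaled Weyl
tensor `d` and the rescaled Cotton tensor `Q`.  As `ĝᵃᵇ = Ω² gᵃᵇ`, the physical trace of `That` is
`Ω² gᵃᵇ Thatₐᵦ`. -/
structure ConformalEinsteinEquationsAt (Lam : ℝ) (W : Coord 4 → ℝ) (G That : CoordTensor 4 2)
    (d : CoordTensor 4 4) (Q : CoordTensor 4 3) (x : Coord 4) : Prop where
  /-- `∇ₐ ∇ᵦ Ω = - Ω Pₐᵦ + s gₐᵦ + Ω T̊ₐᵦ / 2` -/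
  hessian : ∀ a b, hess halfSpace G W x ![a, b] =
    - W x * schouten halfSpace G x ![a, b] + friedrichScalar G W x * G x ![a, b]
      + W x / 2 * traceFree G That x ![a, b]
  /-- `∇ₐ s = - Pₐᵇ ∇ᵦ Ω + ∇ᶜ (Ω T̊ₐ꜀) / 6` -/
  gradient : ∀ a, pd halfSpace (friedrichScalar G W) a x =
    - ∑ b, ∑ c, schouten halfSpace G x ![a, c] * invMetric G x c b * pd halfSpace W b x
      + 1 / 6 * ∑ c, ∑ e, invMetric G x c e *
          covDeriv halfSpace G (fun z I => traceFree G That z I * W z) x e ![a, c]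
  /-- `∇_d dᵈₐᵦ꜀ = Qₐᵦ꜀` -/
  divergence : ∀ a b c, ∑ e, ∑ f, invMetric G x e f * covDeriv halfSpace G d x e ![f, a, b, c] =
    Q x ![a, b, c]
  /-- `2 ∇_[b P_c]a = dᵈₐᵦ꜀ ∇_d Ω + Ω Qₐᵦ꜀` -/
  schouten_curl : ∀ a b c, cotton halfSpace G x ![a, b, c] =
    (∑ e, ∑ f, invMetric G x e f * d x ![f, a, b, c] * pd halfSpace W e x) + W x * Q x ![a, b, c]
  /-- `Λ = 6 Ω s - 3 ∇_c Ω ∇ᶜ Ω + T̂ / 4` -/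
  cosmological : Lam = 6 * W x * friedrichScalar G W x
    - 3 * (∑ a, ∑ b, invMetric G x a b * pd halfSpace W a x * pd halfSpace W b x)
    + W x ^ 2 * trace G That x / 4

/-! ### Tensor fields on a four-manifold with boundary -/

section Manifold

variable {M : Type*} [TopologicalSpace M] [ChartedSpace (EuclideanHalfSpace 4) M]

variable (M) in
/-- A covariant tensor field of rank `k` (no smoothness is implied). -/
abbrev TensorField (k : ℕ) :=
  ∀ p : M, MultilinearMap ℝ (fun _ : Fin k => TangentSpace (𝓡∂ 4) p) ℝ

/-- The coordinate vector field `∂ₐ` of the chart `φ`, at the point with coordinates `x`. -/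
def chartFrame (φ : OpenPartialHomeomorph M (EuclideanHalfSpace 4)) (x : Coord 4) (a : Fin 4) :
    TangentSpace (𝓡∂ 4) ((φ.extend (𝓡∂ 4)).symm x) :=
  mfderivWithin 𝓘(ℝ, Coord 4) (𝓡∂ 4) (φ.extend (𝓡∂ 4)).symm halfSpace x
    (EuclideanSpace.single a (1 : ℝ) : Coord 4)

/-- The components of a tensor field in the chart `φ`. -/
def components {k : ℕ} (φ : OpenPartialHomeomorph M (EuclideanHalfSpace 4)) (T : TensorField M k) :
    CoordTensor 4 k :=
  fun x I => T ((φ.extend (𝓡∂ 4)).symm x) (fun j => chartFrame φ x (I j))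

/-- A function on the manifold, written in the chart `φ`. -/
def inChart (φ : OpenPartialHomeomorph M (EuclideanHalfSpace 4)) (f : M → ℝ) : Coord 4 → ℝ :=
  fun x => f ((φ.extend (𝓡∂ 4)).symm x)

/-- Smoothness (up to the boundary) of a tensor field. -/
def IsSmoothTensor {k : ℕ} (T : TensorField M k) : Prop :=
  ∀ φ ∈ atlas (EuclideanHalfSpace 4) M, ∀ I : Fin k → Fin 4,
    ContDiffOn ℝ ∞ (fun x => components φ T x I) (φ.extend (𝓡∂ 4)).target

/-- A Lorentzian metric of signature `(-,+,+,+)`. -/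
def IsLorentzian (g : TensorField M 2) : Prop :=
  ∀ p : M, ∃ b : Module.Basis (Fin 4) ℝ (TangentSpace (𝓡∂ 4) p), ∀ i j,
    g p ![b i, b j] = if i = j then (if i = 0 then -1 else 1) else 0

/-- The manifold with boundary `M`, with the metric `g` and the conformal factor `Ω`, is a
conformal extension of the asymptotically de Sitter spacetime consisting of the interior of `M`
with the metric `ghat`, the energy-momentum tensor `That` and the cosmological constant `Lam`.
The unphysical energy-momentum tensor `T`, the rescaled Weyl tensor `d` and the rescaled Cotton
tensor `Q` are regular up to the boundary.  The values of `ghat` on the boundary are not used. -/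
structure IsConformalExtension (Lam q : ℝ) (Ω : M → ℝ) (g ghat T That : TensorField M 2)
    (d : TensorField M 4) (Q : TensorField M 3) : Prop where
  lam_pos : 0 < Lam
  smooth_factor : ContMDiff (𝓡∂ 4) 𝓘(ℝ, ℝ) ∞ Ω
  factor_pos : ∀ p ∈ (𝓡∂ 4).interior M, 0 < Ω p
  factor_zero : ∀ p ∈ (𝓡∂ 4).boundary M, Ω p = 0
  smooth_metric : IsSmoothTensor g
  lorentzian : IsLorentzian g
  conformal : ∀ p ∈ (𝓡∂ 4).interior M, g p = Ω p ^ 2 • ghat p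
  /-- `R̂ₐᵦ - R̂ ĝₐᵦ / 2 + Λ ĝₐᵦ = T̂ₐᵦ` on the physical spacetime -/
  einstein : ∀ φ ∈ atlas (EuclideanHalfSpace 4) M, ∀ x ∈ (φ.extend (𝓡∂ 4)).target,
    (φ.extend (𝓡∂ 4)).symm x ∈ (𝓡∂ 4).interior M → ∀ a b,
      ricci halfSpace (components φ ghat) x ![a, b]
        - scalarCurv halfSpace (components φ ghat) x / 2 * components φ ghat x ![a, b]
        + Lam * components φ ghat x ![a, b] = components φ That x ![a, b]
  q_nonneg : 0 ≤ q
  smooth_matter : IsSmoothTensor T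
  matter : ∀ p, That p = Ω p ^ q • T p
  smooth_weyl : IsSmoothTensor d
  /-- `d_{abcd} = Ω⁻¹ C_{abcd}`, for the Weyl tensor of `g` -/
  rescaled_weyl : ∀ φ ∈ atlas (EuclideanHalfSpace 4) M, ∀ x ∈ (φ.extend (𝓡∂ 4)).target,
    (φ.extend (𝓡∂ 4)).symm x ∈ (𝓡∂ 4).interior M → ∀ I,
      components φ d x I = (inChart φ Ω x)⁻¹ * weyl halfSpace (components φ g) x I
  smooth_cotton : IsSmoothTensor Q
  /-- `Q_{abc} = Ω⁻¹ Â_{abc}`, for the Cotton tensor of `ghat` -/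
  rescaled_cotton : ∀ φ ∈ atlas (EuclideanHalfSpace 4) M, ∀ x ∈ (φ.extend (𝓡∂ 4)).target,
    (φ.extend (𝓡∂ 4)).symm x ∈ (𝓡∂ 4).interior M → ∀ I,
      components φ Q x I = (inChart φ Ω x)⁻¹ * cotton halfSpace (components φ ghat) x I

/-- Friedrich's conformal Einstein field equations hold on all of `M`, boundary included, and the
physical energy-momentum tensor is conserved on the physical spacetime. -/
structure SatisfiesConformalEinstein (Lam : ℝ) (Ω : M → ℝ) (g ghat That : TensorField M 2)
    (d : TensorField M 4) (Q : TensorField M 3) : Prop where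
  equations : ∀ φ ∈ atlas (EuclideanHalfSpace 4) M, ∀ x ∈ (φ.extend (𝓡∂ 4)).target,
    ConformalEinsteinEquationsAt Lam (inChart φ Ω) (components φ g) (components φ That)
      (components φ d) (components φ Q) x
  /-- `∇̂ᵇ T̂ₐᵦ = 0` -/
  conservation : ∀ φ ∈ atlas (EuclideanHalfSpace 4) M, ∀ x ∈ (φ.extend (𝓡∂ 4)).target,
    (φ.extend (𝓡∂ 4)).symm x ∈ (𝓡∂ 4).interior M → ∀ a,
      ∑ b, ∑ c, invMetric (components φ ghat) x b c *
        covDeriv halfSpace (components φ ghat) (components φ That) x c ![a, b] = 0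

end Manifold

/-! ### Geometry of the boundary

In a chart of a manifold with boundary the boundary is `{x | x 0 = 0}`, with coordinates
`y = (x 1, x 2, x 3)`, and it is tangent to `∂₁, ∂₂, ∂₃`.  A tensor field intrinsic to the boundary
is given by its components with respect to these vectors; in particular the projection `T^⊤` of a
tensor has the components of `T` whose indices all belong to `1, 2, 3`. -/

/-- The point of the boundary with coordinates `y`. -/
def boundaryPoint (y : Coord 3) : Coord 4 := WithLp.toLp 2 (Fin.cons 0 y.ofLp)

/-- The boundary coordinates of a point with coordinates `x`. -/
def boundaryCoord (x : Coord 4) : Coord 3 := WithLp.toLp 2 (fun i => x i.succ)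

/-- The projection `T^⊤` of a tensor to the boundary. -/
def tangential {k : ℕ} (T : CoordTensor 4 k) : CoordTensor 3 k :=
  fun y I => T (boundaryPoint y) (fun j => (I j).succ)

/-- The normal vector `nᵃ = gᵃᵇ nᵦ` of the conormal `N`. -/
def normalVec (G : CoordTensor 4 2) (N : CoordTensor 4 1) (x : Coord 4) (a : Fin 4) : ℝ :=
  ∑ b, invMetric G x a b * N x ![b]

/-- The extrinsic curvature `Kᵢⱼ`, i.e. the tangential components `∇ᵢ nⱼ` of `∇ₐ nᵦ + nₐ aᵦ`
(recall that `nᵢ = 0`); only the values of the conormal on the boundary enter. -/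
def extrinsicCurv (G : CoordTensor 4 2) (N : CoordTensor 4 1) : CoordTensor 3 2 :=
  fun y I => pd Set.univ (fun z => N (boundaryPoint z) ![(I 1).succ]) (I 0) y
    - ∑ c, christoffel halfSpace G (boundaryPoint y) c (I 0).succ (I 1).succ
        * N (boundaryPoint y) ![c]

/-- The electric part `eᵢⱼ = d^⊤_{i ⊥ j ⊥}`. -/
def electricPart (G : CoordTensor 4 2) (N : CoordTensor 4 1) (d : CoordTensor 4 4) :
    CoordTensor 3 2 :=
  fun y I => ∑ a, ∑ b, d (boundaryPoint y) ![(I 0).succ, a, (I 1).succ, b]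
    * normalVec G N (boundaryPoint y) a * normalVec G N (boundaryPoint y) b

/-- The magnetic part `bᵢⱼₖ = d^⊤_{ijk ⊥}`. -/
def magneticPart (G : CoordTensor 4 2) (N : CoordTensor 4 1) (d : CoordTensor 4 4) :
    CoordTensor 3 3 :=
  fun y I => ∑ a, d (boundaryPoint y) ![(I 0).succ, (I 1).succ, (I 2).succ, a]
    * normalVec G N (boundaryPoint y) a

/-- Along the boundary, `n` is the unit conormal `nₐ` (`nᵃ nₐ = -1`) whose vector `nᵃ` points into
the manifold, i.e. in the direction in which the conformal factor becomes positive.  Off the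
boundary `n` is arbitrary. -/
structure IsInwardUnitConormal {M : Type*} [TopologicalSpace M]
    [ChartedSpace (EuclideanHalfSpace 4) M] (g : TensorField M 2) (n : TensorField M 1) : Prop where
  normal : ∀ φ ∈ atlas (EuclideanHalfSpace 4) M, ∀ y,
    boundaryPoint y ∈ (φ.extend (𝓡∂ 4)).target → ∀ i : Fin 3,
      components φ n (boundaryPoint y) ![i.succ] = 0
  unit : ∀ φ ∈ atlas (EuclideanHalfSpace 4) M, ∀ y,
    boundaryPoint y ∈ (φ.extend (𝓡∂ 4)).target →
      ∑ a, normalVec (components φ g) (components φ n) (boundaryPoint y) a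
        * components φ n (boundaryPoint y) ![a] = -1
  inward : ∀ φ ∈ atlas (EuclideanHalfSpace 4) M, ∀ y,
    boundaryPoint y ∈ (φ.extend (𝓡∂ 4)).target →
      0 < normalVec (components φ g) (components φ n) (boundaryPoint y) 0

/-- The constraints at the boundary point with coordinates `y`. -/
structure BoundaryConstraintsAt (Lam : ℝ) (W : Coord 4 → ℝ) (G : CoordTensor 4 2)
    (d : CoordTensor 4 4) (Q : CoordTensor 4 3) (N : CoordTensor 4 1) (y : Coord 3) : Prop where
  /-- `∇_⊥ Ω = √(Λ/3)` -/
  normal_derivative :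
    ∑ a, normalVec G N (boundaryPoint y) a * pd halfSpace W a (boundaryPoint y) = √(Lam / 3)
  /-- `Kᵢⱼ = - √(3/Λ) s hᵢⱼ` -/
  umbilic : ∀ i j, extrinsicCurv G N y ![i, j] =
    - √(3 / Lam) * friedrichScalar G W (boundaryPoint y) * tangential G y ![i, j]
  /-- `P^⊤_{i ⊥} = √(3/Λ) Dᵢ s` -/
  schouten_normal : ∀ i : Fin 3,
    ∑ a, schouten halfSpace G (boundaryPoint y) ![i.succ, a] * normalVec G N (boundaryPoint y) a =
      √(3 / Lam) * pd Set.univ (fun z => friedrichScalar G W (boundaryPoint z)) i y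
  /-- `P^⊤ᵢⱼ = P⁽³⁾ᵢⱼ + 3 / (2Λ) s² hᵢⱼ` -/
  schouten_tangential : ∀ i j, tangential (schouten halfSpace G) y ![i, j] =
    schouten Set.univ (tangential G) y ![i, j]
      + 3 / (2 * Lam) * friedrichScalar G W (boundaryPoint y) ^ 2 * tangential G y ![i, j]
  /-- `bᵢⱼₖ = √(3/Λ) A⁽³⁾ₖᵢⱼ` -/
  magnetic : ∀ i j k, magneticPart G N d y ![i, j, k] =
    √(3 / Lam) * cotton Set.univ (tangential G) y ![k, i, j]
  /-- `Dʲ eᵢⱼ = - Q^⊤_{⊥ ⊥ i}` -/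
  electric : ∀ i : Fin 3,
    ∑ j, ∑ k, invMetric (tangential G) y j k *
        covDeriv Set.univ (tangential G) (electricPart G N d) y k ![i, j] =
      - ∑ a, ∑ b, Q (boundaryPoint y) ![a, b, i.succ]
        * normalVec G N (boundaryPoint y) a * normalVec G N (boundaryPoint y) b
  /-- `Q^⊤_{⊥ ij} = 0` -/
  cotton_normal : ∀ i j : Fin 3,
    ∑ a, Q (boundaryPoint y) ![a, i.succ, j.succ] * normalVec G N (boundaryPoint y) a = 0

end

end ConformalBoundary

open ConformalBoundary

/-! Everything is local, so the work takes place in one boundary chart, where the boundary is `x 0 =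
0`. There `Ω = 0` reduces the field equations to `∇_a∇_bΩ = s g_ab`, `Λ = -3|∇Ω|²`, `A_abc = d^e_abc
∇_eΩ` and `∇^e d_eabc = Q_abc`; `isBoundaryChart` records this. Write `V^a = ∇^aΩ`. The second
identity makes `V` timelike, and `V` is orthogonal to the boundary because `Ω` is constant along it,
so the boundary is spacelike (`posDef_tangential`) and the inward unit normal is `n = -√(3/Λ) V`
(`normalVec_eq`). Hence `g⁻¹ = h⁻¹ - (3/Λ) V⊗V` (`inv_split`), which splits every trace and every
Christoffel symbol into an intrinsic and a normal part.

The Hessian equation says that the boundary is umbilic, with factor proportional to `s`. As it is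
used only on the boundary, it is differentiated only in tangential directions; with the Ricci
identity this yields the Codazzi equation `riemann_gradVec`, whose trace is `P(∂_i, V) = -∂_i s`.

The Weyl tensor of `g` is `Ω d` in the interior and therefore vanishes on the boundary by
continuity. The curvature there is the Kulkarni-Nomizu product of `g` and `P`; by the Gauss equation
the intrinsic curvature has the same form, with `P^⊤ - (3/2Λ)s²h` in place of `P`. The trace
determines such a factor, so it is `P⁽³⁾` (`schouten_eq_of_riemann_eq`). Comparing `∇P` with `DP⁽³⁾`
leaves a totally symmetric error, so the tangential Cotton components agree (`cotton_tangential`),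
and the Cotton equation gives the magnetic part.

For the last two constraints the divergence equation is contracted with `V`. Its doubly normal part
drops out by antisymmetry of `d`, so only tangential derivatives remain (`divergence_gradVec`), and
these are compared with `D e` and `D b`. The corrections are multiples of `s`: they cancel after
tracing, because `d` is antisymmetric in each pair and trace-free, and in the magnetic case also
because `d_cpqa V^c V^a` is symmetric in `p, q`. This gives the electric constraint. It also makes
`Q_⊥ij` proportional to the divergence of `b_ijk` over `k`, that is, of `A⁽³⁾_kij` over its first
index, which is zero by `div_cotton`. -/

namespace ConformalBoundary

open Filter Topology

/-! ### Partial derivatives within a coordinate domain -/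

section Calculus

variable {n : ℕ} {D : Set (Coord n)} {f g : Coord n → ℝ} {x : Coord n}

/-- A domain of coordinates in which derivatives are unique and second derivatives commute. -/
structure IsRegularDomain (D : Set (Coord n)) : Prop where
  uniqueDiffOn : UniqueDiffOn ℝ D
  subset_closure_interior : D ⊆ closure (interior D)

theorem isRegularDomain_univ : IsRegularDomain (Set.univ : Set (Coord n)) :=
  ⟨uniqueDiffOn_univ, by simp⟩

theorem halfSpace_eq : halfSpace = {x : Coord 4 | 0 ≤ x 0} :=
  range_modelWithCornersEuclideanHalfSpace 4

theorem isRegularDomain_halfSpace : IsRegularDomain halfSpace := by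
  refine ⟨(𝓡∂ 4).uniqueDiffOn, ?_⟩
  exact (𝓡∂ 4).range_subset_closure_interior

/-- `f` is smooth within `D` at `x`. -/
abbrev SmoothWithin (D : Set (Coord n)) (f : Coord n → ℝ) (x : Coord n) : Prop :=
  ContDiffWithinAt ℝ ∞ f D x

theorem SmoothWithin.differentiable (hf : SmoothWithin D f x) :
    DifferentiableWithinAt ℝ f D x :=
  ContDiffWithinAt.differentiableWithinAt hf (by simp)

theorem SmoothWithin.pd (hD : IsRegularDomain D) (hx : x ∈ D) (hf : SmoothWithin D f x)
    (a : Fin n) : SmoothWithin D (pd D f a) x := by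
  have h := ContDiffWithinAt.fderivWithin_right (m := ∞) hf hD.uniqueDiffOn (by simp) hx
  exact h.clm_apply contDiffWithinAt_const

theorem pd_congr (hx : x ∈ D) (h : f =ᶠ[𝓝[D] x] g) (a : Fin n) :
    pd D f a x = pd D g a x := by
  simp only [pd, h.fderivWithin_eq_of_mem hx]

theorem pd_const (c : ℝ) (a : Fin n) : pd D (fun _ => c) a x = 0 := by
  simp [pd]

variable (hD : IsRegularDomain D) (hx : x ∈ D)
include hD hx

theorem pd_add (hf : SmoothWithin D f x) (hg : SmoothWithin D g x) (a : Fin n) :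
    pd D (fun z => f z + g z) a x = pd D f a x + pd D g a x := by
  simp only [pd]
  rw [fderivWithin_fun_add (hD.uniqueDiffOn x hx) hf.differentiable hg.differentiable]
  rfl

theorem pd_sub (hf : SmoothWithin D f x) (hg : SmoothWithin D g x) (a : Fin n) :
    pd D (fun z => f z - g z) a x = pd D f a x - pd D g a x := by
  simp only [pd]
  rw [fderivWithin_fun_sub (hD.uniqueDiffOn x hx) hf.differentiable hg.differentiable]
  rfl

theorem pd_mul (hf : SmoothWithin D f x) (hg : SmoothWithin D g x) (a : Fin n) :
    pd D (fun z => f z * g z) a x = pd D f a x * g x + f x * pd D g a x := by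
  simp only [pd]
  rw [fderivWithin_fun_mul (hD.uniqueDiffOn x hx) hf.differentiable hg.differentiable]
  simp
  ring

theorem pd_const_mul (c : ℝ) (hf : SmoothWithin D f x) (a : Fin n) :
    pd D (fun z => c * f z) a x = c * pd D f a x := by
  rw [pd_mul hD hx contDiffWithinAt_const hf, pd_const]
  ring

theorem pd_sum {ι : Type*} {s : Finset ι} {F : ι → Coord n → ℝ}
    (hF : ∀ i ∈ s, SmoothWithin D (F i) x) (a : Fin n) :
    pd D (fun z => ∑ i ∈ s, F i z) a x = ∑ i ∈ s, pd D (F i) a x := by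
  simp only [pd]
  rw [fderivWithin_fun_sum (hD.uniqueDiffOn x hx) fun i hi => (hF i hi).differentiable]
  simp

/-- Symmetry of the second derivative within `D` also holds at boundary points, since every point of
`D` is a limit of interior points. -/
theorem pd_comm (hf : SmoothWithin D f x) (a b : Fin n) :
    pd D (pd D f a) b x = pd D (pd D f b) a x := by
  have h1 : ContDiffWithinAt ℝ ∞ (fderivWithin ℝ f D) D x :=
    ContDiffWithinAt.fderivWithin_right (m := ∞) hf hD.uniqueDiffOn (by simp) hx
  have h2 := h1.differentiableWithinAt (by simp)
  have key : ∀ a b : Fin n, pd D (pd D f a) b x =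
      fderivWithin ℝ (fderivWithin ℝ f D) D x (EuclideanSpace.single b 1)
        (EuclideanSpace.single a 1) := by
    intro a b
    have : pd D f a = fun z => fderivWithin ℝ f D z (EuclideanSpace.single a 1) := rfl
    rw [this]
    simp only [pd]
    rw [fderivWithin_clm_apply (hD.uniqueDiffOn x hx) h2 (differentiableWithinAt_const _)]
    simp
  rw [key, key]
  exact (ContDiffWithinAt.isSymmSndFDerivWithinAt hf
    (by simpa using WithTop.coe_le_coe.2 (le_top : (2 : ℕ∞) ≤ ⊤)) hD.uniqueDiffOn
    (hD.subset_closure_interior hx) hx).eq _ _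

end Calculus

/-! ### Restriction to the boundary -/

section Restriction

theorem boundaryPoint_mem (y : Coord 3) : boundaryPoint y ∈ halfSpace := by
  simp [halfSpace_eq, boundaryPoint]

/-- The inclusion of the boundary, as a linear map. -/
noncomputable def boundaryInclusion : Coord 3 →L[ℝ] Coord 4 :=
  LinearMap.toContinuousLinearMap
    { toFun := boundaryPoint
      map_add' := fun y z => by
        ext i
        refine Fin.cases ?_ (fun j => ?_) i <;> simp [boundaryPoint]
      map_smul' := fun c y => by
        ext i
        refine Fin.cases ?_ (fun j => ?_) i <;> simp [boundaryPoint] }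

theorem boundaryInclusion_apply (y : Coord 3) : boundaryInclusion y = boundaryPoint y := rfl

theorem boundaryInclusion_single (i : Fin 3) :
    boundaryInclusion (EuclideanSpace.single i 1) = EuclideanSpace.single i.succ (1 : ℝ) := by
  ext j
  rw [boundaryInclusion_apply]
  refine Fin.cases ?_ (fun j => ?_) j
  · simp [boundaryPoint, (Fin.succ_ne_zero _).symm]
  · simp [boundaryPoint, Pi.single_apply]

theorem continuous_boundaryPoint : Continuous boundaryPoint := boundaryInclusion.continuous

theorem SmoothWithin.restrict {f : Coord 4 → ℝ} {y : Coord 3}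
    (hf : SmoothWithin halfSpace f (boundaryPoint y)) :
    SmoothWithin Set.univ (fun z => f (boundaryPoint z)) y :=
  ContDiffWithinAt.comp (t := halfSpace) y hf boundaryInclusion.contDiff.contDiffWithinAt
    fun z _ => boundaryPoint_mem z

/-- The chain rule for the linear inclusion. It is what permits differentiating, in tangential
directions, an identity known only on the boundary. -/
theorem pd_restrict {f : Coord 4 → ℝ} {y : Coord 3}
    (hf : SmoothWithin halfSpace f (boundaryPoint y)) (i : Fin 3) :
    pd Set.univ (fun z => f (boundaryPoint z)) i y = pd halfSpace f i.succ (boundaryPoint y) := by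
  have h := fderivWithin_comp (𝕜 := ℝ) (g := f) (f := boundaryInclusion) (s := Set.univ) y
    (t := halfSpace) hf.differentiable boundaryInclusion.differentiableAt.differentiableWithinAt
    (fun z _ => boundaryPoint_mem z) uniqueDiffWithinAt_univ
  simp only [pd]
  have e : (fun z => f (boundaryPoint z)) = f ∘ boundaryInclusion := rfl
  rw [e, h, ContinuousLinearMap.fderivWithin _ uniqueDiffWithinAt_univ]
  rw [ContinuousLinearMap.comp_apply, boundaryInclusion_single, boundaryInclusion_apply]

theorem boundaryPoint_boundaryCoord {x : Coord 4} (hx : x 0 = 0) :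
    boundaryPoint (boundaryCoord x) = x := by
  ext i
  refine Fin.cases ?_ (fun j => ?_) i
  · simp [boundaryPoint, hx]
  · simp [boundaryPoint, boundaryCoord]

end Restriction

/-! ### Metrics, Christoffel symbols and smoothness of the curvature -/

section Metric

variable {n k : ℕ} {D U : Set (Coord n)} {G : CoordTensor n 2} {x : Coord n}

/-- `G` is a smooth pseudo-Riemannian metric on the relatively open subset `U` of `D`. -/
structure IsRegularMetric (D : Set (Coord n)) (G : CoordTensor n 2) (U : Set (Coord n)) :
    Prop where
  domain : IsRegularDomain D
  subset : U ⊆ D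
  nhds : ∀ x ∈ U, U ∈ 𝓝[D] x
  symm : ∀ x ∈ U, ∀ a b, G x ![a, b] = G x ![b, a]
  det : ∀ x ∈ U, (Matrix.of fun a b => G x ![a, b]).det ≠ 0
  smooth : ∀ I, ∀ x ∈ U, SmoothWithin D (fun z => G z I) x

/-- The Christoffel symbol of the first kind. -/
noncomputable def christoffelLow (D : Set (Coord n)) (G : CoordTensor n 2) (x : Coord n)
    (d a b : Fin n) : ℝ :=
  1 / 2 * (pd D (fun z => G z ![b, d]) a x + pd D (fun z => G z ![a, d]) b x
      - pd D (fun z => G z ![a, b]) d x)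

theorem christoffel_eq (c a b : Fin n) :
    christoffel D G x c a b = ∑ d, invMetric G x c d * christoffelLow D G x d a b := by
  simp only [christoffel, christoffelLow, Finset.mul_sum]
  exact Finset.sum_congr rfl fun d _ => by ring

namespace IsRegularMetric

section Pointwise

variable (h : IsRegularMetric D G U) (hx : x ∈ U)
include h hx

theorem eventually {p : Coord n → Prop} (hp : ∀ z ∈ U, p z) : ∀ᶠ z in 𝓝[D] x, p z :=
  Filter.mem_of_superset (h.nhds x hx) hp

/-- `U` is relatively open in `D`, so an identity on `U` may be differentiated, including at
boundary points. -/
theorem pd_congr_on {f g : Coord n → ℝ} (hfg : ∀ z ∈ U, f z = g z) (a : Fin n) :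
    pd D f a x = pd D g a x :=
  pd_congr (h.subset hx) (h.eventually hx hfg) a

theorem metric_mul_inv (a c : Fin n) :
    ∑ b, G x ![a, b] * invMetric G x b c = if a = c then 1 else 0 := by
  have := Matrix.mul_nonsing_inv _ (isUnit_iff_ne_zero.2 (h.det x hx))
  have := congrFun (congrFun this a) c
  simpa [Matrix.mul_apply, Matrix.one_apply, invMetric] using this

theorem inv_mul_metric (a c : Fin n) :
    ∑ b, invMetric G x a b * G x ![b, c] = if a = c then 1 else 0 := by
  have := Matrix.nonsing_inv_mul _ (isUnit_iff_ne_zero.2 (h.det x hx))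
  have := congrFun (congrFun this a) c
  simpa [Matrix.mul_apply, Matrix.one_apply, invMetric] using this

theorem inv_symm (a b : Fin n) : invMetric G x a b = invMetric G x b a := by
  have : (Matrix.of fun a b => G x ![a, b]).IsSymm := by
    ext a b
    exact h.symm x hx b a
  have := this.inv
  exact (congrFun (congrFun this a) b).symm

/-- Lowering an index of a contraction with the inverse metric. -/
theorem lower_raise (F : Fin n → ℝ) (a : Fin n) :
    ∑ b, G x ![a, b] * ∑ c, invMetric G x b c * F c = F a := by
  simp only [Finset.mul_sum]
  rw [Finset.sum_comm]
  simp only [← mul_assoc, ← Finset.sum_mul, h.metric_mul_inv hx]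
  simp

/-- Raising an index of a contraction with the metric. -/
theorem raise_lower (F : Fin n → ℝ) (a : Fin n) :
    ∑ b, invMetric G x a b * ∑ c, G x ![b, c] * F c = F a := by
  simp only [Finset.mul_sum]
  rw [Finset.sum_comm]
  simp only [← mul_assoc, ← Finset.sum_mul, h.inv_mul_metric hx]
  simp

theorem sum_inv_mul_metric_mul (F : Fin n → ℝ) (b : Fin n) :
    ∑ a, ∑ c, invMetric G x a c * (G x ![c, b] * F a) = F b := by
  simp only [← mul_assoc, ← Finset.sum_mul, h.inv_mul_metric hx]
  simp

theorem trace_metric : ∑ a, ∑ c, invMetric G x a c * G x ![c, a] = n := by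
  simp [h.inv_mul_metric hx]

theorem christoffel_symm (c a b : Fin n) :
    christoffel D G x c a b = christoffel D G x c b a := by
  rw [christoffel_eq, christoffel_eq]
  refine Finset.sum_congr rfl fun d _ => ?_
  simp only [christoffelLow]
  rw [h.pd_congr_on hx (fun z hz => h.symm z hz a b)]
  ring

theorem christoffelLow_symm (c a b : Fin n) :
    christoffelLow D G x c a b = christoffelLow D G x c b a := by
  simp only [christoffelLow]
  rw [h.pd_congr_on hx (fun z hz => h.symm z hz a b)]
  ring

theorem lower_christoffel (d a b : Fin n) :
    ∑ c, christoffel D G x c a b * G x ![c, d] = christoffelLow D G x d a b := by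
  rw [← h.lower_raise hx (fun d => christoffelLow D G x d a b) d]
  refine Finset.sum_congr rfl fun c _ => ?_
  rw [christoffel_eq, h.symm x hx c d, mul_comm]

/-- This is `∇g = 0`, written with symbols of the first kind. -/
theorem pd_metric (b d e : Fin n) :
    pd D (fun z => G z ![d, e]) b x = christoffelLow D G x d b e + christoffelLow D G x e b d := by
  simp only [christoffelLow]
  rw [h.pd_congr_on hx (fun z hz => h.symm z hz e d), h.pd_congr_on hx (fun z hz => h.symm z hz b d),
    h.pd_congr_on hx (fun z hz => h.symm z hz b e)]
  ring

theorem smooth_det : SmoothWithin D (fun z => (Matrix.of fun a b => G z ![a, b]).det) x := by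
  simp only [Matrix.det_apply]
  refine ContDiffWithinAt.sum fun σ _ => ContDiffWithinAt.const_smul _ ?_
  exact contDiffWithinAt_prod fun i _ => h.smooth _ x hx

theorem smooth_inv (a b : Fin n) : SmoothWithin D (fun z => invMetric G z a b) x := by
  -- Cramer's rule exhibits the entries of the inverse as quotients of polynomials in the components
  -- of `G`.
  have e : (fun z => invMetric G z a b) = fun z =>
      (Matrix.of fun a b => G z ![a, b]).det⁻¹ *
        ((Matrix.of fun a b => G z ![a, b]).updateRow b (Pi.single a 1)).det := by
    funext z
    simp [invMetric, Matrix.inv_def, Matrix.adjugate_apply]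
  rw [e]
  refine ContDiffWithinAt.mul ((h.smooth_det hx).inv (h.det x hx)) ?_
  simp only [Matrix.det_apply]
  refine ContDiffWithinAt.sum fun σ _ => ContDiffWithinAt.const_smul _ ?_
  refine contDiffWithinAt_prod fun i _ => ?_
  simp only [Matrix.updateRow_apply]
  split_ifs
  · exact contDiffWithinAt_const
  · exact h.smooth _ x hx

theorem smooth_christoffelLow (d a b : Fin n) :
    SmoothWithin D (fun z => christoffelLow D G z d a b) x := by
  have s : ∀ a b c, SmoothWithin D (fun z => pd D (fun z => G z ![a, b]) c z) x := fun a b c =>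
    SmoothWithin.pd h.domain (h.subset hx) (h.smooth _ x hx) c
  exact contDiffWithinAt_const.mul (((s _ _ _).add (s _ _ _)).sub (s _ _ _))

theorem smooth_christoffel (c a b : Fin n) :
    SmoothWithin D (fun z => christoffel D G z c a b) x := by
  simp only [christoffel_eq]
  exact ContDiffWithinAt.sum fun d _ => (h.smooth_inv hx _ _).mul (h.smooth_christoffelLow hx _ _ _)

theorem smooth_pd_christoffel (c a b e : Fin n) :
    SmoothWithin D (fun z => pd D (fun z => christoffel D G z c a b) e z) x :=
  SmoothWithin.pd h.domain (h.subset hx) (h.smooth_christoffel hx _ _ _) e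

theorem smooth_riemannMixed (a b c d : Fin n) :
    SmoothWithin D (fun z => riemannMixed D G z a b c d) x := by
  have s := fun a b c => h.smooth_christoffel hx a b c
  exact ((h.smooth_pd_christoffel hx _ _ _ _).sub (h.smooth_pd_christoffel hx _ _ _ _)).add
    (ContDiffWithinAt.sum fun e _ => ((s _ _ _).mul (s _ _ _)).sub ((s _ _ _).mul (s _ _ _)))

theorem smooth_riemann (I : Fin 4 → Fin n) : SmoothWithin D (fun z => riemann D G z I) x :=
  ContDiffWithinAt.sum fun _ _ => (h.smooth_riemannMixed hx _ _ _ _).mul (h.smooth _ x hx)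

theorem smooth_ricci (I : Fin 2 → Fin n) : SmoothWithin D (fun z => ricci D G z I) x :=
  ContDiffWithinAt.sum fun _ _ => ContDiffWithinAt.sum fun _ _ =>
    (h.smooth_inv hx _ _).mul (h.smooth_riemann hx _)

theorem smooth_trace {S : CoordTensor n 2} (hS : ∀ I, SmoothWithin D (fun z => S z I) x) :
    SmoothWithin D (fun z => trace G S z) x :=
  ContDiffWithinAt.sum fun _ _ => ContDiffWithinAt.sum fun _ _ =>
    (h.smooth_inv hx _ _).mul (hS _)

theorem smooth_scalarCurv : SmoothWithin D (fun z => scalarCurv D G z) x :=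
  h.smooth_trace hx fun I => h.smooth_ricci hx I

theorem smooth_schouten (I : Fin 2 → Fin n) : SmoothWithin D (fun z => schouten D G z I) x :=
  contDiffWithinAt_const.mul ((h.smooth_ricci hx I).sub
    (((h.smooth_scalarCurv hx).div_const _).mul (h.smooth I x hx)))

theorem smooth_weyl (I : Fin 4 → Fin n) : SmoothWithin D (fun z => weyl D G z I) x := by
  have s := fun I => h.smooth_schouten hx I
  have g := fun I => h.smooth I x hx
  exact (h.smooth_riemann hx I).sub (((((g _).mul (s _)).sub ((g _).mul (s _))).add
    ((g _).mul (s _))).sub ((g _).mul (s _)))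

theorem smooth_covDeriv {T : CoordTensor n k} (hT : ∀ I, SmoothWithin D (fun z => T z I) x)
    (a : Fin n) (I : Fin k → Fin n) : SmoothWithin D (fun z => covDeriv D G T z a I) x :=
  (SmoothWithin.pd h.domain (h.subset hx) (hT I) a).sub
    (ContDiffWithinAt.sum fun _ _ => ContDiffWithinAt.sum fun _ _ =>
      (h.smooth_christoffel hx _ _ _).mul (hT _))

theorem smooth_grad {W : Coord n → ℝ} (hW : SmoothWithin D W x) (I : Fin 1 → Fin n) :
    SmoothWithin D (fun z => grad D W z I) x :=
  SmoothWithin.pd h.domain (h.subset hx) hW _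

theorem smooth_hess {W : Coord n → ℝ} (hW : SmoothWithin D W x) (I : Fin 2 → Fin n) :
    SmoothWithin D (fun z => hess D G W z I) x :=
  h.smooth_covDeriv hx (fun I => h.smooth_grad hx hW I) _ _

/-- The Riemann tensor in terms of the Christoffel symbols of the first kind. -/
theorem riemann_eq (a b c d : Fin n) : riemann D G x ![a, b, c, d] =
    pd D (fun z => christoffelLow D G z d a c) b x - pd D (fun z => christoffelLow D G z d b c) a x
      + ∑ e, (christoffel D G x e b c * christoffelLow D G x e a d
        - christoffel D G x e a c * christoffelLow D G x e b d) := by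
  have hxD := h.subset hx
  -- Leibniz: lowering the index commutes with the derivative up to `Γ ∂g`, and metric compatibility
  -- splits `∂g` into two symbols. One of the resulting products cancels the quadratic term `quad`
  -- below.
  have key : ∀ a b c, ∑ e, pd D (fun z => christoffel D G z e a c) b x * G x ![e, d] =
      pd D (fun z => christoffelLow D G z d a c) b x
        - ∑ e, christoffel D G x e a c * (christoffelLow D G x e b d + christoffelLow D G x d b e) := by
    intro a b c
    rw [h.pd_congr_on hx (fun z hz => (h.lower_christoffel hz d a c).symm),
      pd_sum h.domain hxD fun e _ => (h.smooth_christoffel hx _ _ _).mul (h.smooth _ x hx),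
      ← Finset.sum_sub_distrib]
    refine Finset.sum_congr rfl fun e _ => ?_
    rw [pd_mul h.domain hxD (h.smooth_christoffel hx _ _ _) (h.smooth _ x hx), h.pd_metric hx]
    ring
  have quad : ∀ a b c, ∑ e, (∑ f, christoffel D G x f a c * christoffel D G x e b f) * G x ![e, d]
      = ∑ f, christoffel D G x f a c * christoffelLow D G x d b f := by
    intro a b c
    simp only [Finset.sum_mul]
    rw [Finset.sum_comm]
    refine Finset.sum_congr rfl fun f _ => ?_
    rw [← h.lower_christoffel hx, Finset.mul_sum]
    exact Finset.sum_congr rfl fun e _ => by ring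
  have expand : riemann D G x ![a, b, c, d] =
      ∑ e, pd D (fun z => christoffel D G z e a c) b x * G x ![e, d]
      - ∑ e, pd D (fun z => christoffel D G z e b c) a x * G x ![e, d]
      + ∑ e, (∑ f, christoffel D G x f a c * christoffel D G x e b f) * G x ![e, d]
      - ∑ e, (∑ f, christoffel D G x f b c * christoffel D G x e a f) * G x ![e, d] := by
    rw [← Finset.sum_sub_distrib, ← Finset.sum_add_distrib, ← Finset.sum_sub_distrib]
    refine Finset.sum_congr rfl fun e _ => ?_
    simp only [riemannMixed, Matrix.cons_val, Finset.sum_sub_distrib]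
    ring
  rw [expand, key, key, quad, quad]
  simp only [mul_add, Finset.sum_add_distrib, Finset.sum_sub_distrib]
  ring

/-- Both sides are the inner product, in the symmetric inverse metric, of two symbols of the first
kind. -/
theorem christoffel_pairing (a b c d : Fin n) :
    ∑ e, christoffel D G x e a b * christoffelLow D G x e c d =
      ∑ e, christoffel D G x e c d * christoffelLow D G x e a b := by
  simp only [christoffel_eq, Finset.sum_mul]
  rw [Finset.sum_comm]
  refine Finset.sum_congr rfl fun e _ => Finset.sum_congr rfl fun f _ => ?_
  rw [h.inv_symm hx]
  ring

end Pointwise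

end IsRegularMetric

end Metric

/-! ### Curvature symmetries, traces and Ricci identities -/

section Curvature

variable {n k : ℕ} {D U : Set (Coord n)} {G : CoordTensor n 2} {x : Coord n}

theorem covDeriv_two (T : CoordTensor n 2) (a b c : Fin n) :
    covDeriv D G T x a ![b, c] = pd D (fun z => T z ![b, c]) a x
      - ∑ m, christoffel D G x m a b * T x ![m, c] - ∑ m, christoffel D G x m a c * T x ![b, m] := by
  have u0 : ∀ m, Function.update ![b, c] 0 m = ![m, c] := fun m => by
    ext i; fin_cases i <;> rfl
  have u1 : ∀ m, Function.update ![b, c] 1 m = ![b, m] := fun m => by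
    ext i; fin_cases i <;> rfl
  simp only [covDeriv, Fin.sum_univ_two, u0, u1]
  simp
  ring

theorem covDeriv_three (T : CoordTensor n 3) (a b c d : Fin n) :
    covDeriv D G T x a ![b, c, d] = pd D (fun z => T z ![b, c, d]) a x
      - ∑ m, christoffel D G x m a b * T x ![m, c, d]
      - ∑ m, christoffel D G x m a c * T x ![b, m, d]
      - ∑ m, christoffel D G x m a d * T x ![b, c, m] := by
  have u0 : ∀ m, Function.update ![b, c, d] 0 m = ![m, c, d] := fun m => by
    ext i; fin_cases i <;> rfl
  have u1 : ∀ m, Function.update ![b, c, d] 1 m = ![b, m, d] := fun m => by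
    ext i; fin_cases i <;> rfl
  have u2 : ∀ m, Function.update ![b, c, d] 2 m = ![b, c, m] := fun m => by
    ext i; fin_cases i <;> rfl
  simp only [covDeriv, Fin.sum_univ_three, u0, u1, u2]
  simp
  ring

theorem covDeriv_four (T : CoordTensor n 4) (a b c d e : Fin n) :
    covDeriv D G T x a ![b, c, d, e] = pd D (fun z => T z ![b, c, d, e]) a x
      - ∑ m, christoffel D G x m a b * T x ![m, c, d, e]
      - ∑ m, christoffel D G x m a c * T x ![b, m, d, e]
      - ∑ m, christoffel D G x m a d * T x ![b, c, m, e]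
      - ∑ m, christoffel D G x m a e * T x ![b, c, d, m] := by
  have u0 : ∀ m, Function.update ![b, c, d, e] 0 m = ![m, c, d, e] := fun m => by
    ext i; fin_cases i <;> rfl
  have u1 : ∀ m, Function.update ![b, c, d, e] 1 m = ![b, m, d, e] := fun m => by
    ext i; fin_cases i <;> rfl
  have u2 : ∀ m, Function.update ![b, c, d, e] 2 m = ![b, c, m, e] := fun m => by
    ext i; fin_cases i <;> rfl
  have u3 : ∀ m, Function.update ![b, c, d, e] 3 m = ![b, c, d, m] := fun m => by
    ext i; fin_cases i <;> rfl
  simp only [covDeriv, Fin.sum_univ_four, u0, u1, u2, u3]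
  simp
  ring

theorem hess_eq (W : Coord n → ℝ) (a b : Fin n) :
    hess D G W x ![a, b] = pd D (pd D W b) a x - ∑ m, christoffel D G x m a b * pd D W m x := by
  simp [hess, covDeriv, grad]

theorem riemannMixed_swap (a b c d : Fin n) :
    riemannMixed D G x a b c d = -riemannMixed D G x b a c d := by
  simp only [riemannMixed, Finset.sum_sub_distrib]
  ring

theorem riemann_swap_left (a b c d : Fin n) :
    riemann D G x ![a, b, c, d] = -riemann D G x ![b, a, c, d] := by
  simp only [riemann, Matrix.cons_val, ← Finset.sum_neg_distrib]
  refine Finset.sum_congr rfl fun e _ => ?_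
  rw [riemannMixed_swap]
  ring

theorem weyl_swap_left (a b c d : Fin n) :
    weyl D G x ![a, b, c, d] = -weyl D G x ![b, a, c, d] := by
  simp only [weyl, Matrix.cons_val]
  rw [riemann_swap_left]
  ring

namespace IsRegularMetric

variable (h : IsRegularMetric D G U) (hx : x ∈ U)
include h hx

/-- By metric compatibility the derivative terms, symmetrised in `c, d`, are commutators of second
derivatives of `g_cd`; the quadratic terms cancel by `christoffel_pairing`. -/
theorem riemann_swap_right (a b c d : Fin n) :
    riemann D G x ![a, b, c, d] = -riemann D G x ![a, b, d, c] := by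
  have hxD := h.subset hx
  have key : ∀ a b, pd D (fun z => christoffelLow D G z d a c) b x
      + pd D (fun z => christoffelLow D G z c a d) b x = pd D (pd D (fun z => G z ![c, d]) a) b x := by
    intro a b
    rw [← pd_add h.domain hxD (h.smooth_christoffelLow hx _ _ _) (h.smooth_christoffelLow hx _ _ _)]
    refine h.pd_congr_on hx (fun z hz => ?_) b
    rw [h.pd_metric hz, add_comm]
  have k1 := key a b
  have k2 := key b a
  rw [pd_comm h.domain hxD (h.smooth _ x hx)] at k2
  rw [h.riemann_eq hx, h.riemann_eq hx]
  simp only [Finset.sum_sub_distrib]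
  rw [h.christoffel_pairing hx b c a d, h.christoffel_pairing hx a c b d]
  linarith

theorem pd_christoffelLow (a b c d : Fin n) : pd D (fun z => christoffelLow D G z d a c) b x =
    1 / 2 * (pd D (pd D (fun z => G z ![c, d]) a) b x + pd D (pd D (fun z => G z ![a, d]) c) b x
      - pd D (pd D (fun z => G z ![a, c]) d) b x) := by
  have hxD := h.subset hx
  have s : ∀ a b c, SmoothWithin D (fun z => pd D (fun z => G z ![a, b]) c z) x := fun a b c =>
    SmoothWithin.pd h.domain hxD (h.smooth _ x hx) c
  simp only [christoffelLow]
  rw [pd_const_mul h.domain hxD _ (((s _ _ _).add (s _ _ _)).sub (s _ _ _)),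
    pd_sub h.domain hxD ((s _ _ _).add (s _ _ _)) (s _ _ _), pd_add h.domain hxD (s _ _ _) (s _ _ _)]

theorem pd_pd_metric_symm (a b c d : Fin n) :
    pd D (pd D (fun z => G z ![a, b]) c) d x = pd D (pd D (fun z => G z ![b, a]) c) d x :=
  h.pd_congr_on hx (fun _ hz => h.pd_congr_on hz (fun w hw => h.symm w hw a b) c) d

/-- Once the first derivatives of the symbols are expanded into second derivatives of the metric,
the symmetry follows from `pd_comm`, the symmetry of `G` and `christoffel_pairing`. -/
theorem riemann_pair (a b c d : Fin n) :
    riemann D G x ![a, b, c, d] = riemann D G x ![c, d, a, b] := by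
  have hxD := h.subset hx
  have cm : ∀ a b c d, pd D (pd D (fun z => G z ![a, b]) c) d x =
      pd D (pd D (fun z => G z ![a, b]) d) c x :=
    fun a b c d => pd_comm h.domain hxD (h.smooth _ x hx) c d
  rw [h.riemann_eq hx, h.riemann_eq hx]
  simp only [Finset.sum_sub_distrib, h.pd_christoffelLow hx]
  have p1 := h.christoffel_pairing hx b c a d
  have p2 := h.christoffel_pairing hx a c b d
  have c1 : ∀ e, christoffel D G x e d a = christoffel D G x e a d := fun e =>
    h.christoffel_symm hx _ _ _
  have c2 : ∀ e, christoffel D G x e c a = christoffel D G x e a c := fun e =>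
    h.christoffel_symm hx _ _ _
  have c3 : ∀ e, christoffelLow D G x e d b = christoffelLow D G x e b d := fun e =>
    h.christoffelLow_symm hx _ _ _
  have c4 : ∀ e, christoffelLow D G x e c b = christoffelLow D G x e b c := fun e =>
    h.christoffelLow_symm hx _ _ _
  simp only [c1, c2, c3, c4]
  rw [p1]
  linarith [cm c d a b, cm a b c d, h.pd_pd_metric_symm hx a d c b, cm d a c b,
    h.pd_pd_metric_symm hx a c d b, cm c a d b, h.pd_pd_metric_symm hx b d c a, cm d b c a,
    h.pd_pd_metric_symm hx b c d a, cm c b d a]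

theorem ricci_symm (a b : Fin n) : ricci D G x ![a, b] = ricci D G x ![b, a] := by
  simp only [ricci, Matrix.cons_val]
  rw [Finset.sum_comm]
  refine Finset.sum_congr rfl fun e _ => Finset.sum_congr rfl fun f _ => ?_
  rw [h.riemann_pair hx, h.inv_symm hx]

theorem schouten_symm (a b : Fin n) : schouten D G x ![a, b] = schouten D G x ![b, a] := by
  simp only [schouten]
  rw [h.ricci_symm hx, h.symm x hx]

theorem weyl_swap_right (a b c d : Fin n) :
    weyl D G x ![a, b, c, d] = -weyl D G x ![a, b, d, c] := by
  simp only [weyl, Matrix.cons_val]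
  rw [h.riemann_swap_right hx]
  ring

theorem weyl_pair (a b c d : Fin n) :
    weyl D G x ![a, b, c, d] = weyl D G x ![c, d, a, b] := by
  simp only [weyl, Matrix.cons_val]
  rw [h.riemann_pair hx, h.symm x hx c a, h.symm x hx c b, h.symm x hx d b, h.symm x hx d a,
    h.schouten_symm hx b d, h.schouten_symm hx a d, h.schouten_symm hx a c, h.schouten_symm hx b c]
  ring

/-- The trace of the Kulkarni-Nomizu product of the metric with a symmetric tensor. -/
theorem trace_kulkarni (P : CoordTensor n 2) (b d : Fin n) :
    ∑ a, ∑ c, invMetric G x a c * (G x ![c, a] * P x ![b, d] - G x ![c, b] * P x ![a, d]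
      + G x ![d, b] * P x ![a, c] - G x ![d, a] * P x ![b, c]) =
    ((n : ℝ) - 2) * P x ![b, d] + trace G P x * G x ![b, d] := by
  have e1 : ∑ a, ∑ c, invMetric G x a c * (G x ![c, a] * P x ![b, d]) = n * P x ![b, d] := by
    rw [← h.trace_metric hx]
    simp only [Finset.sum_mul, mul_assoc]
  have e2 : ∑ a, ∑ c, invMetric G x a c * (G x ![c, b] * P x ![a, d]) = P x ![b, d] :=
    h.sum_inv_mul_metric_mul hx (fun a => P x ![a, d]) b
  have e3 : ∑ a, ∑ c, invMetric G x a c * (G x ![d, b] * P x ![a, c]) =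
      trace G P x * G x ![b, d] := by
    rw [trace, Finset.sum_mul]
    refine Finset.sum_congr rfl fun a _ => ?_
    rw [Finset.sum_mul]
    refine Finset.sum_congr rfl fun c _ => ?_
    rw [h.symm x hx d b]
    ring
  have e4 : ∑ a, ∑ c, invMetric G x a c * (G x ![d, a] * P x ![b, c]) = P x ![b, d] := by
    rw [Finset.sum_comm, ← h.sum_inv_mul_metric_mul hx (fun a => P x ![b, a]) d]
    refine Finset.sum_congr rfl fun a _ => Finset.sum_congr rfl fun c _ => ?_
    rw [h.symm x hx d c, h.inv_symm hx]
  simp only [mul_add, mul_sub, Finset.sum_add_distrib, Finset.sum_sub_distrib]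
  rw [e1, e2, e3, e4]
  ring

theorem trace_schouten (hn : 3 ≤ n) :
    trace G (schouten D G) x = scalarCurv D G x / (2 * ((n : ℝ) - 1)) := by
  have hn' : (3 : ℝ) ≤ n := by exact_mod_cast hn
  have e : trace G (schouten D G) x =
      1 / ((n : ℝ) - 2) * (trace G (ricci D G) x
        - scalarCurv D G x / (2 * ((n : ℝ) - 1)) * ∑ a, ∑ c, invMetric G x a c * G x ![c, a]) := by
    simp only [trace, schouten, Finset.mul_sum, ← Finset.sum_sub_distrib]
    refine Finset.sum_congr rfl fun a _ => Finset.sum_congr rfl fun c _ => ?_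
    rw [h.symm x hx c a]
    ring
  rw [e, h.trace_metric hx, ← scalarCurv]
  have h1 : (n : ℝ) - 1 ≠ 0 := by linarith
  have h2 : (n : ℝ) - 2 ≠ 0 := by linarith
  field_simp
  ring

/-- The Weyl tensor is trace-free. -/
theorem trace_weyl (hn : 3 ≤ n) (b d : Fin n) :
    ∑ a, ∑ c, invMetric G x a c * weyl D G x ![a, b, c, d] = 0 := by
  have hn' : (3 : ℝ) ≤ n := by exact_mod_cast hn
  have e := h.trace_kulkarni hx (schouten D G) b d
  have r : ∑ a, ∑ c, invMetric G x a c * riemann D G x ![a, b, c, d] = ricci D G x ![b, d] := rfl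
  have split : ∑ a, ∑ c, invMetric G x a c * weyl D G x ![a, b, c, d] =
      ricci D G x ![b, d] - (((n : ℝ) - 2) * schouten D G x ![b, d]
        + trace G (schouten D G) x * G x ![b, d]) := by
    rw [← e, ← r]
    simp only [← Finset.sum_sub_distrib, ← mul_sub]
    rfl
  rw [split, h.trace_schouten hx hn]
  simp only [schouten]
  have h1 : (n : ℝ) - 1 ≠ 0 := by linarith
  have h2 : (n : ℝ) - 2 ≠ 0 := by linarith
  field_simp
  ring

/-- A symmetric tensor whose Kulkarni-Nomizu product with the metric is the curvature is the
Schouten tensor. -/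
theorem schouten_eq_of_riemann_eq (hn : 3 ≤ n) (P : CoordTensor n 2)
    (hP : ∀ a b c d, riemann D G x ![a, b, c, d] =
      G x ![c, a] * P x ![b, d] - G x ![c, b] * P x ![a, d]
      + G x ![d, b] * P x ![a, c] - G x ![d, a] * P x ![b, c]) (b d : Fin n) :
    schouten D G x ![b, d] = P x ![b, d] := by
  have hn' : (3 : ℝ) ≤ n := by exact_mod_cast hn
  have h1 : (n : ℝ) - 1 ≠ 0 := by linarith
  have h2 : (n : ℝ) - 2 ≠ 0 := by linarith
  -- One trace gives `Ric = (n-2)P + (tr P) g`, a second gives `R = 2(n-1) tr P`; inserting both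
  -- into the Schouten tensor returns `P`.
  have ric : ∀ b d, ricci D G x ![b, d] =
      ((n : ℝ) - 2) * P x ![b, d] + trace G P x * G x ![b, d] := by
    intro b d
    rw [← h.trace_kulkarni hx]
    simp only [ricci, Matrix.cons_val, hP]
  have scal : scalarCurv D G x = 2 * ((n : ℝ) - 1) * trace G P x := by
    have : scalarCurv D G x = ((n : ℝ) - 2) * trace G P x
        + trace G P x * ∑ a, ∑ c, invMetric G x a c * G x ![c, a] := by
      rw [scalarCurv]
      conv_lhs => rw [trace]
      conv_rhs => enter [1]; rw [trace]
      simp only [ric, Finset.mul_sum, ← Finset.sum_add_distrib]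
      refine Finset.sum_congr rfl fun a _ => Finset.sum_congr rfl fun c _ => ?_
      rw [h.symm x hx c a]
      ring
    rw [this, h.trace_metric hx]
    ring
  simp only [schouten, ric, scal]
  field_simp
  ring

/-- Differentiating `g g⁻¹ = 1` and raising an index expresses `∇g⁻¹ = 0`. -/
theorem pd_inv (c a f : Fin n) : pd D (fun z => invMetric G z a f) c x =
    -∑ e, (christoffel D G x a c e * invMetric G x e f
      + christoffel D G x f c e * invMetric G x a e) := by
  have hxD := h.subset hx
  have key : ∀ d, ∑ b, G x ![d, b] * pd D (fun z => invMetric G z b f) c x =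
      -∑ b, pd D (fun z => G z ![d, b]) c x * invMetric G x b f := by
    intro d
    have : pd D (fun z => ∑ b, G z ![d, b] * invMetric G z b f) c x = 0 := by
      rw [h.pd_congr_on hx (fun z hz => h.metric_mul_inv hz d f), pd_const]
    rw [pd_sum h.domain hxD fun b _ => (h.smooth _ x hx).mul (h.smooth_inv hx b f)] at this
    simp only [pd_mul h.domain hxD (h.smooth _ x hx) (h.smooth_inv hx _ f),
      Finset.sum_add_distrib] at this
    linarith
  rw [← h.raise_lower hx (fun b => pd D (fun z => invMetric G z b f) c x) a]
  simp only [key, h.pd_metric hx, add_mul, Finset.sum_add_distrib, mul_neg, mul_add,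
    Finset.sum_neg_distrib]
  congr 1
  congr 1
  · simp only [christoffel_eq, Finset.mul_sum, Finset.sum_mul]
    rw [Finset.sum_comm]
    exact Finset.sum_congr rfl fun b _ => Finset.sum_congr rfl fun d _ => by ring
  · refine Finset.sum_congr rfl fun d _ => ?_
    rw [mul_comm, christoffel_eq]
    congr 1
    exact Finset.sum_congr rfl fun b _ => by rw [h.inv_symm hx b f]; ring

/-- The derivative of a raised covector. -/
theorem pd_raise {w : Fin n → Coord n → ℝ} (hw : ∀ b, SmoothWithin D (w b) x) (c a : Fin n) :
    pd D (fun z => ∑ b, invMetric G z a b * w b z) c x =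
      ∑ b, invMetric G x a b * (pd D (w b) c x - ∑ m, christoffel D G x m c b * w m x)
        - ∑ m, christoffel D G x a c m * ∑ b, invMetric G x m b * w b x := by
  have hxD := h.subset hx
  rw [pd_sum h.domain hxD fun b _ => (h.smooth_inv hx a b).mul (hw b)]
  simp only [pd_mul h.domain hxD (h.smooth_inv hx a _) (hw _), h.pd_inv hx, neg_mul,
    Finset.sum_add_distrib, Finset.sum_neg_distrib, mul_sub, Finset.sum_sub_distrib, add_mul,
    Finset.sum_mul, Finset.mul_sum]
  have e1 : ∑ b, ∑ e, christoffel D G x a c e * invMetric G x e b * w b x =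
      ∑ m, ∑ b, christoffel D G x a c m * (invMetric G x m b * w b x) := by
    rw [Finset.sum_comm]
    exact Finset.sum_congr rfl fun b _ => Finset.sum_congr rfl fun d _ => by ring
  have e2 : ∑ b, ∑ e, christoffel D G x b c e * invMetric G x a e * w b x =
      ∑ b, ∑ m, invMetric G x a b * (christoffel D G x m c b * w m x) := by
    rw [Finset.sum_comm]
    exact Finset.sum_congr rfl fun b _ => Finset.sum_congr rfl fun d _ => by ring
  rw [e1, e2]
  ring

/-- The derivative of a trace. -/
theorem pd_contract {F : Fin n → Fin n → Coord n → ℝ} (hF : ∀ a b, SmoothWithin D (F a b) x)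
    (c : Fin n) : pd D (fun z => ∑ a, ∑ b, invMetric G z a b * F a b z) c x =
      ∑ a, ∑ b, invMetric G x a b * (pd D (F a b) c x - ∑ m, christoffel D G x m c a * F m b x
        - ∑ m, christoffel D G x m c b * F a m x) := by
  have hxD := h.subset hx
  rw [pd_sum h.domain hxD fun a _ => ContDiffWithinAt.sum fun b _ =>
    (h.smooth_inv hx a b).mul (hF a b)]
  simp only [h.pd_raise hx (hF _)]
  simp only [mul_sub, Finset.sum_sub_distrib, Finset.mul_sum]
  have e : ∑ a, ∑ m, ∑ b, christoffel D G x a c m * (invMetric G x m b * F a b x) =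
      ∑ a, ∑ b, ∑ m, invMetric G x a b * (christoffel D G x m c a * F m b x) := by
    rw [Finset.sum_comm]
    refine Finset.sum_congr rfl fun a _ => ?_
    rw [Finset.sum_comm]
    exact Finset.sum_congr rfl fun b _ => Finset.sum_congr rfl fun d _ => by ring
  rw [e]
  ring

/-- The Ricci identity for a gradient. -/
theorem ricci_identity_grad {W : Coord n → ℝ} (hW : SmoothWithin D W x) (a b c : Fin n) :
    (pd D (fun z => hess D G W z ![b, c]) a x
        - ∑ m, christoffel D G x m a c * hess D G W x ![b, m])
      - (pd D (fun z => hess D G W z ![a, c]) b x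
        - ∑ m, christoffel D G x m b c * hess D G W x ![a, m]) =
    ∑ d, riemannMixed D G x a b c d * pd D W d x := by
  have hxD := h.subset hx
  have s1 : ∀ c, SmoothWithin D (pd D W c) x := fun c => hW.pd h.domain hxD c
  have s2 : ∀ c b, SmoothWithin D (pd D (pd D W c) b) x := fun c b => (s1 c).pd h.domain hxD b
  have sΓ := fun a b c => h.smooth_christoffel hx a b c
  have expand : ∀ a b, pd D (fun z => hess D G W z ![b, c]) a x = pd D (pd D (pd D W c) b) a x
      - ∑ m, (pd D (fun z => christoffel D G z m b c) a x * pd D W m x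
        + christoffel D G x m b c * pd D (pd D W m) a x) := by
    intro a b
    simp only [hess_eq]
    rw [pd_sub h.domain hxD (s2 c b) (ContDiffWithinAt.sum fun m _ => (sΓ m b c).mul (s1 m)),
      pd_sum h.domain hxD fun m _ => (sΓ m b c).mul (s1 m)]
    simp only [pd_mul h.domain hxD (sΓ _ b c) (s1 _)]
  rw [expand, expand, pd_comm h.domain hxD (s1 c) a b]
  simp only [hess_eq, riemannMixed, mul_sub, add_mul, sub_mul, Finset.sum_add_distrib,
    Finset.sum_sub_distrib, Finset.mul_sum, Finset.sum_mul]
  have e : ∀ a b, ∑ m, ∑ d, christoffel D G x m a c * (christoffel D G x d b m * pd D W d x) =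
      ∑ d, ∑ m, christoffel D G x m a c * christoffel D G x d b m * pd D W d x := by
    intro a b
    rw [Finset.sum_comm]
    exact Finset.sum_congr rfl fun b _ => Finset.sum_congr rfl fun d _ => by ring
  rw [e a b, e b a]
  ring

/-- The Ricci identity for a tensor of rank two. -/
theorem ricci_identity_two {T : CoordTensor n 2} (hT : ∀ z ∈ U, ∀ I, SmoothWithin D (fun w => T w I) z)
    (k i j l : Fin n) :
    (pd D (fun z => covDeriv D G T z i ![j, l]) k x
        - ∑ m, christoffel D G x m k j * covDeriv D G T x i ![m, l]
        - ∑ m, christoffel D G x m k l * covDeriv D G T x i ![j, m])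
      - (pd D (fun z => covDeriv D G T z k ![j, l]) i x
        - ∑ m, christoffel D G x m i j * covDeriv D G T x k ![m, l]
        - ∑ m, christoffel D G x m i l * covDeriv D G T x k ![j, m]) =
    ∑ e, (riemannMixed D G x k i j e * T x ![e, l] + riemannMixed D G x k i l e * T x ![j, e]) := by
  have hxD := h.subset hx
  have s0 : ∀ I, SmoothWithin D (fun w => T w I) x := hT x hx
  have s1 : ∀ I c, SmoothWithin D (pd D (fun w => T w I) c) x := fun I c => (s0 I).pd h.domain hxD c
  have sΓ := fun a b c => h.smooth_christoffel hx a b c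
  have expand : ∀ i k, pd D (fun z => covDeriv D G T z i ![j, l]) k x =
      pd D (pd D (fun z => T z ![j, l]) i) k x
      - ∑ m, (pd D (fun z => christoffel D G z m i j) k x * T x ![m, l]
        + christoffel D G x m i j * pd D (fun z => T z ![m, l]) k x)
      - ∑ m, (pd D (fun z => christoffel D G z m i l) k x * T x ![j, m]
        + christoffel D G x m i l * pd D (fun z => T z ![j, m]) k x) := by
    intro i k
    simp only [covDeriv_two]
    have t1 : SmoothWithin D (fun z => ∑ m, christoffel D G z m i j * T z ![m, l]) x :=
      ContDiffWithinAt.sum fun m _ => (sΓ m i j).mul (s0 _)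
    have t2 : SmoothWithin D (fun z => ∑ m, christoffel D G z m i l * T z ![j, m]) x :=
      ContDiffWithinAt.sum fun m _ => (sΓ m i l).mul (s0 _)
    rw [pd_sub h.domain hxD ((s1 _ i).sub t1) t2, pd_sub h.domain hxD (s1 _ i) t1,
      pd_sum h.domain hxD fun m _ => (sΓ m i j).mul (s0 _),
      pd_sum h.domain hxD fun m _ => (sΓ m i l).mul (s0 _)]
    simp only [pd_mul h.domain hxD (sΓ _ _ _) (s0 _)]
  rw [expand, expand, pd_comm h.domain hxD (s0 _) k i]
  simp only [covDeriv_two, riemannMixed, mul_sub, add_mul, sub_mul, Finset.sum_add_distrib,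
    Finset.sum_sub_distrib, Finset.mul_sum, Finset.sum_mul]
  have e1 : ∀ i k, ∑ m, ∑ p, christoffel D G x m k j * (christoffel D G x p i m * T x ![p, l]) =
      ∑ e, ∑ m, christoffel D G x m k j * christoffel D G x e i m * T x ![e, l] := by
    intro i k
    rw [Finset.sum_comm]
    exact Finset.sum_congr rfl fun b _ => Finset.sum_congr rfl fun d _ => by ring
  have e2 : ∀ i k, ∑ m, ∑ p, christoffel D G x m k l * (christoffel D G x p i m * T x ![j, p]) =
      ∑ e, ∑ m, christoffel D G x m k l * christoffel D G x e i m * T x ![j, e] := by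
    intro i k
    rw [Finset.sum_comm]
    exact Finset.sum_congr rfl fun b _ => Finset.sum_congr rfl fun d _ => by ring
  have e3 : ∀ i k, ∑ m, ∑ p, christoffel D G x m k j * (christoffel D G x p i l * T x ![m, p]) =
      ∑ m, ∑ p, christoffel D G x m i l * (christoffel D G x p k j * T x ![p, m]) := by
    intro i k
    rw [Finset.sum_comm]
    exact Finset.sum_congr rfl fun b _ => Finset.sum_congr rfl fun d _ => by ring
  rw [e1 i k, e1 k i, e2 i k, e2 k i, e3 i k, e3 k i]
  ring

end IsRegularMetric

end Curvature

/-! ### The divergence of the Cotton tensor -/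

section DivCotton

variable {n k : ℕ} {D U : Set (Coord n)} {G : CoordTensor n 2} {x : Coord n}

/-- Applied with `v = ∇Ω`, this removes the doubly normal part of traces of Riemann and of the
rescaled Weyl tensor. -/
theorem sum_mul_antisymm {ι : Type*} [Fintype ι] (v : ι → ℝ) (F : ι → ι → ℝ)
    (hF : ∀ a b, F a b = -F b a) : ∑ a, ∑ b, v a * v b * F a b = 0 := by
  have h : ∑ a, ∑ b, v a * v b * F a b = -∑ a, ∑ b, v a * v b * F a b := by
    conv_lhs => rw [Finset.sum_comm]
    simp only [← Finset.sum_neg_distrib]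
    refine Finset.sum_congr rfl fun a _ => Finset.sum_congr rfl fun b _ => ?_
    rw [hF]
    ring
  linarith

namespace IsRegularMetric

variable (h : IsRegularMetric D G U) (hx : x ∈ U)
include h hx

theorem sum_inv_mul_symm (F : Fin n → Fin n → ℝ) :
    ∑ a, ∑ b, invMetric G x a b * F a b = ∑ a, ∑ b, invMetric G x a b * F b a := by
  rw [Finset.sum_comm]
  refine Finset.sum_congr rfl fun a _ => Finset.sum_congr rfl fun b _ => ?_
  rw [h.inv_symm hx]

theorem sum_inv_mul_antisymm (F : Fin n → Fin n → ℝ) (hF : ∀ a b, F a b = -F b a) :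
    ∑ a, ∑ b, invMetric G x a b * F a b = 0 := by
  have e := h.sum_inv_mul_symm hx F
  have e' : ∑ a, ∑ b, invMetric G x a b * F a b = -∑ a, ∑ b, invMetric G x a b * F b a := by
    simp only [← Finset.sum_neg_distrib]
    refine Finset.sum_congr rfl fun a _ => Finset.sum_congr rfl fun b _ => ?_
    rw [hF]
    ring
  linarith

theorem sum_inv_mul_metric_mul' (F : Fin n → ℝ) (b : Fin n) :
    ∑ a, ∑ c, invMetric G x a c * (G x ![a, b] * F c) = F b := by
  rw [← h.sum_inv_mul_metric_mul hx F b, Finset.sum_comm]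
  refine Finset.sum_congr rfl fun a _ => Finset.sum_congr rfl fun c _ => ?_
  rw [h.inv_symm hx]

theorem riemann_raise (a b c e : Fin n) :
    riemannMixed D G x a b c e = ∑ d, invMetric G x e d * riemann D G x ![a, b, c, d] := by
  rw [← h.raise_lower hx (riemannMixed D G x a b c) e]
  refine Finset.sum_congr rfl fun d _ => ?_
  congr 1
  refine Finset.sum_congr rfl fun f _ => ?_
  simp only [Matrix.cons_val]
  rw [h.symm x hx d f, mul_comm]

/-- The action of a curvature tensor of Kulkarni-Nomizu form on the tensor it is formed from. -/
theorem curvature_action {P : CoordTensor n 2} (hPs : ∀ a b, P x ![a, b] = P x ![b, a])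
    (hP : ∀ a b c d, riemann D G x ![a, b, c, d] =
      G x ![c, a] * P x ![b, d] - G x ![c, b] * P x ![a, d]
      + G x ![d, b] * P x ![a, c] - G x ![d, a] * P x ![b, c]) (a b c d : Fin n) :
    ∑ e, (riemannMixed D G x a b c e * P x ![e, d] + riemannMixed D G x a b d e * P x ![c, e]) =
      G x ![c, a] * (∑ e, ∑ f, invMetric G x e f * (P x ![b, e] * P x ![f, d]))
      - G x ![c, b] * (∑ e, ∑ f, invMetric G x e f * (P x ![a, e] * P x ![f, d]))
      + G x ![d, a] * (∑ e, ∑ f, invMetric G x e f * (P x ![b, e] * P x ![f, c]))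
      - G x ![d, b] * (∑ e, ∑ f, invMetric G x e f * (P x ![a, e] * P x ![f, c])) := by
  -- Acting on one slot leaves `P_ac P_bd - P_bc P_ad`, which is antisymmetric in `c, d` and
  -- disappears when the action on the other slot is added.
  have key : ∀ a b c d, ∑ e, riemannMixed D G x a b c e * P x ![e, d] =
      G x ![c, a] * (∑ e, ∑ f, invMetric G x e f * (P x ![b, e] * P x ![f, d]))
      - G x ![c, b] * (∑ e, ∑ f, invMetric G x e f * (P x ![a, e] * P x ![f, d]))
      + P x ![a, c] * P x ![b, d] - P x ![b, c] * P x ![a, d] := by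
    intro a b c d
    have m1 := h.sum_inv_mul_metric_mul hx (fun e => P x ![e, d] * P x ![a, c]) b
    have m2 := h.sum_inv_mul_metric_mul hx (fun e => P x ![e, d] * P x ![b, c]) a
    have q : ∀ a b c, ∑ e, ∑ f, invMetric G x e f * (G x ![c, a] * P x ![b, f] * P x ![e, d]) =
        G x ![c, a] * ∑ e, ∑ f, invMetric G x e f * (P x ![b, e] * P x ![f, d]) := by
      intro a b c
      rw [h.sum_inv_mul_symm hx]
      simp only [Finset.mul_sum]
      exact Finset.sum_congr rfl fun e _ => Finset.sum_congr rfl fun f _ => by ring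
    rw [← q, ← q]
    have m1' : P x ![a, c] * P x ![b, d] =
        ∑ e, ∑ f, invMetric G x e f * (G x ![f, b] * (P x ![e, d] * P x ![a, c])) := by
      rw [m1]; ring
    have m2' : P x ![b, c] * P x ![a, d] =
        ∑ e, ∑ f, invMetric G x e f * (G x ![f, a] * (P x ![e, d] * P x ![b, c])) := by
      rw [m2]; ring
    rw [m1', m2']
    simp only [← Finset.sum_sub_distrib, ← Finset.sum_add_distrib]
    refine Finset.sum_congr rfl fun e _ => ?_
    rw [h.riemann_raise hx, Finset.sum_mul]
    refine Finset.sum_congr rfl fun f _ => ?_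
    rw [hP]
    ring
  rw [Finset.sum_add_distrib, key a b c d]
  have := key a b d c
  simp only [hPs c] at *
  rw [this, hPs a c, hPs b d, hPs a d, hPs b c]
  ring

/-- If the curvature is the Kulkarni-Nomizu product of the metric and the Schouten tensor, and the
Cotton tensor is trace-free, then the Cotton tensor is divergence-free. -/
theorem div_cotton (hP : ∀ a b c d, riemann D G x ![a, b, c, d] =
      G x ![c, a] * schouten D G x ![b, d] - G x ![c, b] * schouten D G x ![a, d]
      + G x ![d, b] * schouten D G x ![a, c] - G x ![d, a] * schouten D G x ![b, c])
    (htr : ∀ z ∈ U, ∀ j, ∑ k, ∑ l, invMetric G z k l * cotton D G z ![k, l, j] = 0)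
    (i j : Fin n) :
    ∑ k, ∑ l, invMetric G x k l * covDeriv D G (cotton D G) x k ![l, i, j] = 0 := by
  have hxD := h.subset hx
  set P := schouten D G with hPdef
  have sP : ∀ z ∈ U, ∀ I, SmoothWithin D (fun w => P w I) z := fun z hz I => h.smooth_schouten hz I
  have sS : ∀ i I, SmoothWithin D (fun z => covDeriv D G P z i I) x := fun i I =>
    h.smooth_covDeriv hx (sP x hx) i I
  -- `full k i j l` is `∇_k ∇_i P_jl`, and `Rc` below is the commutator of its first two
  -- derivatives.
  set full : Fin n → Fin n → Fin n → Fin n → ℝ := fun k i j l =>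
    pd D (fun z => covDeriv D G P z i ![j, l]) k x
        - ∑ m, christoffel D G x m k i * covDeriv D G P x m ![j, l]
        - ∑ m, christoffel D G x m k j * covDeriv D G P x i ![m, l]
        - ∑ m, christoffel D G x m k l * covDeriv D G P x i ![j, m] with hfull
  set Rc : Fin n → Fin n → Fin n → Fin n → ℝ := fun k i j l =>
    ∑ e, (riemannMixed D G x k i j e * P x ![e, l] + riemannMixed D G x k i l e * P x ![j, e])
    with hRc
  have comm : ∀ k i j l, full k i j l = full i k j l + Rc k i j l := by
    intro k i j l
    have := h.ricci_identity_two hx sP k i j l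
    have sym : ∑ m, christoffel D G x m k i * covDeriv D G P x m ![j, l] =
        ∑ m, christoffel D G x m i k * covDeriv D G P x m ![j, l] :=
      Finset.sum_congr rfl fun m _ => by rw [h.christoffel_symm hx]
    simp only [hfull, hRc]
    linarith
  have cot : ∀ k l i j, covDeriv D G (cotton D G) x k ![l, i, j] = full k i j l - full k j i l := by
    intro k l i j
    rw [covDeriv_three]
    simp only [cotton, Matrix.cons_val]
    rw [pd_sub h.domain hxD (sS _ _) (sS _ _)]
    simp only [mul_sub, Finset.sum_sub_distrib, hfull]
    ring
  have sA : ∀ I, SmoothWithin D (fun z => cotton D G z I) x := fun I => (sS _ _).sub (sS _ _)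
  -- The covariant derivative of the vanishing Cotton trace: after tracing, `∇_i ∇^k P_jk = ∇_i ∇_j
  -- tr P`.
  have dtr : ∀ i j, ∑ k, ∑ l, invMetric G x k l * (full i l j k - full i j l k) = 0 := by
    intro i j
    have e := h.pd_contract hx (F := fun k l z => cotton D G z ![k, l, j]) (fun k l => sA _) i
    rw [h.pd_congr_on hx (fun z hz => htr z hz j), pd_const] at e
    have e2 : ∑ k, ∑ l, invMetric G x k l * ∑ m, christoffel D G x m i j * cotton D G x ![k, l, m]
        = 0 := by
      have : ∑ m, christoffel D G x m i j *
          ∑ k, ∑ l, invMetric G x k l * cotton D G x ![k, l, m] = 0 := by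
        simp only [htr x hx, mul_zero, Finset.sum_const_zero]
      rw [← this]
      simp only [Finset.mul_sum]
      conv_rhs => rw [Finset.sum_comm]
      refine Finset.sum_congr rfl fun k _ => ?_
      conv_rhs => rw [Finset.sum_comm]
      exact Finset.sum_congr rfl fun l _ => Finset.sum_congr rfl fun m _ => by ring
    have e3 := congrArg₂ (· - ·) e.symm e2
    simp only [← Finset.sum_sub_distrib, ← mul_sub, sub_zero] at e3
    rw [← e3]
    refine Finset.sum_congr rfl fun k _ => Finset.sum_congr rfl fun l _ => ?_
    rw [← cot, covDeriv_three]
  have Ps : ∀ b d, P x ![b, d] = P x ![d, b] := h.schouten_symm hx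
  have act := fun a b c d => h.curvature_action hx (h.schouten_symm hx) hP a b c d
  set PP : Fin n → Fin n → ℝ := fun b d =>
    ∑ e, ∑ f, invMetric G x e f * (P x ![b, e] * P x ![f, d]) with hPP
  have PPs : ∀ b d, PP b d = PP d b := by
    intro b d
    simp only [hPP]
    rw [h.sum_inv_mul_symm hx]
    refine Finset.sum_congr rfl fun e _ => Finset.sum_congr rfl fun f _ => ?_
    rw [Ps b f, Ps e d]
    ring
  have act' : ∀ a b c d, Rc a b c d = G x ![c, a] * PP b d - G x ![c, b] * PP a d
      + G x ![d, a] * PP b c - G x ![d, b] * PP a c := act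
  -- Second derivatives of the scalar `tr P` commute.
  have c1 : ∑ k, ∑ l, invMetric G x k l * Rc i j l k = 0 := by
    have f1 := h.sum_inv_mul_metric_mul hx (PP j) i
    have f2 := h.sum_inv_mul_metric_mul hx (PP i) j
    have f3 := h.sum_inv_mul_metric_mul' hx (PP j) i
    have f4 := h.sum_inv_mul_metric_mul' hx (PP i) j
    simp only [act']
    simp only [mul_add, mul_sub, Finset.sum_add_distrib, Finset.sum_sub_distrib]
    rw [f1, f2, f3, f4, PPs i j]
    ring
  -- This curvature correction is symmetric in `i, j`, so it cancels in the Cotton divergence, which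
  -- is antisymmetric. What then remains is the commutator of `∇_i` and `∇_j` on `tr P`.
  have c2 : ∀ i j, ∑ k, ∑ l, invMetric G x k l * Rc k i j l = n * PP i j
      - G x ![i, j] * ∑ k, ∑ l, invMetric G x k l * PP k l := by
    intro i j
    have f1 := h.sum_inv_mul_metric_mul' hx (PP i) j
    have f4 := h.sum_inv_mul_metric_mul hx (fun k => PP k j) i
    have f2 : ∑ k, ∑ l, invMetric G x k l * (G x ![j, i] * PP k l) =
        G x ![i, j] * ∑ k, ∑ l, invMetric G x k l * PP k l := by
      simp only [Finset.mul_sum]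
      refine Finset.sum_congr rfl fun e _ => Finset.sum_congr rfl fun f _ => ?_
      rw [h.symm x hx j i]
      ring
    have f3 : ∑ k, ∑ l, invMetric G x k l * (G x ![l, k] * PP i j) = n * PP i j := by
      rw [← h.trace_metric hx]
      simp only [Finset.sum_mul, mul_assoc]
    simp only [h.symm x hx _ j] at f1
    simp only [act']
    simp only [mul_add, mul_sub, Finset.sum_add_distrib, Finset.sum_sub_distrib]
    rw [f1, f2, f3, f4, PPs i j]
    ring
  have t1 : ∑ k, ∑ l, invMetric G x k l * full i k j l = ∑ k, ∑ l, invMetric G x k l * full i l j k :=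
    h.sum_inv_mul_symm hx _
  have t2 : ∑ k, ∑ l, invMetric G x k l * full j k i l = ∑ k, ∑ l, invMetric G x k l * full j l i k :=
    h.sum_inv_mul_symm hx _
  have t3 : ∑ k, ∑ l, invMetric G x k l * full i j l k =
      ∑ k, ∑ l, invMetric G x k l * full j i l k + ∑ k, ∑ l, invMetric G x k l * Rc i j l k := by
    simp only [comm i j, mul_add, Finset.sum_add_distrib]
  have t4 : ∀ i j, ∑ k, ∑ l, invMetric G x k l * full k i j l =
      ∑ k, ∑ l, invMetric G x k l * full i k j l + ∑ k, ∑ l, invMetric G x k l * Rc k i j l := by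
    intro i j
    simp only [← Finset.sum_add_distrib, ← mul_add, ← comm]
  have d1 := dtr i j
  have d2 := dtr j i
  simp only [cot, mul_sub, Finset.sum_sub_distrib] at d1 d2 ⊢
  rw [t4 i j, t4 j i, c2 i j, c2 j i, PPs j i, h.symm x hx j i]
  rw [c1] at t3
  linarith

end IsRegularMetric

end DivCotton

/-! ### Causal character, conormal and induced metric of the boundary -/

section Boundary

/-- The gradient vector `∇ᵃ W`. -/
noncomputable def gradVec (G : CoordTensor 4 2) (W : Coord 4 → ℝ) (x : Coord 4) (a : Fin 4) : ℝ :=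
  ∑ b, invMetric G x a b * pd halfSpace W b x

/-- The data of a conformal extension in a boundary chart with coordinate domain `U`. -/
structure IsBoundaryChart (Lam : ℝ) (W : Coord 4 → ℝ) (G : CoordTensor 4 2) (d : CoordTensor 4 4)
    (Q : CoordTensor 4 3) (U : Set (Coord 4)) : Prop where
  lam_pos : 0 < Lam
  metric : IsRegularMetric halfSpace G U
  lorentz : ∀ x ∈ U, ∃ E : Matrix (Fin 4) (Fin 4) ℝ, E.det ≠ 0 ∧
    ∀ a b, G x ![a, b] = -(E 0 a * E 0 b) + ∑ i : Fin 3, E i.succ a * E i.succ b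
  smooth_factor : ∀ x ∈ U, SmoothWithin halfSpace W x
  factor_pos : ∀ x ∈ U, 0 < x 0 → 0 < W x
  factor_zero : ∀ x ∈ U, x 0 = 0 → W x = 0
  smooth_weyl : ∀ I, ∀ x ∈ U, SmoothWithin halfSpace (fun z => d z I) x
  rescaled_weyl : ∀ I, ∀ x ∈ U, 0 < x 0 → d x I = (W x)⁻¹ * weyl halfSpace G x I
  hessian : ∀ x ∈ U, x 0 = 0 → ∀ a b,
    hess halfSpace G W x ![a, b] = friedrichScalar G W x * G x ![a, b]
  divergence : ∀ x ∈ U, x 0 = 0 → ∀ a b c,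
    ∑ e, ∑ f, invMetric G x e f * covDeriv halfSpace G d x e ![f, a, b, c] = Q x ![a, b, c]
  schouten_curl : ∀ x ∈ U, x 0 = 0 → ∀ a b c, cotton halfSpace G x ![a, b, c] =
    ∑ e, ∑ f, invMetric G x e f * d x ![f, a, b, c] * pd halfSpace W e x
  cosmological : ∀ x ∈ U, x 0 = 0 →
    Lam = -(3 * ∑ a, ∑ b, invMetric G x a b * pd halfSpace W a x * pd halfSpace W b x)

/-- A unit conormal of the boundary, in a chart. -/
structure IsConormalInChart (G : CoordTensor 4 2) (N : CoordTensor 4 1) (U : Set (Coord 4)) :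
    Prop where
  normal : ∀ y, boundaryPoint y ∈ U → ∀ i : Fin 3, N (boundaryPoint y) ![i.succ] = 0
  unit : ∀ y, boundaryPoint y ∈ U →
    ∑ a, normalVec G N (boundaryPoint y) a * N (boundaryPoint y) ![a] = -1
  inward : ∀ y, boundaryPoint y ∈ U → 0 < normalVec G N (boundaryPoint y) 0

theorem boundaryPoint_zero (y : Coord 3) : boundaryPoint y 0 = 0 := by
  simp [boundaryPoint]

namespace IsBoundaryChart

variable {Lam : ℝ} {W : Coord 4 → ℝ} {G : CoordTensor 4 2} {d : CoordTensor 4 4}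
  {Q : CoordTensor 4 3} {N : CoordTensor 4 1} {U : Set (Coord 4)} {y : Coord 3}

/-! #### The causal character of the boundary -/

theorem tangential_apply_two (i j : Fin 3) :
    tangential G y ![i, j] = G (boundaryPoint y) ![i.succ, j.succ] := by
  simp only [tangential]
  congr 1
  ext m; fin_cases m <;> rfl

variable (h : IsBoundaryChart Lam W G d Q U)
include h

theorem boundary_nhds (hy : boundaryPoint y ∈ U) :
    ∀ᶠ z in 𝓝 y, boundaryPoint z ∈ U := by
  have t : Tendsto boundaryPoint (𝓝 y) (𝓝[halfSpace] (boundaryPoint y)) :=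
    tendsto_nhdsWithin_of_tendsto_nhds_of_eventually_within _
      continuous_boundaryPoint.continuousAt (Eventually.of_forall boundaryPoint_mem)
  exact t (h.metric.nhds _ hy)

theorem pd_factor_succ (hy : boundaryPoint y ∈ U) (i : Fin 3) :
    pd halfSpace W i.succ (boundaryPoint y) = 0 := by
  rw [← pd_restrict (h.smooth_factor _ hy), pd_congr (g := fun _ => 0) (Set.mem_univ y) ?_, pd_const]
  rw [nhdsWithin_univ]
  filter_upwards [h.boundary_nhds hy] with z hz
  exact h.factor_zero _ hz (boundaryPoint_zero z)

theorem cosmological_zero (hy : boundaryPoint y ∈ U) :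
    Lam = -(3 * (invMetric G (boundaryPoint y) 0 0 * pd halfSpace W 0 (boundaryPoint y) ^ 2)) := by
  have e := h.cosmological _ hy (boundaryPoint_zero y)
  simp only [Fin.sum_univ_succ (n := 3), h.pd_factor_succ hy, mul_zero, Finset.sum_const_zero,
    add_zero, zero_mul] at e
  rw [e]
  ring

/-- A boundary point is a local minimum of the conformal factor within the half space, so the
one-sided derivative in an inward direction has a sign. -/
theorem pd_factor_nonneg (hy : boundaryPoint y ∈ U) :
    0 ≤ pd halfSpace W 0 (boundaryPoint y) := by
  have hmin : IsLocalMinOn W halfSpace (boundaryPoint y) := by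
    filter_upwards [h.metric.nhds _ hy, self_mem_nhdsWithin] with z hz hz'
    rw [h.factor_zero _ hy (boundaryPoint_zero y)]
    rw [halfSpace_eq] at hz'
    rcases (show 0 ≤ z 0 from hz').eq_or_lt with h0 | h0
    · exact (h.factor_zero z hz h0.symm).ge
    · exact (h.factor_pos z hz h0).le
  refine hmin.hasFDerivWithinAt_nonneg (h.smooth_factor _ hy).differentiable.hasFDerivWithinAt ?_
  refine mem_posTangentConeAt_of_segment_subset ?_
  refine (𝓡∂ 4).convex_range.segment_subset (boundaryPoint_mem y) ?_
  change _ ∈ halfSpace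
  rw [halfSpace_eq]
  simp [boundaryPoint_zero]

/-- If the derivative vanished, the cosmological equation would give `Λ = 0`. -/
theorem pd_factor_pos (hy : boundaryPoint y ∈ U) :
    0 < pd halfSpace W 0 (boundaryPoint y) := by
  refine lt_of_le_of_ne (h.pd_factor_nonneg hy) fun h0 => ?_
  have e := h.cosmological_zero hy
  rw [← h0] at e
  have := h.lam_pos
  norm_num at e
  linarith

theorem gradVec_eq (hy : boundaryPoint y ∈ U) (a : Fin 4) : gradVec G W (boundaryPoint y) a =
    invMetric G (boundaryPoint y) a 0 * pd halfSpace W 0 (boundaryPoint y) := by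
  simp [gradVec, Fin.sum_univ_succ (n := 3), h.pd_factor_succ hy]

theorem metric_mul_gradVec {x : Coord 4} (hx : x ∈ U) (a : Fin 4) :
    ∑ b, G x ![a, b] * gradVec G W x b = pd halfSpace W a x :=
  h.metric.lower_raise hx (fun b => pd halfSpace W b x) a

theorem gradVec_sq (hy : boundaryPoint y ∈ U) :
    ∑ a, gradVec G W (boundaryPoint y) a * pd halfSpace W a (boundaryPoint y) = -(Lam / 3) := by
  have e := h.cosmological _ hy (boundaryPoint_zero y)
  have e2 : ∑ a, gradVec G W (boundaryPoint y) a * pd halfSpace W a (boundaryPoint y) =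
      ∑ a, ∑ b, invMetric G (boundaryPoint y) a b * pd halfSpace W a (boundaryPoint y)
        * pd halfSpace W b (boundaryPoint y) := by
    simp only [gradVec, Finset.sum_mul]
    exact Finset.sum_congr rfl fun a _ => Finset.sum_congr rfl fun b _ => by ring
  rw [e2]
  linarith

/-- The boundary is spacelike. -/
theorem posDef_tangential (hy : boundaryPoint y ∈ U) :
    (Matrix.of fun i j => tangential G y ![i, j]).PosDef := by
  refine Matrix.PosDef.of_dotProduct_mulVec_pos ?_ ?_
  · ext i j
    simp only [Matrix.conjTranspose_apply, Matrix.of_apply, star_trivial, tangential_apply_two]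
    exact h.metric.symm _ hy _ _
  intro v hv
  obtain ⟨E, hE, hG⟩ := h.lorentz _ hy
  -- A vector `u` tangent to the boundary is orthogonal to the timelike `V`. In an orthonormal
  -- frame, with `p = Eu` and `r = EV`, this reads `p₀ r₀ = p·r` and `r₀² = |r|² + Λ/3`, where `p·r`
  -- and `|r|` involve the spatial entries only.
  set V := gradVec G W (boundaryPoint y) with hV
  set u : Fin 4 → ℝ := Fin.cons 0 v with hu
  have quad : ∀ p q : Fin 4 → ℝ, ∑ a, p a * ∑ b, G (boundaryPoint y) ![a, b] * q b =
      -((E.mulVec p 0) * (E.mulVec q 0)) + ∑ i : Fin 3, E.mulVec p i.succ * E.mulVec q i.succ := by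
    intro p q
    simp only [hG, Matrix.mulVec, dotProduct, Fin.sum_univ_succ, Fin.sum_univ_zero]
    ring
  have q1 := quad V V
  have q2 := quad u V
  have q3 := quad u u
  have e1 : ∑ a, V a * ∑ b, G (boundaryPoint y) ![a, b] * V b = -(Lam / 3) := by
    rw [← h.gradVec_sq hy]
    simp only [hV, h.metric_mul_gradVec hy]
  have e2 : ∑ a, u a * ∑ b, G (boundaryPoint y) ![a, b] * V b = 0 := by
    simp only [hV, h.metric_mul_gradVec hy]
    simp [Fin.sum_univ_succ (n := 3), h.pd_factor_succ hy, hu]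
  have e3 : star v ⬝ᵥ (Matrix.of fun i j => tangential G y ![i, j]).mulVec v =
      ∑ a, u a * ∑ b, G (boundaryPoint y) ![a, b] * u b := by
    simp only [dotProduct, Matrix.mulVec, tangential_apply_two, Matrix.of_apply]
    simp [Fin.sum_univ_succ (n := 3), hu]
  rw [e3, q3]
  rw [e1] at q1
  rw [e2] at q2
  have hu0 : E.mulVec u ≠ 0 := by
    intro h0
    have : u = 0 := Matrix.eq_zero_of_mulVec_eq_zero hE h0
    apply hv
    funext i
    have := congrFun this i.succ
    simpa [hu] using this
  set p := E.mulVec u with hp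
  set r := E.mulVec V with hr
  have hlam := h.lam_pos
  have cs := Finset.sum_mul_sq_le_sq_mul_sq Finset.univ (fun i : Fin 3 => p i.succ)
    (fun i => r i.succ)
  have n1 : 0 ≤ ∑ i : Fin 3, p i.succ ^ 2 := Finset.sum_nonneg fun i _ => sq_nonneg _
  have n2 : 0 ≤ ∑ i : Fin 3, r i.succ ^ 2 := Finset.sum_nonneg fun i _ => sq_nonneg _
  -- If the spatial part of `p` vanished, orthogonality and `r₀ ≠ 0` would force `p₀ = 0`, hence `u
  -- = 0`.
  have n3 : 0 < ∑ i : Fin 3, p i.succ ^ 2 := by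
    refine lt_of_le_of_ne n1 fun h0 => hu0 ?_
    have z := (Finset.sum_eq_zero_iff_of_nonneg fun i _ => sq_nonneg _).1 h0.symm
    have z' : ∀ i : Fin 3, p i.succ = 0 := fun i => by simpa using z i (Finset.mem_univ i)
    have r0 : r 0 ≠ 0 := by
      intro h0
      simp only [h0, ← sq] at q1
      nlinarith
    funext i
    refine Fin.cases ?_ z' i
    simp only [z', zero_mul, Finset.sum_const_zero, add_zero] at q2
    have : p 0 * r 0 = 0 := by linarith
    simpa [r0] using this
  simp only [← sq] at q1 ⊢
  have c1 : p 0 * r 0 = ∑ i : Fin 3, p i.succ * r i.succ := by linarith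
  rw [← c1] at cs
  have c2 : r 0 ^ 2 = ∑ i : Fin 3, r i.succ ^ 2 + Lam / 3 := by linarith
  have c3 : p 0 ^ 2 * (∑ i : Fin 3, r i.succ ^ 2 + Lam / 3) ≤
      (∑ i : Fin 3, p i.succ ^ 2) * ∑ i : Fin 3, r i.succ ^ 2 := by
    rw [← c2, ← mul_pow]; exact cs
  -- If `|p|² ≤ p₀²`, Cauchy-Schwarz would yield `|p|²(|r|² + Λ/3) ≤ |p|²|r|²`, impossible as `|p|²
  -- > 0`.
  by_contra hcon
  have c4 : ∑ i : Fin 3, p i.succ ^ 2 ≤ p 0 ^ 2 := by linarith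
  have c5 := mul_le_mul_of_nonneg_right c4 (show 0 ≤ ∑ i : Fin 3, r i.succ ^ 2 + Lam / 3 by linarith)
  nlinarith [mul_pos n3 hlam]

/-! #### The conormal -/

theorem sq_sqrt_lam : √(3 / Lam) ^ 2 = 3 / Lam :=
  Real.sq_sqrt (div_nonneg (by norm_num) h.lam_pos.le)

/-- Both covectors annihilate the boundary, so only the component `0` matters: normalisation fixes
its size. Since `g⁰⁰ < 0`, raising the index reverses the sign, which is why an inward vector has a
negative conormal component. -/
theorem conormal_eq (hN : IsConormalInChart G N U) (hy : boundaryPoint y ∈ U) (a : Fin 4) :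
    N (boundaryPoint y) ![a] = -√(3 / Lam) * pd halfSpace W a (boundaryPoint y) := by
  have hl := h.lam_pos
  refine Fin.cases ?_ (fun i => ?_) a
  swap
  · rw [hN.normal _ hy, h.pd_factor_succ hy, mul_zero]
  have u := hN.unit _ hy
  have v := hN.inward _ hy
  simp only [normalVec, Fin.sum_univ_succ (n := 3), hN.normal _ hy, mul_zero, Finset.sum_const_zero,
    add_zero] at u v
  have l := h.cosmological_zero hy
  have wpos := h.pd_factor_pos hy
  set w := pd halfSpace W 0 (boundaryPoint y)
  set g := invMetric G (boundaryPoint y) 0 0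
  set m := N (boundaryPoint y) ![0]
  have gneg : g < 0 := by
    by_contra hg
    nlinarith [mul_nonneg (not_lt.1 hg) (sq_nonneg w)]
  have mneg : m < 0 := by
    by_contra hm
    nlinarith [mul_nonneg (neg_nonneg.2 gneg.le) (not_lt.1 hm)]
  have sq : (-m) ^ 2 = (√(3 / Lam) * w) ^ 2 := by
    rw [mul_pow, h.sq_sqrt_lam, l]
    have : w ≠ 0 := wpos.ne'
    have g0 : g ≠ 0 := gneg.ne
    field_simp
    linear_combination u
  have := (sq_eq_sq₀ (by linarith) (by positivity)).1 sq
  linarith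

theorem normalVec_eq (hN : IsConormalInChart G N U) (hy : boundaryPoint y ∈ U) (a : Fin 4) :
    normalVec G N (boundaryPoint y) a = -√(3 / Lam) * gradVec G W (boundaryPoint y) a := by
  simp only [normalVec, gradVec, h.conormal_eq hN hy, Finset.mul_sum]
  exact Finset.sum_congr rfl fun b _ => by ring

theorem normal_derivative (hN : IsConormalInChart G N U) (hy : boundaryPoint y ∈ U) :
    ∑ a, normalVec G N (boundaryPoint y) a * pd halfSpace W a (boundaryPoint y) = √(Lam / 3) := by
  have e := h.gradVec_sq hy
  have hl := h.lam_pos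
  simp only [h.normalVec_eq hN hy, mul_assoc, ← Finset.mul_sum, e]
  have h1 : √(3 / Lam) * √(Lam / 3) = 1 := by
    rw [← Real.sqrt_mul (by positivity), show 3 / Lam * (Lam / 3) = 1 by field_simp, Real.sqrt_one]
  have h2 : √(Lam / 3) * √(Lam / 3) = Lam / 3 := Real.mul_self_sqrt (by positivity)
  linear_combination √(Lam / 3) * h1 - √(3 / Lam) * h2

/-! #### The induced metric -/

theorem induced_metric : IsRegularMetric Set.univ (tangential G) {y | boundaryPoint y ∈ U} where
  domain := isRegularDomain_univ
  subset := Set.subset_univ _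
  nhds y hy := by
    rw [nhdsWithin_univ]
    exact h.boundary_nhds hy
  symm y hy i j := by
    rw [tangential_apply_two, tangential_apply_two]
    exact h.metric.symm _ hy _ _
  det y hy := (h.posDef_tangential hy).det_pos.ne'
  smooth _I y hy := (h.metric.smooth _ _ hy).restrict

end IsBoundaryChart

end Boundary

/-! ### Orthogonal splitting, umbilicity and the Codazzi equation -/

section BoundaryGeometry

namespace IsBoundaryChart

variable {Lam : ℝ} {W : Coord 4 → ℝ} {G : CoordTensor 4 2} {d : CoordTensor 4 4}
  {Q : CoordTensor 4 3} {N : CoordTensor 4 1} {U : Set (Coord 4)} {y : Coord 3}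

variable (h : IsBoundaryChart Lam W G d Q U)
include h

/-- The decomposition `g⁻¹ = h⁻¹ - n⊗n`, with `n⊗n = (3/Λ) V⊗V` and `h⁻¹` extended by zero to the
index `0`. -/
theorem inv_split (hy : boundaryPoint y ∈ U) (a b : Fin 4) : invMetric G (boundaryPoint y) a b =
    (Fin.cons (fun _ => 0) (fun i => Fin.cons 0 (fun j => invMetric (tangential G) y i j)) :
      Fin 4 → Fin 4 → ℝ) a b
    - 3 / Lam * (gradVec G W (boundaryPoint y) a * gradVec G W (boundaryPoint y) b) := by
  have hl := h.lam_pos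
  have wpos := h.pd_factor_pos hy
  have l := h.cosmological_zero hy
  set x := boundaryPoint y
  set w := pd halfSpace W 0 x with hw
  -- Here `V^a = g^{a0} w` and `Λ = -3 g⁰⁰ w²`, so the two terms cancel.
  have col0 : ∀ a, invMetric G x a 0 + 3 / Lam * (gradVec G W x a * gradVec G W x 0) = 0 := by
    intro a
    rw [h.gradVec_eq hy, h.gradVec_eq hy]
    field_simp
    nth_rewrite 1 [l]
    ring
  have row0 : ∀ b, invMetric G x 0 b + 3 / Lam * (gradVec G W x 0 * gradVec G W x b) = 0 := by
    intro b
    rw [h.metric.inv_symm hy, ← col0 b]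
    ring
  -- As the row and column `0` of `g⁻¹ + (3/Λ) V⊗V` vanish and `V` is orthogonal to the boundary,
  -- its spatial block inverts `h`.
  have hinv : invMetric (tangential G) y =
      Matrix.of fun i j : Fin 3 => invMetric G x i.succ j.succ
        + 3 / Lam * (gradVec G W x i.succ * gradVec G W x j.succ) := by
    refine Matrix.inv_eq_right_inv ?_
    ext i k
    have m1 := h.metric.metric_mul_inv hy i.succ k.succ
    have m2 := h.metric_mul_gradVec hy i.succ
    rw [h.pd_factor_succ hy] at m2
    have m3 : ∑ b, G x ![i.succ, b] * (invMetric G x b k.succ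
        + 3 / Lam * (gradVec G W x b * gradVec G W x k.succ)) = if i = k then 1 else 0 := by
      have : ∑ b, G x ![i.succ, b] * (3 / Lam * (gradVec G W x b * gradVec G W x k.succ)) =
          (∑ b, G x ![i.succ, b] * gradVec G W x b) * (3 / Lam * gradVec G W x k.succ) := by
        rw [Finset.sum_mul]
        exact Finset.sum_congr rfl fun b _ => by ring
      simp only [mul_add, Finset.sum_add_distrib]
      rw [m1, this, m2]
      simp
    rw [Fin.sum_univ_succ, row0, mul_zero, zero_add] at m3
    simp only [Matrix.mul_apply, Matrix.of_apply, tangential_apply_two, Matrix.one_apply]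
    exact m3
  refine Fin.cases ?_ (fun i => ?_) a
  · simp only [Fin.cons_zero]
    linarith [row0 b]
  · refine Fin.cases ?_ (fun j => ?_) b
    · simp only [Fin.cons_succ, Fin.cons_zero]
      linarith [col0 i.succ]
    · simp [hinv]

/-- A trace splits into its tangential and its normal part. -/
theorem trace_split (hy : boundaryPoint y ∈ U) (F : Fin 4 → Fin 4 → ℝ) :
    ∑ a, ∑ b, invMetric G (boundaryPoint y) a b * F a b =
      ∑ i, ∑ j, invMetric (tangential G) y i j * F i.succ j.succ
      - 3 / Lam * ∑ a, ∑ b,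
        gradVec G W (boundaryPoint y) a * gradVec G W (boundaryPoint y) b * F a b := by
  have e : ∑ a, ∑ b, (Fin.cons (fun _ => 0) (fun i => Fin.cons 0 (fun j =>
      invMetric (tangential G) y i j)) : Fin 4 → Fin 4 → ℝ) a b * F a b =
      ∑ i, ∑ j, invMetric (tangential G) y i j * F i.succ j.succ := by
    simp [Fin.sum_univ_succ (n := 3)]
  rw [← e]
  simp only [Finset.mul_sum, ← Finset.sum_sub_distrib]
  refine Finset.sum_congr rfl fun a _ => Finset.sum_congr rfl fun b _ => ?_
  rw [h.inv_split hy]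
  ring

theorem christoffelLow_tangential (hy : boundaryPoint y ∈ U) (k i j : Fin 3) :
    christoffelLow Set.univ (tangential G) y k i j =
      christoffelLow halfSpace G (boundaryPoint y) k.succ i.succ j.succ := by
  simp only [christoffelLow]
  have e : ∀ i j k : Fin 3, pd Set.univ (fun z => tangential G z ![i, j]) k y =
      pd halfSpace (fun z => G z ![i.succ, j.succ]) k.succ (boundaryPoint y) := by
    intro i j k
    simp only [tangential_apply_two]
    exact pd_restrict (f := fun z => G z ![i.succ, j.succ]) (h.metric.smooth _ _ hy) k
  simp only [e]

/-- Second tangential derivatives of `Ω` vanish on the boundary, so the tangential Hessian consists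
of the Christoffel term alone, and it equals `s h`. This is umbilicity before normalisation. -/
theorem gradVec_christoffelLow (hy : boundaryPoint y ∈ U) (i j : Fin 3) :
    ∑ a, gradVec G W (boundaryPoint y) a
      * christoffelLow halfSpace G (boundaryPoint y) a i.succ j.succ =
    -(friedrichScalar G W (boundaryPoint y) * G (boundaryPoint y) ![i.succ, j.succ]) := by
  rw [← h.hessian _ hy (boundaryPoint_zero y), hess_eq]
  have e1 : pd halfSpace (pd halfSpace W j.succ) i.succ (boundaryPoint y) = 0 := by
    rw [← pd_restrict (SmoothWithin.pd h.metric.domain (h.metric.subset hy) (h.smooth_factor _ hy) _),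
      h.induced_metric.pd_congr_on (x := y) hy (g := fun _ => 0)
        (fun z hz => h.pd_factor_succ hz j), pd_const]
  rw [e1]
  simp only [christoffel_eq, gradVec, Finset.sum_mul, zero_sub, neg_neg]
  rw [Finset.sum_comm]
  refine Finset.sum_congr rfl fun a _ => Finset.sum_congr rfl fun b _ => ?_
  rw [h.metric.inv_symm hy]
  ring

/-- The tangential Christoffel symbols split into those of the induced metric and the extrinsic
curvature. -/
theorem christoffel_split (hy : boundaryPoint y ∈ U) (i j : Fin 3) (F : Fin 4 → ℝ) :
    ∑ c, christoffel halfSpace G (boundaryPoint y) c i.succ j.succ * F c =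
      ∑ m, christoffel Set.univ (tangential G) y m i j * F m.succ
      + 3 / Lam * friedrichScalar G W (boundaryPoint y) * G (boundaryPoint y) ![i.succ, j.succ]
        * ∑ a, gradVec G W (boundaryPoint y) a * F a := by
  have e := h.trace_split hy (fun a b =>
    christoffelLow halfSpace G (boundaryPoint y) b i.succ j.succ * F a)
  have l1 : ∑ a, ∑ b, invMetric G (boundaryPoint y) a b *
      (christoffelLow halfSpace G (boundaryPoint y) b i.succ j.succ * F a) =
      ∑ c, christoffel halfSpace G (boundaryPoint y) c i.succ j.succ * F c := by
    simp only [christoffel_eq, Finset.sum_mul, mul_assoc]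
  have l2 : ∑ a, ∑ b, invMetric (tangential G) y a b *
      (christoffelLow halfSpace G (boundaryPoint y) b.succ i.succ j.succ * F a.succ) =
      ∑ m, christoffel Set.univ (tangential G) y m i j * F m.succ := by
    simp only [christoffel_eq, Finset.sum_mul, mul_assoc, h.christoffelLow_tangential hy]
  have l3 : ∑ a, ∑ b, gradVec G W (boundaryPoint y) a * gradVec G W (boundaryPoint y) b *
      (christoffelLow halfSpace G (boundaryPoint y) b i.succ j.succ * F a) =
      (∑ b, gradVec G W (boundaryPoint y) b
        * christoffelLow halfSpace G (boundaryPoint y) b i.succ j.succ)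
      * ∑ a, gradVec G W (boundaryPoint y) a * F a := by
    rw [Finset.sum_mul_sum, Finset.sum_comm]
    exact Finset.sum_congr rfl fun a _ => Finset.sum_congr rfl fun b _ => by ring
  rw [l1, l2, l3, h.gradVec_christoffelLow hy] at e
  rw [e]
  ring

theorem umbilic (hN : IsConormalInChart G N U) (hy : boundaryPoint y ∈ U) (i j : Fin 3) :
    extrinsicCurv G N y ![i, j] =
      -√(3 / Lam) * friedrichScalar G W (boundaryPoint y) * tangential G y ![i, j] := by
  have e1 : pd Set.univ (fun z => N (boundaryPoint z) ![j.succ]) i y = 0 := by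
    rw [h.induced_metric.pd_congr_on (x := y) hy (g := fun _ => 0)
        (fun z hz => hN.normal z hz j), pd_const]
  have e2 := h.gradVec_christoffelLow hy i j
  have e3 : ∑ c, christoffel halfSpace G (boundaryPoint y) c i.succ j.succ
      * pd halfSpace W c (boundaryPoint y) = -(friedrichScalar G W (boundaryPoint y)
        * G (boundaryPoint y) ![i.succ, j.succ]) := by
    rw [← e2]
    simp only [christoffel_eq, gradVec, Finset.sum_mul]
    rw [Finset.sum_comm]
    refine Finset.sum_congr rfl fun a _ => Finset.sum_congr rfl fun b _ => ?_
    rw [h.metric.inv_symm hy]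
    ring
  simp only [extrinsicCurv, Matrix.cons_val, h.conormal_eq hN hy, tangential_apply_two]
  have e4 : ∑ c, christoffel halfSpace G (boundaryPoint y) c i.succ j.succ
      * (-√(3 / Lam) * pd halfSpace W c (boundaryPoint y)) =
      -√(3 / Lam) * ∑ c, christoffel halfSpace G (boundaryPoint y) c i.succ j.succ
      * pd halfSpace W c (boundaryPoint y) := by
    rw [Finset.mul_sum]
    exact Finset.sum_congr rfl fun c _ => by ring
  rw [e4, e3, e1]
  ring

/-! #### Smoothness -/

theorem smooth_friedrichScalar {x : Coord 4} (hx : x ∈ U) :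
    SmoothWithin halfSpace (friedrichScalar G W) x := by
  refine ContDiffWithinAt.add ?_ ?_
  · exact ((h.metric.smooth_scalarCurv hx).mul (h.smooth_factor x hx)).div_const _
  · exact (h.metric.smooth_trace hx fun I => h.metric.smooth_hess hx (h.smooth_factor x hx) I).div_const
      _

theorem smooth_gradVec {x : Coord 4} (hx : x ∈ U) (a : Fin 4) :
    SmoothWithin halfSpace (fun z => gradVec G W z a) x :=
  ContDiffWithinAt.sum fun b _ => (h.metric.smooth_inv hx a b).mul
    (SmoothWithin.pd h.metric.domain (h.metric.subset hx) (h.smooth_factor x hx) b)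

/-! #### The Codazzi equation -/

theorem pd_friedrichScalar (hy : boundaryPoint y ∈ U) (i : Fin 3) :
    pd Set.univ (fun z => friedrichScalar G W (boundaryPoint z)) i y =
      pd halfSpace (friedrichScalar G W) i.succ (boundaryPoint y) :=
  pd_restrict (h.smooth_friedrichScalar hy) i

/-- The Ricci identity for `∇Ω`, with `s g` inserted for the Hessian. The derivative indices must be
tangential because that substitution is valid only along the boundary; the index `a` is free. -/
theorem riemann_gradVec (hy : boundaryPoint y ∈ U) (i j : Fin 3) (a : Fin 4) :
    ∑ e, riemann halfSpace G (boundaryPoint y) ![i.succ, j.succ, a, e]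
      * gradVec G W (boundaryPoint y) e =
    pd halfSpace (friedrichScalar G W) i.succ (boundaryPoint y) * G (boundaryPoint y) ![j.succ, a]
    - pd halfSpace (friedrichScalar G W) j.succ (boundaryPoint y)
      * G (boundaryPoint y) ![i.succ, a] := by
  have hxD := h.metric.subset hy
  have e1 : ∑ e, riemann halfSpace G (boundaryPoint y) ![i.succ, j.succ, a, e]
      * gradVec G W (boundaryPoint y) e =
      ∑ f, riemannMixed halfSpace G (boundaryPoint y) i.succ j.succ a f
        * pd halfSpace W f (boundaryPoint y) := by
    simp only [riemann, Matrix.cons_val, Finset.sum_mul, ← h.metric_mul_gradVec hy, Finset.mul_sum]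
    rw [Finset.sum_comm]
    exact Finset.sum_congr rfl fun a _ => Finset.sum_congr rfl fun b _ => by ring
  rw [e1, ← h.metric.ricci_identity_grad hy (h.smooth_factor _ hy)]
  have sm := h.smooth_friedrichScalar hy
  have e2 : ∀ i j : Fin 3, pd halfSpace (fun z => hess halfSpace G W z ![j.succ, a]) i.succ
      (boundaryPoint y) =
      pd halfSpace (friedrichScalar G W) i.succ (boundaryPoint y) * G (boundaryPoint y) ![j.succ, a]
      + friedrichScalar G W (boundaryPoint y)
        * pd halfSpace (fun z => G z ![j.succ, a]) i.succ (boundaryPoint y) := by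
    intro i j
    rw [← pd_mul h.metric.domain hxD sm (h.metric.smooth _ _ hy),
      ← pd_restrict (h.metric.smooth_hess hy (h.smooth_factor _ hy) _),
      ← pd_restrict (sm.mul (h.metric.smooth _ _ hy))]
    exact h.induced_metric.pd_congr_on (x := y) hy
      (fun z hz => h.hessian _ hz (boundaryPoint_zero z) _ _) i
  have e3 : ∀ i j : Fin 3, ∑ m, christoffel halfSpace G (boundaryPoint y) m i.succ a
      * hess halfSpace G W (boundaryPoint y) ![j.succ, m] =
      friedrichScalar G W (boundaryPoint y)
        * christoffelLow halfSpace G (boundaryPoint y) j.succ i.succ a := by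
    intro i j
    rw [← h.metric.lower_christoffel hy, Finset.mul_sum]
    refine Finset.sum_congr rfl fun m _ => ?_
    rw [h.hessian _ hy (boundaryPoint_zero y), h.metric.symm _ hy]
    ring
  rw [e2, e2, e3, e3, h.metric.pd_metric hy, h.metric.pd_metric hy,
    h.metric.christoffelLow_symm hy a i.succ]
  ring

/-- Trace of the Codazzi equation. The normal part vanishes by antisymmetry of Riemann in its last
pair, and the tangential trace gives `∂_i s - 3 ∂_i s`, where `3` is the dimension of the boundary.
-/
theorem ricci_gradVec (hy : boundaryPoint y ∈ U) (i : Fin 3) :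
    ∑ b, ricci halfSpace G (boundaryPoint y) ![i.succ, b] * gradVec G W (boundaryPoint y) b =
      -2 * pd halfSpace (friedrichScalar G W) i.succ (boundaryPoint y) := by
  set x := boundaryPoint y
  have e1 : ∑ b, ricci halfSpace G x ![i.succ, b] * gradVec G W x b =
      ∑ a, ∑ c, invMetric G x a c *
        ∑ b, riemann halfSpace G x ![a, i.succ, c, b] * gradVec G W x b := by
    simp only [ricci, Matrix.cons_val, Finset.sum_mul, Finset.mul_sum]
    rw [Finset.sum_comm]
    refine Finset.sum_congr rfl fun a _ => ?_
    rw [Finset.sum_comm]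
    exact Finset.sum_congr rfl fun a _ => Finset.sum_congr rfl fun b _ => by ring
  have e2 : ∑ a, ∑ c, gradVec G W x a * gradVec G W x c *
        ∑ b, riemann halfSpace G x ![a, i.succ, c, b] * gradVec G W x b = 0 := by
    refine Finset.sum_eq_zero fun a _ => ?_
    rw [← mul_zero (gradVec G W x a), ← sum_mul_antisymm (gradVec G W x)
      (fun c b => riemann halfSpace G x ![a, i.succ, c, b])
      (fun c b => h.metric.riemann_swap_right hy _ _ _ _)]
    simp only [Finset.mul_sum]
    exact Finset.sum_congr rfl fun a _ => Finset.sum_congr rfl fun b _ => by ring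
  rw [e1, h.trace_split hy, e2]
  simp only [x, h.riemann_gradVec hy]
  have f1 := h.induced_metric.sum_inv_mul_metric_mul hy
    (fun k => pd halfSpace (friedrichScalar G W) k.succ (boundaryPoint y)) i
  have f2 := h.induced_metric.trace_metric hy
  simp only [tangential_apply_two] at f1 f2
  have f3 : ∑ k, ∑ l, invMetric (tangential G) y k l *
      (pd halfSpace (friedrichScalar G W) i.succ (boundaryPoint y)
        * G (boundaryPoint y) ![k.succ, l.succ]) =
      3 * pd halfSpace (friedrichScalar G W) i.succ (boundaryPoint y) := by
    rw [show (3 : ℝ) = ((3 : ℕ) : ℝ) by norm_num, ← f2]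
    simp only [Finset.sum_mul]
    refine Finset.sum_congr rfl fun k _ => Finset.sum_congr rfl fun l _ => ?_
    rw [h.metric.symm _ hy k.succ]
    ring
  have f4 : ∑ k, ∑ l, invMetric (tangential G) y k l *
      (pd halfSpace (friedrichScalar G W) k.succ (boundaryPoint y)
        * G (boundaryPoint y) ![i.succ, l.succ]) =
      pd halfSpace (friedrichScalar G W) i.succ (boundaryPoint y) := by
    rw [← f1]
    refine Finset.sum_congr rfl fun k _ => Finset.sum_congr rfl fun l _ => ?_
    rw [h.metric.symm _ hy i.succ]
    ring
  simp only [mul_sub, Finset.sum_sub_distrib, f3, f4]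
  ring

/-- The scalar curvature term of `P` does not contribute, because `g(∂_i, V) = ∂_iΩ = 0`. -/
theorem schouten_gradVec (hy : boundaryPoint y ∈ U) (i : Fin 3) :
    ∑ b, schouten halfSpace G (boundaryPoint y) ![i.succ, b] * gradVec G W (boundaryPoint y) b =
      -pd halfSpace (friedrichScalar G W) i.succ (boundaryPoint y) := by
  have e := h.ricci_gradVec hy i
  have e0 := h.metric_mul_gradVec hy i.succ
  rw [h.pd_factor_succ hy] at e0
  have e1 : ∑ b, schouten halfSpace G (boundaryPoint y) ![i.succ, b]
      * gradVec G W (boundaryPoint y) b =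
      1 / 2 * ∑ b, ricci halfSpace G (boundaryPoint y) ![i.succ, b] * gradVec G W (boundaryPoint y) b
      - scalarCurv halfSpace G (boundaryPoint y) / 12
        * ∑ b, G (boundaryPoint y) ![i.succ, b] * gradVec G W (boundaryPoint y) b := by
    simp only [schouten, Finset.mul_sum, ← Finset.sum_sub_distrib]
    refine Finset.sum_congr rfl fun b _ => ?_
    norm_num
    ring
  rw [e1, e, e0]
  ring

theorem schouten_normal (hN : IsConormalInChart G N U) (hy : boundaryPoint y ∈ U) (i : Fin 3) :
    ∑ a, schouten halfSpace G (boundaryPoint y) ![i.succ, a] * normalVec G N (boundaryPoint y) a =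
      √(3 / Lam) * pd Set.univ (fun z => friedrichScalar G W (boundaryPoint z)) i y := by
  have e := h.schouten_gradVec hy i
  simp only [h.normalVec_eq hN hy, h.pd_friedrichScalar hy, mul_left_comm _ (-√(3 / Lam)),
    ← Finset.mul_sum, e]
  ring

end IsBoundaryChart

end BoundaryGeometry

/-! ### The rescaled Weyl tensor, the Gauss equation and the magnetic part -/

section RescaledWeyl

namespace IsBoundaryChart

variable {Lam : ℝ} {W : Coord 4 → ℝ} {G : CoordTensor 4 2} {d : CoordTensor 4 4}
  {Q : CoordTensor 4 3} {N : CoordTensor 4 1} {U : Set (Coord 4)} {y : Coord 3} {x : Coord 4}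

variable (h : IsBoundaryChart Lam W G d Q U)
include h

/-- Equalities that hold off the boundary extend to the boundary. -/
theorem eq_of_eq_interior (hx : x ∈ U) {f g : Coord 4 → ℝ} (hf : SmoothWithin halfSpace f x)
    (hg : SmoothWithin halfSpace g x) (hfg : ∀ z ∈ U, 0 < z 0 → f z = g z) : f x = g x := by
  have hint : interior halfSpace = {z : Coord 4 | 0 < z 0} :=
    interior_range_modelWithCornersEuclideanHalfSpace 4
  have hcl : x ∈ closure (interior halfSpace) :=
    h.metric.domain.subset_closure_interior (h.metric.subset hx)
  have : (𝓝[interior halfSpace] x).NeBot := mem_closure_iff_nhdsWithin_neBot.1 hcl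
  have hle : 𝓝[interior halfSpace] x ≤ 𝓝[halfSpace] x := nhdsWithin_mono _ interior_subset
  refine tendsto_nhds_unique_of_eventuallyEq
    (ContDiffWithinAt.continuousWithinAt hf |>.mono_left hle)
    (ContDiffWithinAt.continuousWithinAt hg |>.mono_left hle) ?_
  filter_upwards [hle (h.metric.nhds x hx), self_mem_nhdsWithin] with z hz hz'
  rw [hint] at hz'
  exact hfg z hz hz'

/-- In the interior the Weyl tensor equals `Ω d`; both sides are continuous up to the boundary,
where `Ω = 0`. -/
theorem weyl_boundary (hx : x ∈ U) (hx0 : x 0 = 0) (I : Fin 4 → Fin 4) :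
    weyl halfSpace G x I = 0 := by
  have e := h.eq_of_eq_interior hx (h.metric.smooth_weyl hx I)
    ((h.smooth_factor x hx).mul (h.smooth_weyl I x hx)) fun z hz hz0 => by
      rw [h.rescaled_weyl I z hz hz0, mul_inv_cancel_left₀ (h.factor_pos z hz hz0).ne']
  rw [e, h.factor_zero x hx hx0, zero_mul]

/-- On the boundary `d` is known only as a limit, so it inherits the algebraic symmetries of the
Weyl tensor by continuity; likewise below. -/
theorem rescaled_swap_left (hx : x ∈ U) (a b c e : Fin 4) :
    d x ![a, b, c, e] = -d x ![b, a, c, e] :=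
  h.eq_of_eq_interior hx (h.smooth_weyl _ x hx) (h.smooth_weyl _ x hx).neg fun z hz hz0 => by
    rw [h.rescaled_weyl _ z hz hz0, h.rescaled_weyl _ z hz hz0, weyl_swap_left]
    ring

theorem rescaled_swap_right (hx : x ∈ U) (a b c e : Fin 4) :
    d x ![a, b, c, e] = -d x ![a, b, e, c] :=
  h.eq_of_eq_interior hx (h.smooth_weyl _ x hx) (h.smooth_weyl _ x hx).neg fun z hz hz0 => by
    rw [h.rescaled_weyl _ z hz hz0, h.rescaled_weyl _ z hz hz0, h.metric.weyl_swap_right hz]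
    ring

theorem rescaled_pair (hx : x ∈ U) (a b c e : Fin 4) :
    d x ![a, b, c, e] = d x ![c, e, a, b] :=
  h.eq_of_eq_interior hx (h.smooth_weyl _ x hx) (h.smooth_weyl _ x hx) fun z hz hz0 => by
    rw [h.rescaled_weyl _ z hz hz0, h.rescaled_weyl _ z hz hz0, h.metric.weyl_pair hz]

theorem rescaled_trace (hx : x ∈ U) (b e : Fin 4) :
    ∑ a, ∑ c, invMetric G x a c * d x ![a, b, c, e] = 0 := by
  refine h.eq_of_eq_interior (f := fun z => ∑ a, ∑ c, invMetric G z a c * d z ![a, b, c, e])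
    (g := fun _ => 0) hx ?_ contDiffWithinAt_const fun z hz hz0 => ?_
  · exact ContDiffWithinAt.sum fun a _ => ContDiffWithinAt.sum fun c _ =>
      (h.metric.smooth_inv hx a c).mul (h.smooth_weyl _ x hx)
  · simp only [h.rescaled_weyl _ z hz hz0, mul_left_comm _ (W z)⁻¹, ← Finset.mul_sum]
    rw [h.metric.trace_weyl hz (by norm_num), mul_zero]

/-- The tangential trace of the magnetic part vanishes. -/
theorem rescaled_trace_tangential (hy : boundaryPoint y ∈ U) (i : Fin 3) :
    ∑ j, ∑ k, invMetric (tangential G) y j k *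
      ∑ b, d (boundaryPoint y) ![j.succ, i.succ, k.succ, b] * gradVec G W (boundaryPoint y) b
      = 0 := by
  set V := gradVec G W (boundaryPoint y) with hV
  have e := h.trace_split hy (fun a c => ∑ b, d (boundaryPoint y) ![a, i.succ, c, b] * V b)
  have e1 : ∑ a, ∑ c, invMetric G (boundaryPoint y) a c *
      ∑ b, d (boundaryPoint y) ![a, i.succ, c, b] * V b = 0 := by
    have : ∑ b, (∑ a, ∑ c, invMetric G (boundaryPoint y) a c * d (boundaryPoint y) ![a, i.succ, c, b])
        * V b = 0 := by
      simp only [h.rescaled_trace hy, zero_mul, Finset.sum_const_zero]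
    rw [← this]
    simp only [Finset.mul_sum, Finset.sum_mul]
    conv_rhs => rw [Finset.sum_comm]
    refine Finset.sum_congr rfl fun a _ => ?_
    conv_rhs => rw [Finset.sum_comm]
    exact Finset.sum_congr rfl fun c _ => Finset.sum_congr rfl fun b _ => by ring
  -- The doubly normal part contains `d_aicb V^c V^b`, antisymmetric in `c, b`.
  have e2 : ∑ a, ∑ c, V a * V c * ∑ b, d (boundaryPoint y) ![a, i.succ, c, b] * V b = 0 := by
    refine Finset.sum_eq_zero fun a _ => ?_
    rw [← mul_zero (V a), ← sum_mul_antisymm V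
      (fun c b => d (boundaryPoint y) ![a, i.succ, c, b])
      (fun c b => h.rescaled_swap_right hy _ _ _ _)]
    simp only [Finset.mul_sum]
    exact Finset.sum_congr rfl fun a _ => Finset.sum_congr rfl fun b _ => by ring
  rw [e1, e2, mul_zero, sub_zero] at e
  exact e.symm

/-! #### The Gauss equation -/

/-- Tangential first-kind symbols are intrinsic, so the derivative terms agree. In the quadratic
terms `christoffel_split` contributes `(3/Λ) s h_ij` times `V^a Γ_akl = -s h_kl`, which is the
extrinsic curvature term. -/
theorem gauss (hy : boundaryPoint y ∈ U) (i j k l : Fin 3) :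
    riemann halfSpace G (boundaryPoint y) ![i.succ, j.succ, k.succ, l.succ] =
      riemann Set.univ (tangential G) y ![i, j, k, l]
      + 3 / Lam * friedrichScalar G W (boundaryPoint y) ^ 2 *
        (tangential G y ![i, k] * tangential G y ![j, l]
          - tangential G y ![j, k] * tangential G y ![i, l]) := by
  rw [h.metric.riemann_eq hy, h.induced_metric.riemann_eq (x := y) hy]
  have e1 : ∀ i j k l : Fin 3,
      pd Set.univ (fun z => christoffelLow Set.univ (tangential G) z l i k) j y =
      pd halfSpace (fun z => christoffelLow halfSpace G z l.succ i.succ k.succ) j.succ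
        (boundaryPoint y) := by
    intro i j k l
    rw [← pd_restrict (h.metric.smooth_christoffelLow hy _ _ _)]
    exact h.induced_metric.pd_congr_on (x := y) hy
      (fun z hz => h.christoffelLow_tangential hz _ _ _) j
  rw [e1, e1]
  simp only [Finset.sum_sub_distrib, h.christoffel_split hy, h.gradVec_christoffelLow hy,
    h.christoffelLow_tangential hy, tangential_apply_two]
  ring

theorem riemann_tangential (hy : boundaryPoint y ∈ U) (i j k l : Fin 3) :
    riemann halfSpace G (boundaryPoint y) ![i.succ, j.succ, k.succ, l.succ] =
      tangential G y ![k, i] * tangential (schouten halfSpace G) y ![j, l]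
      - tangential G y ![k, j] * tangential (schouten halfSpace G) y ![i, l]
      + tangential G y ![l, j] * tangential (schouten halfSpace G) y ![i, k]
      - tangential G y ![l, i] * tangential (schouten halfSpace G) y ![j, k] := by
  have e := h.weyl_boundary hy (boundaryPoint_zero y) ![i.succ, j.succ, k.succ, l.succ]
  simp only [weyl, Matrix.cons_val] at e
  simp only [tangential_apply_two]
  linarith

/-- The quadratic term of the Gauss equation is half the Kulkarni-Nomizu product of `h` with itself,
times `(3/Λ)s²`; absorbing it shifts the factor by `(3/2Λ)s²h`. -/
theorem riemann_induced (hy : boundaryPoint y ∈ U) (s : ℝ)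
    (hs : s = friedrichScalar G W (boundaryPoint y)) (i j k l : Fin 3) :
    riemann Set.univ (tangential G) y ![i, j, k, l] =
      tangential G y ![k, i] * (tangential (schouten halfSpace G) y ![j, l]
        - 3 / (2 * Lam) * s ^ 2 * tangential G y ![j, l])
      - tangential G y ![k, j] * (tangential (schouten halfSpace G) y ![i, l]
        - 3 / (2 * Lam) * s ^ 2 * tangential G y ![i, l])
      + tangential G y ![l, j] * (tangential (schouten halfSpace G) y ![i, k]
        - 3 / (2 * Lam) * s ^ 2 * tangential G y ![i, k])
      - tangential G y ![l, i] * (tangential (schouten halfSpace G) y ![j, k]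
        - 3 / (2 * Lam) * s ^ 2 * tangential G y ![j, k]) := by
  have hl := h.lam_pos.ne'
  have e := h.riemann_tangential hy i j k l
  rw [h.gauss hy, ← hs] at e
  have sy := h.induced_metric.symm y hy
  rw [sy i k, sy j l, sy j k, sy i l] at *
  rw [eq_sub_of_add_eq e]
  field_simp
  ring

theorem schouten_tangential (hy : boundaryPoint y ∈ U) (i j : Fin 3) :
    tangential (schouten halfSpace G) y ![i, j] = schouten Set.univ (tangential G) y ![i, j]
      + 3 / (2 * Lam) * friedrichScalar G W (boundaryPoint y) ^ 2 * tangential G y ![i, j] := by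
  rw [h.induced_metric.schouten_eq_of_riemann_eq (x := y) hy le_rfl
    (fun z I => tangential (schouten halfSpace G) z I
      - 3 / (2 * Lam) * friedrichScalar G W (boundaryPoint y) ^ 2 * tangential G z I)
    (h.riemann_induced hy _ rfl)]
  ring

theorem riemann_induced_eq_schouten (hy : boundaryPoint y ∈ U) (i j k l : Fin 3) :
    riemann Set.univ (tangential G) y ![i, j, k, l] =
      tangential G y ![k, i] * schouten Set.univ (tangential G) y ![j, l]
      - tangential G y ![k, j] * schouten Set.univ (tangential G) y ![i, l]
      + tangential G y ![l, j] * schouten Set.univ (tangential G) y ![i, k]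
      - tangential G y ![l, i] * schouten Set.univ (tangential G) y ![j, k] := by
  rw [h.riemann_induced hy _ rfl]
  simp only [h.schouten_tangential hy]
  ring

/-! #### The magnetic part -/

/-- The first correction is the derivative of `(3/2Λ)s²h`; the other two come from the extrinsic
curvature paired with `P(V, ·) = -∂s`. The coefficients match, so the sum is totally symmetric in
`i, j, k`. -/
theorem covDeriv_schouten (hy : boundaryPoint y ∈ U) (i j k : Fin 3) :
    covDeriv halfSpace G (schouten halfSpace G) (boundaryPoint y) i.succ ![j.succ, k.succ] =
      covDeriv Set.univ (tangential G) (schouten Set.univ (tangential G)) y i ![j, k]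
      + 3 / Lam * friedrichScalar G W (boundaryPoint y) * (
        pd halfSpace (friedrichScalar G W) i.succ (boundaryPoint y) * tangential G y ![j, k]
        + tangential G y ![i, j] * pd halfSpace (friedrichScalar G W) k.succ (boundaryPoint y)
        + tangential G y ![i, k]
          * pd halfSpace (friedrichScalar G W) j.succ (boundaryPoint y)) := by
  have hI := h.induced_metric
  have hl := h.lam_pos.ne'
  have ss : SmoothWithin Set.univ (fun z => friedrichScalar G W (boundaryPoint z)) y :=
    (h.smooth_friedrichScalar hy).restrict
  have ss2 : SmoothWithin Set.univ (fun z => friedrichScalar G W (boundaryPoint z) ^ 2) y :=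
    ss.pow 2
  have sg : SmoothWithin Set.univ (fun z => tangential G z ![j, k]) y := hI.smooth _ _ hy
  have e0 : pd Set.univ (fun z => friedrichScalar G W (boundaryPoint z) ^ 2) i y =
      2 * friedrichScalar G W (boundaryPoint y)
        * pd halfSpace (friedrichScalar G W) i.succ (boundaryPoint y) := by
    simp only [sq]
    rw [pd_mul hI.domain (Set.mem_univ y) ss ss, h.pd_friedrichScalar hy]
    ring
  have e1 : pd halfSpace (fun z => schouten halfSpace G z ![j.succ, k.succ]) i.succ
      (boundaryPoint y) =
      pd Set.univ (fun z => schouten Set.univ (tangential G) z ![j, k]) i y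
      + 3 / (2 * Lam) * (2 * friedrichScalar G W (boundaryPoint y)
        * pd halfSpace (friedrichScalar G W) i.succ (boundaryPoint y) * tangential G y ![j, k]
        + friedrichScalar G W (boundaryPoint y) ^ 2
          * pd Set.univ (fun z => tangential G z ![j, k]) i y) := by
    rw [← pd_restrict (h.metric.smooth_schouten hy _), ← e0,
      ← pd_mul hI.domain (Set.mem_univ y) ss2 sg,
      ← pd_const_mul hI.domain (Set.mem_univ y) _ (ss2.mul sg),
      ← pd_add hI.domain (Set.mem_univ y) (hI.smooth_schouten (x := y) hy _)
        (contDiffWithinAt_const.mul (ss2.mul sg))]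
    refine hI.pd_congr_on (x := y) hy (fun z hz => ?_) i
    rw [← tangential_apply_two (G := schouten halfSpace G), h.schouten_tangential hz]
    ring
  have e2 : ∀ j k, ∑ m, christoffel Set.univ (tangential G) y m i j
      * schouten halfSpace G (boundaryPoint y) ![m.succ, k.succ] =
      ∑ m, christoffel Set.univ (tangential G) y m i j * schouten Set.univ (tangential G) y ![m, k]
      + 3 / (2 * Lam) * friedrichScalar G W (boundaryPoint y) ^ 2
        * christoffelLow Set.univ (tangential G) y k i j := by
    intro j k
    rw [← hI.lower_christoffel (x := y) hy, Finset.mul_sum, ← Finset.sum_add_distrib]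
    refine Finset.sum_congr rfl fun m _ => ?_
    rw [← tangential_apply_two (G := schouten halfSpace G), h.schouten_tangential hy]
    ring
  have c1 := h.christoffel_split hy i j
    (fun c => schouten halfSpace G (boundaryPoint y) ![c, k.succ])
  have c2 := h.christoffel_split hy i k
    (fun c => schouten halfSpace G (boundaryPoint y) ![j.succ, c])
  have f : ∀ k, ∑ a, gradVec G W (boundaryPoint y) a
      * schouten halfSpace G (boundaryPoint y) ![Fin.succ k, a] =
      -pd halfSpace (friedrichScalar G W) k.succ (boundaryPoint y) := by
    intro k
    rw [← h.schouten_gradVec hy]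
    exact Finset.sum_congr rfl fun a _ => mul_comm _ _
  have f' : ∑ a, gradVec G W (boundaryPoint y) a
      * schouten halfSpace G (boundaryPoint y) ![a, k.succ] =
      -pd halfSpace (friedrichScalar G W) k.succ (boundaryPoint y) := by
    rw [← f]
    exact Finset.sum_congr rfl fun a _ => by rw [h.metric.schouten_symm hy]
  have g2 : ∑ m, christoffel Set.univ (tangential G) y m i k
      * schouten halfSpace G (boundaryPoint y) ![j.succ, m.succ] =
      ∑ m, christoffel Set.univ (tangential G) y m i k
        * schouten halfSpace G (boundaryPoint y) ![m.succ, j.succ] :=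
    Finset.sum_congr rfl fun m _ => by rw [h.metric.schouten_symm hy]
  have g3 : ∑ m, christoffel Set.univ (tangential G) y m i k
      * schouten Set.univ (tangential G) y ![m, j] =
      ∑ m, christoffel Set.univ (tangential G) y m i k
        * schouten Set.univ (tangential G) y ![j, m] :=
    Finset.sum_congr rfl fun m _ => by rw [hI.schouten_symm (x := y) hy]
  rw [covDeriv_two, covDeriv_two, e1, c1, c2, f, f', g2, e2, e2, g3, hI.pd_metric (x := y) hy,
    hI.christoffelLow_symm (x := y) hy j i k, tangential_apply_two, tangential_apply_two,
    tangential_apply_two]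
  field_simp
  ring

/-- The correction in `covDeriv_schouten` is totally symmetric and drops out under
antisymmetrisation. -/
theorem cotton_tangential (hy : boundaryPoint y ∈ U) (k i j : Fin 3) :
    cotton halfSpace G (boundaryPoint y) ![k.succ, i.succ, j.succ] =
      cotton Set.univ (tangential G) y ![k, i, j] := by
  simp only [cotton, Matrix.cons_val]
  rw [h.covDeriv_schouten hy, h.covDeriv_schouten hy, h.induced_metric.symm y hy j i]
  ring

theorem cotton_eq_rescaled (hy : boundaryPoint y ∈ U) (k i j : Fin 3) :
    cotton Set.univ (tangential G) y ![k, i, j] =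
      -∑ a, d (boundaryPoint y) ![i.succ, j.succ, k.succ, a]
        * gradVec G W (boundaryPoint y) a := by
  rw [← h.cotton_tangential hy, h.schouten_curl _ hy (boundaryPoint_zero y)]
  simp only [gradVec, Finset.mul_sum, ← Finset.sum_neg_distrib]
  rw [Finset.sum_comm]
  refine Finset.sum_congr rfl fun f _ => Finset.sum_congr rfl fun e _ => ?_
  rw [h.rescaled_pair hy f, h.rescaled_swap_right hy _ _ f, h.metric.inv_symm hy]
  ring

theorem magneticPart_eq (hN : IsConormalInChart G N U) (hy : boundaryPoint y ∈ U)
    (i j k : Fin 3) : magneticPart G N d y ![i, j, k] =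
      -√(3 / Lam) * ∑ a, d (boundaryPoint y) ![i.succ, j.succ, k.succ, a]
        * gradVec G W (boundaryPoint y) a := by
  simp only [magneticPart, Matrix.cons_val, h.normalVec_eq hN hy, Finset.mul_sum]
  exact Finset.sum_congr rfl fun a _ => by ring

theorem magnetic (hN : IsConormalInChart G N U) (hy : boundaryPoint y ∈ U) (i j k : Fin 3) :
    magneticPart G N d y ![i, j, k] =
      √(3 / Lam) * cotton Set.univ (tangential G) y ![k, i, j] := by
  rw [h.magneticPart_eq hN hy, h.cotton_eq_rescaled hy]
  ring

end IsBoundaryChart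

end RescaledWeyl

/-! ### The divergence equation: electric part and normal part of `Q` -/

section Divergence

namespace IsBoundaryChart

variable {Lam : ℝ} {W : Coord 4 → ℝ} {G : CoordTensor 4 2} {d : CoordTensor 4 4}
  {Q : CoordTensor 4 3} {N : CoordTensor 4 1} {U : Set (Coord 4)} {y : Coord 3} {x : Coord 4}

variable (h : IsBoundaryChart Lam W G d Q U)
include h

/-- The Hessian equation with an index raised: `∇_k V^a = s δ_k^a`. Each contraction with `V`
therefore costs one extra term with factor `s` when differentiated. -/
theorem pd_gradVec (hy : boundaryPoint y ∈ U) (k : Fin 3) (a : Fin 4) :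
    pd halfSpace (fun z => gradVec G W z a) k.succ (boundaryPoint y) =
      (if a = k.succ then friedrichScalar G W (boundaryPoint y) else 0)
      - ∑ m, christoffel halfSpace G (boundaryPoint y) a k.succ m
        * gradVec G W (boundaryPoint y) m := by
  have e := h.metric.pd_raise hy (w := fun b => pd halfSpace W b)
    (fun b => SmoothWithin.pd h.metric.domain (h.metric.subset hy) (h.smooth_factor _ hy) b) k.succ a
  simp only [gradVec]
  rw [e]
  congr 1
  simp only [← hess_eq, h.hessian _ hy (boundaryPoint_zero y), mul_left_comm _ (friedrichScalar _ _ _),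
    ← Finset.mul_sum, h.metric.symm _ hy k.succ, h.metric.inv_mul_metric hy]
  simp

/-- The Leibniz rule for a contraction with the gradient vector. -/
theorem pd_contract_gradVec (hy : boundaryPoint y ∈ U) {T : Fin 4 → Coord 4 → ℝ}
    (hT : ∀ p, SmoothWithin halfSpace (T p) (boundaryPoint y)) (k : Fin 3) :
    pd halfSpace (fun z => ∑ p, T p z * gradVec G W z p) k.succ (boundaryPoint y) =
      ∑ p, (pd halfSpace (T p) k.succ (boundaryPoint y)
        - ∑ m, christoffel halfSpace G (boundaryPoint y) m k.succ p * T m (boundaryPoint y))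
          * gradVec G W (boundaryPoint y) p
      + friedrichScalar G W (boundaryPoint y) * T k.succ (boundaryPoint y) := by
  have hxD := h.metric.subset hy
  rw [pd_sum h.metric.domain hxD fun p _ => (hT p).mul (h.smooth_gradVec hy p)]
  simp only [pd_mul h.metric.domain hxD (hT _) (h.smooth_gradVec hy _), h.pd_gradVec hy, mul_sub,
    sub_mul, Finset.sum_add_distrib, Finset.sum_sub_distrib, Finset.mul_sum, Finset.sum_mul]
  have e : ∑ p, ∑ m, T p (boundaryPoint y) * (christoffel halfSpace G (boundaryPoint y) p k.succ m
      * gradVec G W (boundaryPoint y) m) =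
      ∑ p, ∑ m, christoffel halfSpace G (boundaryPoint y) m k.succ p * T m (boundaryPoint y)
        * gradVec G W (boundaryPoint y) p := by
    rw [Finset.sum_comm]
    exact Finset.sum_congr rfl fun a _ => Finset.sum_congr rfl fun b _ => by ring
  rw [e]
  simp
  ring

theorem covDeriv_swap_left (hx : x ∈ U) (k a b c e : Fin 4) :
    covDeriv halfSpace G d x k ![a, b, c, e] = -covDeriv halfSpace G d x k ![b, a, c, e] := by
  have p : pd halfSpace (fun z => d z ![a, b, c, e]) k x =
      -pd halfSpace (fun z => d z ![b, a, c, e]) k x := by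
    rw [← neg_one_mul, ← pd_const_mul h.metric.domain (h.metric.subset hx) _ (h.smooth_weyl _ x hx)]
    exact h.metric.pd_congr_on hx (fun z hz => by rw [h.rescaled_swap_left hz]; ring) k
  rw [covDeriv_four, covDeriv_four, p]
  simp only [h.rescaled_swap_left hx _ b, h.rescaled_swap_left hx a, mul_neg, Finset.sum_neg_distrib]
  ring

theorem covDeriv_swap_right (hx : x ∈ U) (k a b c e : Fin 4) :
    covDeriv halfSpace G d x k ![a, b, c, e] = -covDeriv halfSpace G d x k ![a, b, e, c] := by
  have p : pd halfSpace (fun z => d z ![a, b, c, e]) k x =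
      -pd halfSpace (fun z => d z ![a, b, e, c]) k x := by
    rw [← neg_one_mul, ← pd_const_mul h.metric.domain (h.metric.subset hx) _ (h.smooth_weyl _ x hx)]
    exact h.metric.pd_congr_on hx (fun z hz => by rw [h.rescaled_swap_right hz]; ring) k
  rw [covDeriv_four, covDeriv_four, p]
  simp only [h.rescaled_swap_right hx _ _ _ e, h.rescaled_swap_right hx _ _ c, mul_neg,
    Finset.sum_neg_distrib]
  ring

theorem covDeriv_pair (hx : x ∈ U) (k a b c e : Fin 4) :
    covDeriv halfSpace G d x k ![a, b, c, e] = covDeriv halfSpace G d x k ![c, e, a, b] := by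
  have p : pd halfSpace (fun z => d z ![a, b, c, e]) k x =
      pd halfSpace (fun z => d z ![c, e, a, b]) k x :=
    h.metric.pd_congr_on hx (fun z hz => h.rescaled_pair hz _ _ _ _) k
  rw [covDeriv_four, covDeriv_four, p]
  simp only [h.rescaled_pair hx c, h.rescaled_pair hx _ e]
  ring

/-- The divergence equation contracted once with the gradient. -/
theorem divergence_gradVec (hy : boundaryPoint y ∈ U) (b c : Fin 4) :
    ∑ a, Q (boundaryPoint y) ![a, b, c] * gradVec G W (boundaryPoint y) a =
      ∑ k, ∑ l, invMetric (tangential G) y k l *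
        ∑ a, covDeriv halfSpace G d (boundaryPoint y) k.succ ![l.succ, a, b, c]
          * gradVec G W (boundaryPoint y) a := by
  set V := gradVec G W (boundaryPoint y)
  have e := h.trace_split hy (fun e f =>
    ∑ a, covDeriv halfSpace G d (boundaryPoint y) e ![f, a, b, c] * V a)
  -- `∇d` retains the antisymmetry of `d` in its first pair, and both `f` and `a` are contracted
  -- with `V`. Hence no normal derivative of `d` survives.
  have e2 : ∑ e, ∑ f, V e * V f *
      ∑ a, covDeriv halfSpace G d (boundaryPoint y) e ![f, a, b, c] * V a = 0 := by
    refine Finset.sum_eq_zero fun k _ => ?_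
    rw [← mul_zero (V k), ← sum_mul_antisymm V
      (fun f a => covDeriv halfSpace G d (boundaryPoint y) k ![f, a, b, c])
      (fun f a => h.covDeriv_swap_left hy _ _ _ _ _)]
    simp only [Finset.mul_sum]
    exact Finset.sum_congr rfl fun a _ => Finset.sum_congr rfl fun b _ => by ring
  rw [e2, mul_zero, sub_zero] at e
  rw [← e]
  simp only [← h.divergence _ hy (boundaryPoint_zero y), Finset.sum_mul, Finset.mul_sum]
  rw [Finset.sum_comm]
  refine Finset.sum_congr rfl fun a _ => ?_
  rw [Finset.sum_comm]
  exact Finset.sum_congr rfl fun f _ => Finset.sum_congr rfl fun a _ => by ring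

/-! #### The electric part -/

theorem electricPart_eq (hN : IsConormalInChart G N U) (hy : boundaryPoint y ∈ U) (i j : Fin 3) :
    electricPart G N d y ![i, j] = 3 / Lam * ∑ a, (∑ b, d (boundaryPoint y) ![i.succ, a, j.succ, b]
      * gradVec G W (boundaryPoint y) b) * gradVec G W (boundaryPoint y) a := by
  rw [← h.sq_sqrt_lam]
  simp only [electricPart, Matrix.cons_val, h.normalVec_eq hN hy, Finset.mul_sum, Finset.sum_mul]
  exact Finset.sum_congr rfl fun a _ => Finset.sum_congr rfl fun b _ => by ring

theorem smooth_contract {x : Coord 4} (hx : x ∈ U) (a b c : Fin 4) :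
    SmoothWithin halfSpace (fun z => ∑ e, d z ![a, b, c, e] * gradVec G W z e) x :=
  ContDiffWithinAt.sum fun e _ => (h.smooth_weyl _ x hx).mul (h.smooth_gradVec hx e)

/-- The electric part annihilates the normal; thus the extrinsic curvature terms of
`christoffel_split` do not enter its covariant derivative. -/
theorem gradVec_contract_electric_left (hy : boundaryPoint y ∈ U) (j : Fin 4) :
    ∑ c, gradVec G W (boundaryPoint y) c * ∑ a, (∑ b, d (boundaryPoint y) ![c, a, j, b]
      * gradVec G W (boundaryPoint y) b) * gradVec G W (boundaryPoint y) a = 0 := by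
  rw [← sum_mul_antisymm (gradVec G W (boundaryPoint y))
    (fun c a => ∑ b, d (boundaryPoint y) ![c, a, j, b] * gradVec G W (boundaryPoint y) b) ?_]
  · simp only [Finset.mul_sum]
    refine Finset.sum_congr rfl fun a _ => Finset.sum_congr rfl fun b _ => ?_
    simp only [Finset.sum_mul, Finset.mul_sum]
    exact Finset.sum_congr rfl fun c _ => by ring
  · intro a b
    simp only [h.rescaled_swap_left hy a, neg_mul, Finset.sum_neg_distrib]

theorem gradVec_contract_electric_right (hy : boundaryPoint y ∈ U) (i : Fin 4) :
    ∑ c, gradVec G W (boundaryPoint y) c * ∑ a, (∑ b, d (boundaryPoint y) ![i, a, c, b]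
      * gradVec G W (boundaryPoint y) b) * gradVec G W (boundaryPoint y) a = 0 := by
  rw [← h.gradVec_contract_electric_left hy i]
  refine Finset.sum_congr rfl fun c _ => ?_
  congr 1
  simp only [Finset.sum_mul]
  rw [Finset.sum_comm]
  refine Finset.sum_congr rfl fun a _ => Finset.sum_congr rfl fun b _ => ?_
  rw [h.rescaled_pair hy]
  ring

/-- The two terms with factor `s` come from differentiating the two copies of `V` in the electric
part. -/
theorem covDeriv_electricPart (hN : IsConormalInChart G N U) (hy : boundaryPoint y ∈ U)
    (k i j : Fin 3) :
    covDeriv Set.univ (tangential G) (electricPart G N d) y k ![i, j] =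
      3 / Lam * (∑ a, ∑ b, covDeriv halfSpace G d (boundaryPoint y) k.succ ![i.succ, a, j.succ, b]
          * gradVec G W (boundaryPoint y) b * gradVec G W (boundaryPoint y) a
        + friedrichScalar G W (boundaryPoint y) * (
          ∑ a, d (boundaryPoint y) ![i.succ, a, j.succ, k.succ] * gradVec G W (boundaryPoint y) a
          + ∑ b, d (boundaryPoint y) ![i.succ, k.succ, j.succ, b]
            * gradVec G W (boundaryPoint y) b)) := by
  set V := gradVec G W (boundaryPoint y) with hV
  have sE : ∀ i j : Fin 4, SmoothWithin halfSpace
      (fun z => ∑ a, (∑ b, d z ![i, a, j, b] * gradVec G W z b) * gradVec G W z a)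
      (boundaryPoint y) := fun i j =>
    ContDiffWithinAt.sum fun a _ => (h.smooth_contract hy _ _ _).mul (h.smooth_gradVec hy a)
  have e1 : pd Set.univ (fun z => electricPart G N d z ![i, j]) k y = 3 / Lam * pd halfSpace
      (fun z => ∑ a, (∑ b, d z ![i.succ, a, j.succ, b] * gradVec G W z b) * gradVec G W z a) k.succ
      (boundaryPoint y) := by
    rw [← pd_const_mul h.metric.domain (h.metric.subset hy) _ (sE _ _),
      ← pd_restrict (contDiffWithinAt_const.mul (sE _ _))]
    exact h.induced_metric.pd_congr_on (x := y) hy (fun z hz => h.electricPart_eq hN hz i j) k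
  rw [covDeriv_two, e1, h.pd_contract_gradVec hy fun a => h.smooth_contract hy _ _ _]
  simp only [h.pd_contract_gradVec hy fun b => h.smooth_weyl ![i.succ, _, j.succ, b] _ hy]
  have c1 := h.christoffel_split hy k i (fun c => ∑ a, (∑ b, d (boundaryPoint y) ![c, a, j.succ, b]
    * gradVec G W (boundaryPoint y) b) * gradVec G W (boundaryPoint y) a)
  have c2 := h.christoffel_split hy k j (fun c => ∑ a, (∑ b, d (boundaryPoint y) ![i.succ, a, c, b]
    * gradVec G W (boundaryPoint y) b) * gradVec G W (boundaryPoint y) a)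
  rw [h.gradVec_contract_electric_left hy, mul_zero, add_zero] at c1
  rw [h.gradVec_contract_electric_right hy, mul_zero, add_zero] at c2
  simp only [h.electricPart_eq hN hy, mul_left_comm _ (3 / Lam), ← Finset.mul_sum, ← c1, ← c2,
    covDeriv_four]
  rw [← mul_sub, ← mul_sub]
  congr 1
  simp only [← hV]
  have d1 : ∑ c, christoffel halfSpace G (boundaryPoint y) c k.succ i.succ * ∑ a,
      (∑ b, d (boundaryPoint y) ![c, a, j.succ, b] * V b) * V a =
      ∑ a, ∑ b, (∑ m, christoffel halfSpace G (boundaryPoint y) m k.succ i.succ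
        * d (boundaryPoint y) ![m, a, j.succ, b]) * V b * V a := by
    simp only [Finset.mul_sum, Finset.sum_mul]
    rw [Finset.sum_comm]
    refine Finset.sum_congr rfl fun a _ => ?_
    rw [Finset.sum_comm]
    exact Finset.sum_congr rfl fun b _ => Finset.sum_congr rfl fun c _ => by ring
  have d2 : ∑ c, christoffel halfSpace G (boundaryPoint y) c k.succ j.succ * ∑ a,
      (∑ b, d (boundaryPoint y) ![i.succ, a, c, b] * V b) * V a =
      ∑ a, ∑ b, (∑ m, christoffel halfSpace G (boundaryPoint y) m k.succ j.succ
        * d (boundaryPoint y) ![i.succ, a, m, b]) * V b * V a := by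
    simp only [Finset.mul_sum, Finset.sum_mul]
    rw [Finset.sum_comm]
    refine Finset.sum_congr rfl fun a _ => ?_
    rw [Finset.sum_comm]
    exact Finset.sum_congr rfl fun b _ => Finset.sum_congr rfl fun c _ => by ring
  have d3 : ∀ a, ∑ m, christoffel halfSpace G (boundaryPoint y) m k.succ a
      * ∑ b, d (boundaryPoint y) ![i.succ, m, j.succ, b] * V b =
      ∑ b, (∑ m, christoffel halfSpace G (boundaryPoint y) m k.succ a
        * d (boundaryPoint y) ![i.succ, m, j.succ, b]) * V b := by
    intro a
    simp only [Finset.mul_sum, Finset.sum_mul]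
    rw [Finset.sum_comm]
    exact Finset.sum_congr rfl fun b _ => Finset.sum_congr rfl fun c _ => by ring
  simp only [d1, d2, d3, sub_mul, add_mul, Finset.sum_sub_distrib, Finset.sum_add_distrib]
  simp only [Finset.sum_mul, Finset.mul_sum, mul_add, mul_assoc]
  ring

theorem electric (hN : IsConormalInChart G N U) (hy : boundaryPoint y ∈ U) (i : Fin 3) :
    ∑ j, ∑ k, invMetric (tangential G) y j k *
        covDeriv Set.univ (tangential G) (electricPart G N d) y k ![i, j] =
      -∑ a, ∑ b, Q (boundaryPoint y) ![a, b, i.succ]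
        * normalVec G N (boundaryPoint y) a * normalVec G N (boundaryPoint y) b := by
  have hI := h.induced_metric
  set V := gradVec G W (boundaryPoint y) with hV
  have q : ∑ a, ∑ b, Q (boundaryPoint y) ![a, b, i.succ]
        * normalVec G N (boundaryPoint y) a * normalVec G N (boundaryPoint y) b =
      3 / Lam * ∑ b, (∑ a, Q (boundaryPoint y) ![a, b, i.succ] * V a) * V b := by
    rw [← h.sq_sqrt_lam, Finset.sum_comm]
    simp only [h.normalVec_eq hN hy, Finset.mul_sum, Finset.sum_mul]
    exact Finset.sum_congr rfl fun a _ => Finset.sum_congr rfl fun b _ => by ring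
  -- Of the two corrections to `D e`, this one vanishes by antisymmetry in `j, k`, and the next
  -- because the tangential trace of `d(·,·,·,V)` vanishes.
  have t1 : ∑ j, ∑ k, invMetric (tangential G) y j k *
      ∑ a, d (boundaryPoint y) ![i.succ, a, j.succ, k.succ] * V a = 0 :=
    hI.sum_inv_mul_antisymm (x := y) hy _ fun j k => by
      simp only [h.rescaled_swap_right hy _ _ j.succ, neg_mul, Finset.sum_neg_distrib]
  have t2 : ∑ j, ∑ k, invMetric (tangential G) y j k *
      ∑ b, d (boundaryPoint y) ![i.succ, k.succ, j.succ, b] * V b = 0 := by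
    rw [hI.sum_inv_mul_symm (x := y) hy, ← neg_eq_zero, ← h.rescaled_trace_tangential hy i]
    simp only [← Finset.sum_neg_distrib]
    refine Finset.sum_congr rfl fun j _ => Finset.sum_congr rfl fun k _ => ?_
    simp only [h.rescaled_swap_left hy i.succ, neg_mul, Finset.sum_neg_distrib, mul_neg, neg_neg]
    rfl
  -- Pair symmetry and one swap move the free index `i` to the first slot, as in the electric part;
  -- the swap produces the minus sign of the constraint.
  have m : ∑ b, (∑ a, Q (boundaryPoint y) ![a, b, i.succ] * V a) * V b =
      -∑ j, ∑ k, invMetric (tangential G) y j k * ∑ a, ∑ b,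
        covDeriv halfSpace G d (boundaryPoint y) k.succ ![i.succ, a, j.succ, b] * V b * V a := by
    simp only [hV, h.divergence_gradVec hy]
    simp only [← hV, Finset.sum_mul]
    rw [Finset.sum_comm]
    conv_rhs => rw [Finset.sum_comm]
    simp only [← Finset.sum_neg_distrib]
    refine Finset.sum_congr rfl fun k _ => ?_
    rw [Finset.sum_comm]
    refine Finset.sum_congr rfl fun l _ => ?_
    simp only [Finset.mul_sum, Finset.sum_mul, ← Finset.sum_neg_distrib]
    refine Finset.sum_congr rfl fun b _ => Finset.sum_congr rfl fun a _ => ?_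
    rw [h.covDeriv_pair hy _ i.succ, h.covDeriv_swap_right hy _ _ _ i.succ, hI.inv_symm (x := y) hy l]
    ring
  rw [q, m]
  simp only [h.covDeriv_electricPart hN hy, mul_left_comm _ (3 / Lam), ← Finset.mul_sum]
  simp only [mul_add, Finset.sum_add_distrib, mul_left_comm _ (friedrichScalar _ _ _)]
  simp only [← Finset.mul_sum]
  rw [t1, t2]
  ring

/-! #### The normal part of the rescaled Cotton tensor -/

/-- The term `s d_ijlk` comes from differentiating `V`. The extrinsic curvature enters through the
first two slots only, since a `V` in the third slot meets the `V` already in the fourth. -/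
theorem covDeriv_magneticPart (hN : IsConormalInChart G N U) (hy : boundaryPoint y ∈ U)
    (k i j l : Fin 3) :
    covDeriv Set.univ (tangential G) (magneticPart G N d) y k ![i, j, l] =
      -√(3 / Lam) * (∑ a, covDeriv halfSpace G d (boundaryPoint y) k.succ
          ![i.succ, j.succ, l.succ, a] * gradVec G W (boundaryPoint y) a
        + friedrichScalar G W (boundaryPoint y) * d (boundaryPoint y)
            ![i.succ, j.succ, l.succ, k.succ]
        + 3 / Lam * friedrichScalar G W (boundaryPoint y) * (
          tangential G y ![k, i] * (∑ c, gradVec G W (boundaryPoint y) c *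
            ∑ a, d (boundaryPoint y) ![c, j.succ, l.succ, a] * gradVec G W (boundaryPoint y) a)
          + tangential G y ![k, j] * (∑ c, gradVec G W (boundaryPoint y) c *
            ∑ a, d (boundaryPoint y) ![i.succ, c, l.succ, a]
              * gradVec G W (boundaryPoint y) a))) := by
  set V := gradVec G W (boundaryPoint y) with hV
  have e1 : pd Set.univ (fun z => magneticPart G N d z ![i, j, l]) k y = -√(3 / Lam) * pd halfSpace
      (fun z => ∑ a, d z ![i.succ, j.succ, l.succ, a] * gradVec G W z a) k.succ
      (boundaryPoint y) := by
    rw [← pd_const_mul h.metric.domain (h.metric.subset hy) _ (h.smooth_contract hy _ _ _),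
      ← pd_restrict (contDiffWithinAt_const.mul (h.smooth_contract hy _ _ _))]
    exact h.induced_metric.pd_congr_on (x := y) hy (fun z hz => h.magneticPart_eq hN hz i j l) k
  rw [covDeriv_three, e1, h.pd_contract_gradVec hy fun a => h.smooth_weyl _ _ hy]
  have c1 := h.christoffel_split hy k i (fun c => ∑ a, d (boundaryPoint y) ![c, j.succ, l.succ, a]
    * V a)
  have c2 := h.christoffel_split hy k j (fun c => ∑ a, d (boundaryPoint y) ![i.succ, c, l.succ, a]
    * V a)
  have c3 := h.christoffel_split hy k l (fun c => ∑ a, d (boundaryPoint y) ![i.succ, j.succ, c, a]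
    * V a)
  have c4 : ∑ c, V c * ∑ a, d (boundaryPoint y) ![i.succ, j.succ, c, a] * V a = 0 := by
    rw [← sum_mul_antisymm V (fun c a => d (boundaryPoint y) ![i.succ, j.succ, c, a])
      (fun c a => h.rescaled_swap_right hy _ _ _ _)]
    simp only [Finset.mul_sum]
    exact Finset.sum_congr rfl fun a _ => Finset.sum_congr rfl fun b _ => by ring
  have d0 : ∀ F : Fin 4 → Fin 4 → ℝ, ∀ Γ : Fin 4 → ℝ, ∑ c, Γ c * ∑ a, F c a * V a =
      ∑ a, (∑ c, Γ c * F c a) * V a := by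
    intro F Γ
    simp only [Finset.mul_sum, Finset.sum_mul]
    rw [Finset.sum_comm]
    exact Finset.sum_congr rfl fun b _ => Finset.sum_congr rfl fun c _ => by ring
  simp only [← hV] at c1 c2 c3
  rw [c4, mul_zero, add_zero, d0] at c3
  rw [d0 _ (fun c => christoffel halfSpace G (boundaryPoint y) c k.succ i.succ)] at c1
  rw [d0 _ (fun c => christoffel halfSpace G (boundaryPoint y) c k.succ j.succ)] at c2
  simp only [h.magneticPart_eq hN hy, ← hV, mul_left_comm _ (-√(3 / Lam)), ← Finset.mul_sum,
    covDeriv_four, tangential_apply_two]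
  rw [← c3, eq_sub_of_add_eq c1.symm, eq_sub_of_add_eq c2.symm]
  simp only [sub_mul, Finset.sum_sub_distrib]
  ring

/-- Through `cotton_eq_rescaled` this is the tangential trace of `d(·,·,·,V)`, and it supplies the
trace hypothesis of `div_cotton`. -/
theorem trace_cotton_tangential (hy : boundaryPoint y ∈ U) (j : Fin 3) :
    ∑ k, ∑ l, invMetric (tangential G) y k l * cotton Set.univ (tangential G) y ![k, l, j] = 0 := by
  rw [h.induced_metric.sum_inv_mul_symm (x := y) hy, ← neg_eq_zero,
    ← h.rescaled_trace_tangential hy j]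
  simp only [h.cotton_eq_rescaled hy, mul_neg, Finset.sum_neg_distrib, neg_neg]

theorem covDeriv_magneticPart_eq_cotton (hN : IsConormalInChart G N U) (hy : boundaryPoint y ∈ U)
    (k i j l : Fin 3) :
    covDeriv Set.univ (tangential G) (magneticPart G N d) y k ![i, j, l] = √(3 / Lam) *
      covDeriv Set.univ (tangential G) (cotton Set.univ (tangential G)) y k ![l, i, j] := by
  have hI := h.induced_metric
  have sA : ∀ I, SmoothWithin Set.univ (fun z => cotton Set.univ (tangential G) z I) y := fun I =>
    (hI.smooth_covDeriv (x := y) hy (fun I => hI.smooth_schouten (x := y) hy I) _ _).sub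
      (hI.smooth_covDeriv (x := y) hy (fun I => hI.smooth_schouten (x := y) hy I) _ _)
  have e : pd Set.univ (fun z => magneticPart G N d z ![i, j, l]) k y =
      √(3 / Lam) * pd Set.univ (fun z => cotton Set.univ (tangential G) z ![l, i, j]) k y := by
    rw [← pd_const_mul hI.domain (Set.mem_univ y) _ (sA _)]
    exact hI.pd_congr_on (x := y) hy (fun z hz => h.magnetic hN hz i j l) k
  rw [covDeriv_three, covDeriv_three, e]
  simp only [h.magnetic hN hy, mul_left_comm _ (√(3 / Lam)), ← Finset.mul_sum]
  ring

/-- The divergence of `b_ijl` over `l` vanishes, being a multiple of the Cotton divergence. Its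
corrections cancel, and what remains is the contraction with `V` of the divergence equation. -/
theorem cotton_normal (hN : IsConormalInChart G N U) (hy : boundaryPoint y ∈ U) (i j : Fin 3) :
    ∑ a, Q (boundaryPoint y) ![a, i.succ, j.succ] * normalVec G N (boundaryPoint y) a = 0 := by
  have hI := h.induced_metric
  set V := gradVec G W (boundaryPoint y) with hV
  have dc := hI.div_cotton (x := y) hy (h.riemann_induced_eq_schouten hy)
    (fun z hz j => h.trace_cotton_tangential hz j) i j
  have db : ∑ k, ∑ l, invMetric (tangential G) y k l *
      covDeriv Set.univ (tangential G) (magneticPart G N d) y k ![i, j, l] = 0 := by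
    simp only [h.covDeriv_magneticPart_eq_cotton hN hy, mul_left_comm _ (√(3 / Lam)),
      ← Finset.mul_sum, dc, mul_zero]
  set F : Fin 4 → Fin 4 → ℝ := fun p q => ∑ c, V c * ∑ a, d (boundaryPoint y) ![c, p, q, a] * V a
    with hF
  have Fs : ∀ p q, ∑ c, V c * ∑ a, d (boundaryPoint y) ![p, c, q, a] * V a = -F p q := by
    intro p q
    simp only [hF, h.rescaled_swap_left hy p, neg_mul, Finset.sum_neg_distrib, mul_neg]
  -- The extrinsic curvature terms contribute `F_ji - F_ij` after tracing, so this symmetry removes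
  -- them.
  have Fsymm : ∀ p q, F p q = F q p := by
    intro p q
    simp only [hF, Finset.mul_sum]
    rw [Finset.sum_comm]
    refine Finset.sum_congr rfl fun a _ => Finset.sum_congr rfl fun c _ => ?_
    rw [h.rescaled_pair hy, h.rescaled_swap_left hy q, h.rescaled_swap_right hy a]
    ring
  have t1 : ∑ k, ∑ l, invMetric (tangential G) y k l *
      d (boundaryPoint y) ![i.succ, j.succ, l.succ, k.succ] = 0 :=
    hI.sum_inv_mul_antisymm (x := y) hy _ fun k l => h.rescaled_swap_right hy _ _ _ _
  have t2 := hI.sum_inv_mul_metric_mul' (x := y) hy (fun l => F j.succ l.succ) i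
  have t3 := hI.sum_inv_mul_metric_mul' (x := y) hy (fun l => F i.succ l.succ) j
  have hc : √(3 / Lam) ≠ 0 := (Real.sqrt_pos.2 (div_pos (by norm_num) h.lam_pos)).ne'
  simp only [h.covDeriv_magneticPart hN hy, mul_left_comm _ (-√(3 / Lam)), ← Finset.mul_sum] at db
  have db' := (mul_eq_zero.1 db).resolve_left (neg_ne_zero.2 hc)
  simp only [← hV, Fs] at db'
  change ∑ k, ∑ l, invMetric (tangential G) y k l * (_ + _ + _ * (_ * F j.succ l.succ + _)) = 0 at db'
  simp only [mul_add, Finset.sum_add_distrib, mul_left_comm _ (friedrichScalar _ _ _),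
    mul_left_comm _ (3 / Lam * friedrichScalar _ _ _)] at db'
  simp only [← Finset.mul_sum, mul_neg, Finset.sum_neg_distrib] at db'
  rw [t1, t2, t3, Fsymm i.succ] at db'
  simp only [h.normalVec_eq hN hy, mul_left_comm _ (-√(3 / Lam)), ← Finset.mul_sum]
  rw [h.divergence_gradVec hy]
  simp only [h.covDeriv_pair hy _ _ _ i.succ]
  rw [← hV]
  rw [show ∑ k, ∑ l, invMetric (tangential G) y k l * ∑ a, covDeriv halfSpace G d (boundaryPoint y)
    k.succ ![i.succ, j.succ, l.succ, a] * V a = 0 by linarith, mul_zero]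

/-- The constraints at the conformal boundary, in a chart. -/
theorem boundaryConstraints (hN : IsConormalInChart G N U) (hy : boundaryPoint y ∈ U) :
    BoundaryConstraintsAt Lam W G d Q N y where
  normal_derivative := h.normal_derivative hN hy
  umbilic := h.umbilic hN hy
  schouten_normal := h.schouten_normal hN hy
  schouten_tangential := h.schouten_tangential hy
  magnetic := h.magnetic hN hy
  electric := h.electric hN hy
  cotton_normal := h.cotton_normal hN hy

end IsBoundaryChart

end Divergence

/-! ### Orthonormal bases and coordinate frames -/

section Frames

/-- The columns of `E` are the coordinates of the images of the standard vectors in the orthonormal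
basis; injectivity of `A` makes `E` invertible. -/
theorem exists_frame_matrix {V : Type*} [AddCommGroup V] [Module ℝ V]
    (B : MultilinearMap ℝ (fun _ : Fin 2 => V) ℝ) (b : Module.Basis (Fin 4) ℝ V)
    (hb : ∀ i j, B ![b i, b j] = if i = j then (if i = 0 then -1 else 1) else 0)
    (A : Coord 4 →ₗ[ℝ] V) (hA : Function.Injective A) :
    ∃ E : Matrix (Fin 4) (Fin 4) ℝ, E.det ≠ 0 ∧
      ∀ a c, B ![A (EuclideanSpace.single a 1), A (EuclideanSpace.single c 1)] =
        -(E 0 a * E 0 c) + ∑ i : Fin 3, E i.succ a * E i.succ c := by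
  have u0 : ∀ u v w : V, Function.update ![u, v] 0 w = ![w, v] := fun u v w => by
    ext i; fin_cases i <;> rfl
  have u1 : ∀ u v w : V, Function.update ![u, v] 1 w = ![u, w] := fun u v w => by
    ext i; fin_cases i <;> rfl
  let B' : V →ₗ[ℝ] V →ₗ[ℝ] ℝ := LinearMap.mk₂ ℝ (fun u v => B ![u, v])
    (fun u u' v => by simpa only [u0] using B.map_update_add ![u, v] 0 u u')
    (fun c u v => by simpa only [u0] using B.map_update_smul ![u, v] 0 c u)
    (fun u v v' => by simpa only [u1] using B.map_update_add ![u, v] 1 v v')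
    (fun c u v => by simpa only [u1] using B.map_update_smul ![u, v] 1 c v)
  refine ⟨Matrix.of fun i a => b.repr (A (EuclideanSpace.single a 1)) i, fun hdet => ?_,
    fun a c => ?_⟩
  · obtain ⟨v, hv, hv0⟩ := Matrix.exists_mulVec_eq_zero_iff.2 hdet
    apply hv
    have e : (WithLp.toLp 2 v : Coord 4) = ∑ a, v a • EuclideanSpace.single a (1 : ℝ) := by
      ext i
      simp [Pi.single_apply]
    have z : A (WithLp.toLp 2 v) = 0 := by
      apply b.repr.injective
      ext i
      have := congrFun hv0 i
      simp only [Matrix.mulVec, dotProduct, Matrix.of_apply, Pi.zero_apply] at this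
      rw [e]
      simp only [map_sum, map_smul, map_zero, Finsupp.coe_zero, Pi.zero_apply,
        Finsupp.coe_finsetSum, Finset.sum_apply, Finsupp.coe_smul, Pi.smul_apply, smul_eq_mul]
      rw [← this]
      exact Finset.sum_congr rfl fun a _ => mul_comm _ _
    have := (map_eq_zero_iff A hA).1 z
    funext i
    exact congrArg (fun w : Coord 4 => w i) this
  · have e := LinearMap.sum_repr_mul_repr_mul b b (B := B') (A (EuclideanSpace.single a 1))
      (A (EuclideanSpace.single c 1))
    have e' : B' (A (EuclideanSpace.single a 1)) (A (EuclideanSpace.single c 1)) =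
      B ![A (EuclideanSpace.single a 1), A (EuclideanSpace.single c 1)] := rfl
    have hb' : ∀ i j, B' (b i) (b j) = if i = j then (if i = 0 then -1 else 1) else 0 := hb
    rw [← e', ← e]
    simp [Finsupp.sum_fintype, hb', Fin.sum_univ_succ (n := 3), Fin.succ_ne_zero,
      (Fin.succ_ne_zero _).symm]

/-- The hypothesis reads `G = Eᵀ diag(-1,1,1,1) E`. -/
theorem det_ne_zero_of_frame {G : Fin 4 → Fin 4 → ℝ} {E : Matrix (Fin 4) (Fin 4) ℝ}
    (hE : E.det ≠ 0)
    (hG : ∀ a c, G a c = -(E 0 a * E 0 c) + ∑ i : Fin 3, E i.succ a * E i.succ c) :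
    (Matrix.of G).det ≠ 0 := by
  have e : Matrix.of G = E.transpose * Matrix.diagonal (Fin.cons (-1) fun _ => 1) * E := by
    ext a c
    rw [Matrix.mul_apply]
    simp [Matrix.mul_diagonal, Fin.sum_univ_succ (n := 3), hG]
  rw [e, Matrix.det_mul, Matrix.det_mul, Matrix.det_transpose, Matrix.det_diagonal]
  simp [hE, Fin.prod_univ_succ]

end Frames

/-! ### From the manifold to a boundary chart -/

section Charts

variable {M : Type*} [TopologicalSpace M] {φ : OpenPartialHomeomorph M (EuclideanHalfSpace 4)}
  {x : Coord 4}

theorem symm_mem_source (hx : x ∈ (φ.extend (𝓡∂ 4)).target) :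
    (φ.extend (𝓡∂ 4)).symm x ∈ φ.source := by
  rw [← φ.extend_source (I := 𝓡∂ 4)]
  exact (φ.extend (𝓡∂ 4)).map_target hx

theorem target_mem_nhdsWithin (hx : x ∈ (φ.extend (𝓡∂ 4)).target) :
    (φ.extend (𝓡∂ 4)).target ∈ 𝓝[halfSpace] x := by
  have := φ.extend_target_mem_nhdsWithin (I := 𝓡∂ 4) (symm_mem_source hx)
  rwa [(φ.extend (𝓡∂ 4)).right_inv hx] at this

theorem mem_interior_target_iff (hx : x ∈ (φ.extend (𝓡∂ 4)).target) :
    x ∈ interior (φ.extend (𝓡∂ 4)).target ↔ 0 < x 0 := by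
  have hint : interior halfSpace = {z : Coord 4 | 0 < z 0} :=
    interior_range_modelWithCornersEuclideanHalfSpace 4
  constructor
  · intro h
    have : x ∈ interior halfSpace := interior_mono φ.extend_target_subset_range h
    rwa [hint] at this
  · intro h
    have h' : x ∈ interior halfSpace := by rwa [hint]
    have hn := target_mem_nhdsWithin hx
    rw [nhdsWithin_eq_nhds.2 (mem_interior_iff_mem_nhds.1 h')] at hn
    exact mem_interior_iff_mem_nhds.2 hn

variable [ChartedSpace (EuclideanHalfSpace 4) M]

theorem IsSmoothTensor.smoothWithin {k : ℕ} {T : TensorField M k} (hT : IsSmoothTensor T)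
    (hφ : φ ∈ atlas (EuclideanHalfSpace 4) M) (I : Fin k → Fin 4)
    (hx : x ∈ (φ.extend (𝓡∂ 4)).target) :
    SmoothWithin halfSpace (fun z => components φ T z I) x :=
  (hT φ hφ I x hx).mono_of_mem_nhdsWithin (target_mem_nhdsWithin hx)

variable {Lam q : ℝ} {Ω : M → ℝ} {g ghat T That : TensorField M 2} {d : TensorField M 4}
  {Q : TensorField M 3}

theorem isConormalInChart {g : TensorField M 2} {n : TensorField M 1}
    (hφ : φ ∈ atlas (EuclideanHalfSpace 4) M)
    (hn : IsInwardUnitConormal g n) :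
    IsConormalInChart (components φ g) (components φ n) (φ.extend (𝓡∂ 4)).target where
  normal := hn.normal φ hφ
  unit := hn.unit φ hφ
  inward := hn.inward φ hφ

variable [IsManifold (𝓡∂ 4) ∞ M]

/-- On a smooth manifold, being an interior point can be tested in any chart of the atlas containing
the point, not only in the preferred one. -/
theorem isInteriorPoint_iff (hφ : φ ∈ atlas (EuclideanHalfSpace 4) M) {p : M}
    (hp : p ∈ φ.source) : p ∈ (𝓡∂ 4).interior M ↔ 0 < φ.extend (𝓡∂ 4) p 0 := by
  have hx : φ.extend (𝓡∂ 4) p ∈ (φ.extend (𝓡∂ 4)).target :=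
    (φ.extend (𝓡∂ 4)).map_source (by rwa [φ.extend_source])
  rw [← mem_interior_target_iff hx]
  exact (𝓡∂ 4).isInteriorPoint_iff_of_mem_atlas (n := ∞) (by simp) hφ hp

theorem symm_mem_interior_iff (hφ : φ ∈ atlas (EuclideanHalfSpace 4) M)
    (hx : x ∈ (φ.extend (𝓡∂ 4)).target) :
    (φ.extend (𝓡∂ 4)).symm x ∈ (𝓡∂ 4).interior M ↔ 0 < x 0 := by
  rw [isInteriorPoint_iff hφ (symm_mem_source hx), (φ.extend (𝓡∂ 4)).right_inv hx]

theorem contMDiffWithinAt_symm (hφ : φ ∈ atlas (EuclideanHalfSpace 4) M)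
    (hx : x ∈ (φ.extend (𝓡∂ 4)).target) :
    ContMDiffWithinAt 𝓘(ℝ, Coord 4) (𝓡∂ 4) ∞ (φ.extend (𝓡∂ 4)).symm halfSpace x := by
  have hm : φ ∈ IsManifold.maximalAtlas (𝓡∂ 4) ∞ M :=
    IsManifold.subset_maximalAtlas hφ
  have h := contMDiffOn_extend_symm (I := 𝓡∂ 4) hm
  rw [← φ.extend_target'] at h
  exact (h x hx).mono_of_mem_nhdsWithin (target_mem_nhdsWithin hx)

/-- By the chain rule the derivative of the chart is a left inverse. Hence the coordinate vectors
form a frame, also at boundary points. -/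
theorem injective_mfderivWithin_symm (hφ : φ ∈ atlas (EuclideanHalfSpace 4) M)
    (hx : x ∈ (φ.extend (𝓡∂ 4)).target) :
    Function.Injective
      (mfderivWithin 𝓘(ℝ, Coord 4) (𝓡∂ 4) (φ.extend (𝓡∂ 4)).symm halfSpace x) := by
  have hm : φ ∈ IsManifold.maximalAtlas (𝓡∂ 4) ∞ M :=
    IsManifold.subset_maximalAtlas hφ
  have hxD : x ∈ halfSpace := φ.extend_target_subset_range hx
  have hU : UniqueMDiffWithinAt 𝓘(ℝ, Coord 4) halfSpace x := (𝓡∂ 4).uniqueMDiffOn x hxD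
  have h1 : MDifferentiableAt (𝓡∂ 4) 𝓘(ℝ, Coord 4) (φ.extend (𝓡∂ 4))
      ((φ.extend (𝓡∂ 4)).symm x) :=
    (φ.contMDiffAt_extend hm (symm_mem_source hx)).mdifferentiableAt (by simp)
  have h2 : MDifferentiableWithinAt 𝓘(ℝ, Coord 4) (𝓡∂ 4) (φ.extend (𝓡∂ 4)).symm halfSpace x :=
    (contMDiffWithinAt_symm hφ hx).mdifferentiableWithinAt (by simp)
  have h3 := mfderiv_comp_mfderivWithin x h1 h2 hU
  have h4 : mfderivWithin 𝓘(ℝ, Coord 4) 𝓘(ℝ, Coord 4)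
      (φ.extend (𝓡∂ 4) ∘ (φ.extend (𝓡∂ 4)).symm) halfSpace x =
      mfderivWithin 𝓘(ℝ, Coord 4) 𝓘(ℝ, Coord 4) id halfSpace x := by
    apply Filter.EventuallyEq.mfderivWithin_eq
    · filter_upwards [target_mem_nhdsWithin hx] with z hz
      simp only [Function.comp_def, PartialEquiv.right_inv _ hz, id_eq]
    · simp only [Function.comp_def, PartialEquiv.right_inv _ hx, id_eq]
  intro u v huv
  have h5 : ∀ w : Coord 4, mfderiv (𝓡∂ 4) 𝓘(ℝ, Coord 4) (φ.extend (𝓡∂ 4))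
      ((φ.extend (𝓡∂ 4)).symm x)
      (mfderivWithin 𝓘(ℝ, Coord 4) (𝓡∂ 4) (φ.extend (𝓡∂ 4)).symm halfSpace x w) = w := by
    intro w
    have := congrArg (fun A => A w) (h3.symm.trans (h4.trans (mfderivWithin_id hU)))
    exact this
  rw [← h5 u, ← h5 v]
  exact congrArg _ huv

theorem exists_frame_components (hφ : φ ∈ atlas (EuclideanHalfSpace 4) M) {g : TensorField M 2}
    (hg : IsLorentzian g) (hx : x ∈ (φ.extend (𝓡∂ 4)).target) :
    ∃ E : Matrix (Fin 4) (Fin 4) ℝ, E.det ≠ 0 ∧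
      ∀ a c, components φ g x ![a, c] =
        -(E 0 a * E 0 c) + ∑ i : Fin 3, E i.succ a * E i.succ c := by
  obtain ⟨b, hb⟩ := hg ((φ.extend (𝓡∂ 4)).symm x)
  obtain ⟨E, hE, hG⟩ := exists_frame_matrix (g ((φ.extend (𝓡∂ 4)).symm x)) b hb
    (mfderivWithin 𝓘(ℝ, Coord 4) (𝓡∂ 4) (φ.extend (𝓡∂ 4)).symm halfSpace x).toLinearMap
    (injective_mfderivWithin_symm hφ hx)
  refine ⟨E, hE, fun a c => ?_⟩
  rw [← hG]
  simp only [components]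
  congr 1
  funext j
  fin_cases j <;> rfl

theorem isRegularMetric_components (hφ : φ ∈ atlas (EuclideanHalfSpace 4) M)
    (hg : IsLorentzian g) (hs : IsSmoothTensor g) :
    IsRegularMetric halfSpace (components φ g) (φ.extend (𝓡∂ 4)).target where
  domain := isRegularDomain_halfSpace
  subset := φ.extend_target_subset_range
  nhds _ hx := target_mem_nhdsWithin hx
  symm x hx a b := by
    obtain ⟨E, -, hG⟩ := exists_frame_components hφ hg hx
    rw [hG, hG, mul_comm (E 0 a)]
    congr 1
    exact Finset.sum_congr rfl fun i _ => mul_comm _ _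
  det x hx := by
    obtain ⟨E, hE, hG⟩ := exists_frame_components hφ hg hx
    exact det_ne_zero_of_frame hE hG
  smooth I _ hx := hs.smoothWithin hφ I hx

theorem inChart_eq_zero (hφ : φ ∈ atlas (EuclideanHalfSpace 4) M)
    (hext : IsConformalExtension Lam q Ω g ghat T That d Q)
    (hx : x ∈ (φ.extend (𝓡∂ 4)).target) (hx0 : x 0 = 0) : inChart φ Ω x = 0 := by
  refine hext.factor_zero _ ?_
  rw [← ModelWithCorners.compl_interior]
  intro hint
  exact ((symm_mem_interior_iff hφ hx).1 hint).ne' hx0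

/-- Setting `Ω = 0` in the field equations removes the matter terms and the explicit `P` and `Q`
terms from the Hessian, Cotton and cosmological equations. -/
theorem isBoundaryChart (hφ : φ ∈ atlas (EuclideanHalfSpace 4) M)
    (hext : IsConformalExtension Lam q Ω g ghat T That d Q)
    (hcefe : SatisfiesConformalEinstein Lam Ω g ghat That d Q) :
    IsBoundaryChart Lam (inChart φ Ω) (components φ g) (components φ d) (components φ Q)
      (φ.extend (𝓡∂ 4)).target where
  lam_pos := hext.lam_pos
  metric := isRegularMetric_components hφ hext.lorentzian hext.smooth_metric
  lorentz _ hx := exists_frame_components hφ hext.lorentzian hx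
  smooth_factor x hx := by
    have h := ContMDiffAt.comp_contMDiffWithinAt x hext.smooth_factor.contMDiffAt
      (contMDiffWithinAt_symm hφ hx)
    exact h.contDiffWithinAt
  factor_pos x hx hx0 := hext.factor_pos _ ((symm_mem_interior_iff hφ hx).2 hx0)
  factor_zero _ hx hx0 := inChart_eq_zero hφ hext hx hx0
  smooth_weyl I _ hx := hext.smooth_weyl.smoothWithin hφ I hx
  rescaled_weyl I x hx hx0 :=
    hext.rescaled_weyl φ hφ x hx ((symm_mem_interior_iff hφ hx).2 hx0) I
  hessian x hx hx0 a b := by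
    rw [(hcefe.equations φ hφ x hx).hessian, inChart_eq_zero hφ hext hx hx0]
    ring
  divergence x hx _ a b c := (hcefe.equations φ hφ x hx).divergence a b c
  schouten_curl x hx hx0 a b c := by
    rw [(hcefe.equations φ hφ x hx).schouten_curl,
      inChart_eq_zero hφ hext hx hx0]
    ring
  cosmological x hx hx0 := by
    conv_lhs => rw [(hcefe.equations φ hφ x hx).cosmological,
      inChart_eq_zero hφ hext hx hx0]
    ring

/-- Since `Ω` is positive in the interior, a zero of `Ω` must have `x 0 = 0` in the chart and is
recovered from its boundary coordinates. -/
theorem boundaryPoint_boundaryCoord_mem (hφ : φ ∈ atlas (EuclideanHalfSpace 4) M)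
    (hext : IsConformalExtension Lam q Ω g ghat T That d Q) {p : M} (hp : Ω p = 0)
    (hpφ : p ∈ φ.source) :
    boundaryPoint (boundaryCoord (φ.extend (𝓡∂ 4) p)) ∈ (φ.extend (𝓡∂ 4)).target := by
  have hx : φ.extend (𝓡∂ 4) p ∈ (φ.extend (𝓡∂ 4)).target :=
    (φ.extend (𝓡∂ 4)).map_source (by rwa [φ.extend_source])
  have hx0 : 0 ≤ φ.extend (𝓡∂ 4) p 0 := by
    have := φ.extend_target_subset_range hx
    rwa [range_modelWithCornersEuclideanHalfSpace] at this
  rw [boundaryPoint_boundaryCoord]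
  · exact hx
  · refine le_antisymm (not_lt.1 fun hpos => ?_) hx0
    exact (hext.factor_pos p ((isInteriorPoint_iff hφ hpφ).2 hpos)).ne' hp

end Charts

end ConformalBoundary

theorem mainTheorem2 {M : Type*} [TopologicalSpace M] [ChartedSpace (EuclideanHalfSpace 4) M]
    [IsManifold (𝓡∂ 4) ∞ M] (Lam q : ℝ) (Ω : M → ℝ) (g ghat T That : TensorField M 2)
    (d : TensorField M 4) (Q : TensorField M 3)
    (hext : IsConformalExtension Lam q Ω g ghat T That d Q)
    (hcefe : SatisfiesConformalEinstein Lam Ω g ghat That d Q) :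
    -- the boundary is spacelike, so that it has an inward unit normal
    (∀ p : M, Ω p = 0 → ∀ φ ∈ atlas (EuclideanHalfSpace 4) M, p ∈ φ.source →
      (Matrix.of fun i j => tangential (components φ g)
        (boundaryCoord (φ.extend (𝓡∂ 4) p)) ![i, j]).PosDef) ∧
    ∀ n : TensorField M 1, IsInwardUnitConormal g n →
      ∀ p : M, Ω p = 0 → ∀ φ ∈ atlas (EuclideanHalfSpace 4) M, p ∈ φ.source →
        BoundaryConstraintsAt Lam (inChart φ Ω) (components φ g) (components φ d) (components φ Q)
          (components φ n) (boundaryCoord (φ.extend (𝓡∂ 4) p)) := by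
  refine ⟨fun p hp φ hφ hpφ => ?_, fun n hn p hp φ hφ hpφ => ?_⟩
  · exact (isBoundaryChart hφ hext hcefe).posDef_tangential
      (boundaryPoint_boundaryCoord_mem hφ hext hp hpφ)
  · exact (isBoundaryChart hφ hext hcefe).boundaryConstraints (isConormalInChart hφ hn)
      (boundaryPoint_boundaryCoord_mem hφ hext hp hpφ)
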